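/- Let $\mathcal N=\mathcal N_0\mathcal N_1\mathcal N_2$ be a square-free positive integer, $\rho=(\mathcal N_0,\mathcal N_1,\mathcal N_2)$, let $k\ge 4$ be an integer, and let $\chi$ be a Dirichlet character modulo $\mathcal N$. For a divisor $m\mid\mathcal N$ let $\chi_m$ be the component of $\chi$ of modulus $m$, so that $\chi=\chi_m\chi_{\mathcal N/m}$. Assume $\chi_{\mathcal N_1}^2=1$. Let $\Gamma_0(\mathcal N)$ be the group of all $\begin{pmatrix}A&B\\C&D\end{pmatrix}\in Sp_2(\mathbb Z)$ (degree 2, with $2\times2$ blocks) with $C\equiv0\pmod{\mathcal N}$. Choose an integral diagonal matrix $M_\rho$ which modulo each prime $p\mid\mathcal N$ is congruent to $0$, $\begin{pmatrix}1&0\\0&0\end{pmatrix}$ or $I$ according as $p\mid\mathcal N_0$, $p\mid\mathcal N_1$ or $p\mid\mathcal N_2$. For $\tau$ in the Siegel upper half space of degree 2, put $$\mathbb E_\rho(\tau)=\tfrac12\sum\overline\chi(\det D_\gamma)\,\det(M\tau+N)^{-k},$$ where $(M\ N)=(M_\rho\ I)\gamma$, $\gamma=\begin{pmatrix}*&*\\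 *&D_\gamma\end{pmatrix}\in\Gamma_0(\mathcal N)$, runs over representatives of the $SL_2(\mathbb Z)$-classes (under left multiplication) in the $\Gamma_0(\mathcal N)$-orbit of $(M_\rho\ I)$. The definition applies likewise, with the same $\mathcal N$ and $\chi$, to any other factorization $\rho'$ of $\mathcal N$ into three factors, provided the square of the component of $\chi$ at the middle factor is $1$. For a prime $p$, let $\delta=\begin{pmatrix}pI&0\\0&I\end{pmatrix}$ and $$f|T(p)=p^{k-3}\sum_\gamma\overline\chi(\det D_\gamma)\,f|\delta^{-1}\gamma,$$ where $\gamma$ runs over representatives of $(\delta\Gamma_0(\mathcal N)\delta^{-1}\cap\Gamma_0(\mathcal N))\backslash\Gamma_0(\mathcal N)$ and, for $\beta=\begin{pmatrix}A&B\\C&D\end{pmatrix}$, $(f|\beta)(\tau)=(\det\beta)^{k/2}\det(C\tau+D)^{-k}f\big((A\tau+B)(C\tau+D)^{-1}\big)$. **Proposition.** Let $q$ be a prime dividing $\mathcal N_1$ and let $\rho'=(\mathcal N_0,\mathcal N_1/q,q\mathcal N_2)$. Then $$\mathbb E_\rho|T(q)=\begin{cases}\chi_{\mathcal N_0\mathcal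 N_2}(q)\big(q^{k-1}\mathbb E_\rho+q^{k-3}(q^2-1)\mathbb E_{\rho'}\big)&\text{if }\chi_q=1,\\ \chi_{\mathcal N_0\mathcal N_2}(q)\,q^{k-1}\mathbb E_\rho&\text{if }\chi_q\neq1.\end{cases}$$ -/

import Mathlib

open Matrix

namespace Siegel

/-- `2 × 2` matrices. -/
abbrev M2 (R : Type*) := Matrix (Fin 2) (Fin 2) R

/-- `Sp₂(ℤ)`: integral symplectic `4 × 4` matrices, written in `2 × 2` blocks `(A B; C D)`. -/
abbrev Sp := Matrix.symplecticGroup (Fin 2) ℤ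

/-- The lower left block `C` of `γ = (A B; C D)`. -/
def blockC (γ : Sp) : M2 ℤ := (γ : Matrix (Fin 2 ⊕ Fin 2) (Fin 2 ⊕ Fin 2) ℤ).toBlocks₂₁

/-- The lower right block `D` of `γ = (A B; C D)`. -/
def blockD (γ : Sp) : M2 ℤ := (γ : Matrix (Fin 2 ⊕ Fin 2) (Fin 2 ⊕ Fin 2) ℤ).toBlocks₂₂

lemma blockC_mul (γ γ' : Sp) :
    blockC (γ * γ') = blockC γ * (γ' : Matrix (Fin 2 ⊕ Fin 2) (Fin 2 ⊕ Fin 2) ℤ).toBlocks₁₁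
      + blockD γ * blockC γ' := by
  simp only [blockC, blockD, Submonoid.coe_mul]
  conv_lhs => rw [← fromBlocks_toBlocks (γ : Matrix (Fin 2 ⊕ Fin 2) (Fin 2 ⊕ Fin 2) ℤ),
    ← fromBlocks_toBlocks (γ' : Matrix (Fin 2 ⊕ Fin 2) (Fin 2 ⊕ Fin 2) ℤ),
    fromBlocks_multiply, toBlocks_fromBlocks₂₁]

lemma blockC_inv (γ : Sp) : blockC γ⁻¹ = -(blockC γ)ᵀ := by
  simp only [blockC, SymplecticGroup.coe_inv]
  conv_lhs => rw [← fromBlocks_toBlocks (γ : Matrix (Fin 2 ⊕ Fin 2) (Fin 2 ⊕ Fin 2) ℤ)]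
  simp [J, fromBlocks_transpose, fromBlocks_multiply, fromBlocks_neg]

/-- `Γ₀(N)`: the elements of `Sp₂(ℤ)` whose lower left block vanishes modulo `N`. -/
def Gamma0 (N : ℕ) : Subgroup Sp where
  carrier := {γ | ∀ i j, (N : ℤ) ∣ blockC γ i j}
  mul_mem' {γ γ'} h h' := by
    intro i j
    rw [blockC_mul]
    simp only [Matrix.add_apply, Matrix.mul_apply]
    exact dvd_add (Finset.dvd_sum fun x _ => (h i x).mul_right _)
      (Finset.dvd_sum fun x _ => (h' x j).mul_left _)
  one_mem' := by
    intro i j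
    simp [blockC, ← fromBlocks_one]
  inv_mem' {γ} h := by
    intro i j
    rw [blockC_inv]
    simpa using h j i

/-- The Siegel upper half space of degree two: `τ = X + iY` with `X`, `Y` real symmetric and `Y`
positive definite. -/
def upperHalfSpace : Set (M2 ℂ) :=
  {τ | τ.IsSymm ∧ (τ.map Complex.im).PosDef}

/-- The factor `1|γ (τ) = det (Cτ + D)^{-k}` for `γ = (* *; C D)`. -/
noncomputable def oneSlash (k : ℕ) (C D : M2 ℤ) (τ : M2 ℂ) : ℂ :=
  (C.map (Int.cast : ℤ → ℂ) * τ + D.map (Int.cast : ℤ → ℂ)).det ^ (-(k : ℤ))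

/-- Two elements `δ, δ'` of `Γ₀(N)` are identified when the pairs `(M N)` and `(M' N')` formed by
the lower blocks of `γ₀ δ` and `γ₀ δ'` are in the same `SL₂(ℤ)`-class: `(M' N') = G (M N)`. Thus
the quotient is the set of `SL₂(ℤ)`-classes in the `Γ₀(N)`-orbit of the lower blocks of `γ₀`. -/
def orbitSetoid (N : ℕ) (γ₀ : Sp) : Setoid (Gamma0 N) where
  r δ δ' := ∃ G : Matrix.SpecialLinearGroup (Fin 2) ℤ,
    blockC (γ₀ * δ') = (G : M2 ℤ) * blockC (γ₀ * δ) ∧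
    blockD (γ₀ * δ') = (G : M2 ℤ) * blockD (γ₀ * δ)
  iseqv :=
    { refl := fun δ => ⟨1, by simp, by simp⟩
      symm := by
        rintro δ δ' ⟨G, hC, hD⟩
        refine ⟨G⁻¹, ?_, ?_⟩
        · rw [hC, ← mul_assoc, ← Matrix.SpecialLinearGroup.coe_mul]; simp
        · rw [hD, ← mul_assoc, ← Matrix.SpecialLinearGroup.coe_mul]; simp
      trans := by
        rintro δ δ' δ'' ⟨G, hC, hD⟩ ⟨G', hC', hD'⟩
        refine ⟨G' * G, ?_, ?_⟩
        · rw [hC', hC, ← mul_assoc, ← Matrix.SpecialLinearGroup.coe_mul]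
        · rw [hD', hD, ← mul_assoc, ← Matrix.SpecialLinearGroup.coe_mul] }

/-- The Eisenstein series attached to the cusp `Γ_∞ γ₀ Γ₀(N)`:
`2 E_{γ₀}(τ) = ∑ conj χ(det D_δ) · 1|(γ₀ δ) (τ)`, where `γ₀ δ` (`δ ∈ Γ₀(N)`) runs over
representatives for the `SL₂(ℤ)`-classes in the `Γ₀(N)`-orbit. Every class under
`Γ_∞` (that is, under `GL₂(ℤ)`) splits into two `SL₂(ℤ)`-classes, whence the `1/2`; when
`χ(-1) = (-1)^k` the two contribute equally and this is the sum over `Γ_∞`-cosets, and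
otherwise they cancel. The summand does not depend on the representative if `χ_q² = 1` for
all primes `q ∣ N` at which the lower left block of `γ₀` has rank one. -/
noncomputable def eisenstein (N k : ℕ) (χ : DirichletCharacter ℂ N) (γ₀ : Sp) (τ : M2 ℂ) : ℂ :=
  (1 / 2) * ∑' c : Quotient (orbitSetoid N γ₀),
    (starRingEnd ℂ) (χ (((blockD (c.out : Sp)).det : ℤ) : ZMod N)) *
      oneSlash k (blockC (γ₀ * (c.out : Sp))) (blockD (γ₀ * (c.out : Sp))) τ

/-- `γ = (I 0; M I)` with `M = diag(d 0, d 1)`. -/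
def cuspElt (d : Fin 2 → ℤ) : Sp :=
  ⟨fromBlocks 1 0 (diagonal d) 1, by
    rw [SymplecticGroup.fromBlocks_mem_iff]
    simp⟩

/-- `M = diag(d 0, d 1)` is an admissible choice of `M_ρ` for `ρ = (N₀, N₁, N₂)`: modulo each prime
`q ∣ N₀ N₁ N₂` it is `0`, `diag(1, 0)` or `I` according as `q ∣ N₀`, `q ∣ N₁` or `q ∣ N₂`. -/
def IsCuspDiag (N₀ N₁ N₂ : ℕ) (d : Fin 2 → ℤ) : Prop :=
  ∀ q : ℕ, q.Prime →
    (q ∣ N₀ → (diagonal d).map (Int.cast : ℤ → ZMod q) = 0) ∧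
    (q ∣ N₁ → (diagonal d).map (Int.cast : ℤ → ZMod q) = !![1, 0; 0, 0]) ∧
    (q ∣ N₂ → (diagonal d).map (Int.cast : ℤ → ZMod q) = 1)

open Classical in
/-- For `N = M M'` with `M, M'` coprime, a character `χ` modulo `N` is uniquely a product
`χ_M χ_{M'}` of characters modulo `M` and `M'`; this is `χ_M`. On a unit `a` modulo `M` it is
`χ(b)` with `b ≡ a (M)`, `b ≡ 1 (M')`. (Junk value `1` if `M ∤ N` or `M`, `N / M` are not
coprime.) -/
noncomputable def component {N : ℕ} (χ : DirichletCharacter ℂ N) (M : ℕ) :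
    DirichletCharacter ℂ M :=
  if h : M * (N / M) = N ∧ M.Coprime (N / M) then
    MulChar.ofUnitHom
      ((MulChar.toUnitHom χ).comp
        ((Units.map ((ZMod.ringEquivCongr h.1).toRingHom.toMonoidHom.comp
            (ZMod.chineseRemainder h.2).symm.toRingHom.toMonoidHom)).comp
          ((MulEquiv.prodUnits (M := ZMod M) (N := ZMod (N / M))).symm.toMonoidHom.comp
            (MonoidHom.inl (ZMod M)ˣ (ZMod (N / M))ˣ))))
  else 1

/-- `f|γ (τ) = (det γ)^{k/2} det (Cτ + D)^{-k} f((Aτ + B)(Cτ + D)⁻¹)` for a real matrix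
`γ = (A B; C D)` of positive determinant. Functions on the upper half space are given on all
complex `2 × 2` matrices; only their values on the upper half space matter. -/
noncomputable def slash (k : ℕ) (f : M2 ℂ → ℂ) (γ : Matrix (Fin 2 ⊕ Fin 2) (Fin 2 ⊕ Fin 2) ℝ)
    (τ : M2 ℂ) : ℂ :=
  let A : M2 ℂ := γ.toBlocks₁₁.map Complex.ofReal
  let B : M2 ℂ := γ.toBlocks₁₂.map Complex.ofReal
  let C : M2 ℂ := γ.toBlocks₂₁.map Complex.ofReal
  let D : M2 ℂ := γ.toBlocks₂₂.map Complex.ofReal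
  ((γ.det ^ ((k : ℝ) / 2) : ℝ) : ℂ) * (C * τ + D).det ^ (-(k : ℤ)) *
    f ((A * τ + B) * (C * τ + D)⁻¹)

/-- `δ = diag(p I, I)`. -/
def heckeDelta (p : ℕ) (R : Type*) [CommRing R] : Matrix (Fin 2 ⊕ Fin 2) (Fin 2 ⊕ Fin 2) R :=
  fromBlocks ((p : R) • (1 : M2 R)) 0 0 1

/-- `δ Γ₀(N) δ⁻¹ ∩ Γ₀(N)` as a subgroup of `Γ₀(N)`: the `γ` in `Γ₀(N)` such that `γ δ = δ γ'` for some
`γ'` in `Γ₀(N)`. -/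
def heckeSubgroup (N p : ℕ) : Subgroup (Gamma0 N) where
  carrier := {γ | ∃ γ' : Gamma0 N,
    ((γ : Sp) : Matrix (Fin 2 ⊕ Fin 2) (Fin 2 ⊕ Fin 2) ℤ) * heckeDelta p ℤ =
      heckeDelta p ℤ * ((γ' : Sp) : Matrix (Fin 2 ⊕ Fin 2) (Fin 2 ⊕ Fin 2) ℤ)}
  mul_mem' := by
    rintro γ₁ γ₂ ⟨γ₁', h₁⟩ ⟨γ₂', h₂⟩
    refine ⟨γ₁' * γ₂', ?_⟩
    simp only [Subgroup.coe_mul, Submonoid.coe_mul]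
    rw [Matrix.mul_assoc, h₂, ← Matrix.mul_assoc, h₁, Matrix.mul_assoc]
  one_mem' := ⟨1, by simp⟩
  inv_mem' := by
    rintro γ ⟨γ', h⟩
    refine ⟨γ'⁻¹, ?_⟩
    have e₁ : (((γ⁻¹ : Gamma0 N) : Sp) : Matrix (Fin 2 ⊕ Fin 2) (Fin 2 ⊕ Fin 2) ℤ) *
        ((γ : Sp) : Matrix (Fin 2 ⊕ Fin 2) (Fin 2 ⊕ Fin 2) ℤ) = 1 := by
      rw [← Submonoid.coe_mul, ← Subgroup.coe_mul, inv_mul_cancel]; rfl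
    have e₂ : ((γ' : Sp) : Matrix (Fin 2 ⊕ Fin 2) (Fin 2 ⊕ Fin 2) ℤ) *
        (((γ'⁻¹ : Gamma0 N) : Sp) : Matrix (Fin 2 ⊕ Fin 2) (Fin 2 ⊕ Fin 2) ℤ) = 1 := by
      rw [← Submonoid.coe_mul, ← Subgroup.coe_mul, mul_inv_cancel]; rfl
    calc _ = (((γ⁻¹ : Gamma0 N) : Sp) : Matrix (Fin 2 ⊕ Fin 2) (Fin 2 ⊕ Fin 2) ℤ) *
          (heckeDelta p ℤ * ((γ' : Sp) : Matrix (Fin 2 ⊕ Fin 2) (Fin 2 ⊕ Fin 2) ℤ)) *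
          (((γ'⁻¹ : Gamma0 N) : Sp) : Matrix (Fin 2 ⊕ Fin 2) (Fin 2 ⊕ Fin 2) ℤ) := by
            rw [Matrix.mul_assoc, Matrix.mul_assoc, e₂, Matrix.mul_one]
      _ = _ := by rw [← h, ← Matrix.mul_assoc, e₁, Matrix.one_mul]

/-- The Hecke operator `T(p)` in weight `k`, level `N` and character `χ`:
`f|T(p) = p^{k-3} ∑ conj χ(det D_γ) f|δ⁻¹γ`, with `γ` running over representatives for
`(δ Γ₀(N) δ⁻¹ ∩ Γ₀(N)) \ Γ₀(N)`, a finite set. For `f` of weight `k`, level `N` and character `χ` the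
summand does not depend on the representative. -/
noncomputable def heckeT (N k : ℕ) (χ : DirichletCharacter ℂ N) (p : ℕ) (f : M2 ℂ → ℂ)
    (τ : M2 ℂ) : ℂ :=
  (p : ℂ) ^ ((k : ℤ) - 3) * ∑ᶠ c : Quotient (QuotientGroup.rightRel (heckeSubgroup N p)),
    (starRingEnd ℂ) (χ (((blockD (c.out : Sp)).det : ℤ) : ZMod N)) *
      slash k f ((heckeDelta p ℝ)⁻¹ *
        ((c.out : Sp) : Matrix (Fin 2 ⊕ Fin 2) (Fin 2 ⊕ Fin 2) ℤ).map (Int.cast : ℤ → ℝ)) τ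

end Siegel

/-! Attach to a symmetric pair (M N) its Plücker coordinates v = (a, Q, d), with a = det M, d = det
N and Q = adj(N) M symmetric. They satisfy det Q = a d, and det(Mτ + N) = a det τ + tr(Qτ) + d is
linear in v (`SymmPair.det_eq_lin`). Every primitive integral point of this cone comes from a
symplectic matrix (`exists_plucker_eq`), and it determines the `SL₂(ℤ)`-class
(`exists_sl_of_plucker_eq`). For square-free N the orbit of a cusp is cut out by the rank of M
modulo each p ∣ N (`exists_gamma0_plucker_eq`). The character value factors over these primes: for
rank 0, 1, 2 the factor is conj χ_p(d), χ_p of a nonzero diagonal entry of Q, or χ_p(a)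
(`weight_orbit`). So twice the Eisenstein series is a sum over all v of `weight` times a power of a
linear form (`CuspData.eisenstein_eq_tsum`).

Since q ∣ N, the operator T(q) is q^{-3} times the sum of f((τ + S)/q) over symmetric S modulo q
(`CuspData.heckeT_eq`). On coordinates, the coefficient of the image at v collects, over all S with
q ∣ d - tr(QS) + a det S, the coefficients at (qa, Q - a adj S, (d - tr(QS) + a det S)/q). At p ≠ q
this multiplies the local factor by χ_p(q), or by 1 if the rank is one; together this gives the
value at q of the component of modulus N₀N₂.

At q a count over the finite field remains (`sum_singularChar_translate`). If q ∣ a, then Q is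
unchanged and the condition on S is a nontrivial linear equation with q² solutions, which gives back
the old series. If q ∤ a, then S ↦ Q - a adj S runs through all symmetric matrices and the condition
says that the image is singular. The total is q + 1 times the sum of all values of χ_q: it is q² - 1
for trivial χ_q and 0 otherwise. Since q ∤ a means rank two at q, this is the series of the second
cusp.

Rearranging the series needs absolute convergence for k ≥ 4. This follows from a lower bound for the
linear form on the cone (`exists_mul_norm_le_realLin`) and from a divisor bound for the number of
points on the cone (`summable_height_cone`). -/

namespace Siegel

/-! ### Plücker coordinates and the quadric cone. -/

/-- Integral symmetric pairs `(M N)` up to `SL₂(ℤ)` are recorded by their Plücker coordinates: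
`a = det M`, `d = det N` and the symmetric matrix `(x y; y z) = adj(N) M`. -/
@[ext] structure Plucker where
  /-- `det M` -/
  a : ℤ
  /-- upper left entry of `adj(N) M` -/
  x : ℤ
  /-- off-diagonal entry of `adj(N) M` -/
  y : ℤ
  /-- lower right entry of `adj(N) M` -/
  z : ℤ
  /-- `det N` -/
  d : ℤ

namespace Plucker

/-- The quadric cone containing the Plücker coordinates of symmetric pairs. -/
def IsCone (v : Plucker) : Prop := v.x * v.z - v.y ^ 2 = v.a * v.d

/-- The prime `p` divides all coordinates. -/
def DvdAll (p : ℤ) (v : Plucker) : Prop := p ∣ v.a ∧ p ∣ v.x ∧ p ∣ v.y ∧ p ∣ v.z ∧ p ∣ v.d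

/-- The coordinates have no common prime factor. -/
def IsPrimitive (v : Plucker) : Prop := ∀ p : ℕ, p.Prime → ¬ v.DvdAll p

/-- The function `det(Mτ + N)` in terms of Plücker coordinates. -/
noncomputable def lin (v : Plucker) (τ : M2 ℂ) : ℂ :=
  v.a * τ.det + v.x * τ 0 0 + v.y * (τ 0 1 + τ 1 0) + v.z * τ 1 1 + v.d

/-- The Plücker coordinates of the pair `(M N)`. -/
def ofPair (M N : M2 ℤ) : Plucker where
  a := M 0 0 * M 1 1 - M 0 1 * M 1 0
  x := N 1 1 * M 0 0 - N 0 1 * M 1 0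
  y := N 1 1 * M 0 1 - N 0 1 * M 1 1
  z := N 0 0 * M 1 1 - N 1 0 * M 0 1
  d := N 0 0 * N 1 1 - N 0 1 * N 1 0

end Plucker

/-- `M Nᵀ` is symmetric. -/
def SymmPair (M N : M2 ℤ) : Prop :=
  M 0 0 * N 1 0 + M 0 1 * N 1 1 = M 1 0 * N 0 0 + M 1 1 * N 0 1

open Plucker

lemma SymmPair.isCone {M N : M2 ℤ} (h : SymmPair M N) : (ofPair M N).IsCone := by
  simp only [SymmPair, IsCone, ofPair] at *
  linear_combination (-N 1 1 * M 0 1 + N 0 1 * M 1 1) * h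

lemma SymmPair.det_eq_lin {M N : M2 ℤ} (h : SymmPair M N) (τ : M2 ℂ) :
    (M.map (Int.cast : ℤ → ℂ) * τ + N.map (Int.cast : ℤ → ℂ)).det = (ofPair M N).lin τ := by
  have h' : (M 0 0 * N 1 0 + M 0 1 * N 1 1 : ℂ) = M 1 0 * N 0 0 + M 1 1 * N 0 1 := by
    exact_mod_cast h
  simp only [lin, ofPair, det_fin_two, Matrix.add_apply, mul_apply, Fin.sum_univ_two, map_apply]
  push_cast
  linear_combination (- τ 0 1) * h'

/-- Translation `(M N) ↦ (M, N + M S)` by the symmetric matrix `S = (s t; t u)`. -/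
def Plucker.trans (s t u : ℤ) (v : Plucker) : Plucker where
  a := v.a
  x := v.x + v.a * u
  y := v.y - v.a * t
  z := v.z + v.a * s
  d := v.d + v.x * s + 2 * v.y * t + v.z * u + v.a * (s * u - t ^ 2)

lemma Plucker.IsCone.trans {v : Plucker} (h : v.IsCone) (s t u : ℤ) : (v.trans s t u).IsCone := by
  simp only [IsCone, Plucker.trans] at *
  linear_combination h

/-- Every integral point of the cone comes from a symmetric pair with singular `M`, if `a = 0`. -/
lemma exists_pair_of_a_eq_zero (v : Plucker) (hv : v.IsCone) (ha : v.a = 0) :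
    ∃ M N : M2 ℤ, SymmPair M N ∧ ofPair M N = v := by
  obtain ⟨a, x, y, z, d⟩ := v
  simp only [IsCone] at hv ha
  subst ha
  -- A singular integral binary form is an integer times the square of a primitive linear form.
  have key : ∃ u s t : ℤ, IsCoprime s t ∧ x = u * s ^ 2 ∧ y = u * s * t ∧ z = u * t ^ 2 := by
    by_cases hx : x = 0
    · have hy : y = 0 := by
        subst hx
        have : y ^ 2 = 0 := by linarith
        exact pow_eq_zero_iff (two_ne_zero) |>.1 this
      exact ⟨z, 0, 1, isCoprime_one_right, by simp [hx], by simp [hy], by simp⟩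
    · obtain ⟨s, t, hg, hst, h1, h2⟩ : ∃ s t : ℤ, (Int.gcd x y : ℤ) ≠ 0 ∧ IsCoprime s t ∧
          x = Int.gcd x y * s ∧ y = Int.gcd x y * t := by
        have hg : 0 < Int.gcd x y := Int.gcd_pos_of_ne_zero_left _ hx
        obtain ⟨s, t, h, h1, h2⟩ := Int.exists_gcd_one hg
        exact ⟨s, t, by exact_mod_cast hg.ne', Int.isCoprime_iff_gcd_eq_one.2 h,
          by rw [mul_comm]; exact h1, by rw [mul_comm]; exact h2⟩
      set g : ℤ := ((Int.gcd x y : ℕ) : ℤ)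
      have h3 : s * z = g * t ^ 2 := by
        apply mul_left_cancel₀ hg
        have : x * z = y ^ 2 := by linarith
        rw [h1, h2] at this
        linear_combination this
      have h4 : s ∣ g := by
        have : IsCoprime s (t ^ 2) := hst.pow_right
        exact this.dvd_of_dvd_mul_right ⟨z, h3.symm⟩
      obtain ⟨u, hu⟩ := h4
      have hs : s ≠ 0 := by rintro rfl; simp at h1; exact hx h1
      refine ⟨u, s, t, hst, by rw [h1, hu]; ring, by rw [h2, hu]; ring, ?_⟩
      apply mul_left_cancel₀ hs
      rw [h3, hu]; ring
  obtain ⟨u, s, t, ⟨p, q, hpq⟩, rfl, rfl, rfl⟩ := key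
  -- The row (-t, s) annihilates the linear form (s, t); the Bézout row (p, q), scaled by d, makes
  -- the determinant of N equal to d.
  refine ⟨!![u * s, u * t; 0, 0], !![d * p, d * q; -t, s], ?_, ?_⟩
  · simp [SymmPair]; ring
  · simp only [ofPair, Plucker.mk.injEq, of_apply, cons_val', cons_val_zero, cons_val_one,
      cons_val_fin_one]
    refine ⟨by ring, by ring, by ring, by ring, ?_⟩
    linear_combination d * hpq

/-- Every integral point of the cone comes from a symmetric pair. -/
lemma exists_pair (v : Plucker) (hv : v.IsCone) : ∃ M N : M2 ℤ, SymmPair M N ∧ ofPair M N = v := by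
  induction hn : v.a.natAbs using Nat.strong_induction_on generalizing v with
  | _ n ih =>
  by_cases ha : v.a = 0
  · exact exists_pair_of_a_eq_zero v hv ha
  -- Euclidean step: a translation reduces x, y, z modulo a. The cone equation then gives |a||d| <
  -- a², so |d| < |a|.
  · set w : Plucker := v.trans (-(v.z / v.a)) (v.y / v.a) (-(v.x / v.a)) with hw
    have hwc : w.IsCone := hv.trans _ _ _
    have hwx : w.x = v.x % v.a := by simp [hw, Plucker.trans, Int.emod_def]; ring
    have hwy : w.y = v.y % v.a := by simp [hw, Plucker.trans, Int.emod_def]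
    have hwz : w.z = v.z % v.a := by simp [hw, Plucker.trans, Int.emod_def]; ring
    have hwa : w.a = v.a := rfl
    have hlt : w.d.natAbs < n := by
      rw [← hn]
      have hpos : 0 < |v.a| := abs_pos.2 ha
      zify
      have bx := Int.emod_nonneg v.x ha
      have bx' := Int.emod_lt_abs v.x ha
      have bz := Int.emod_nonneg v.z ha
      have bz' := Int.emod_lt_abs v.z ha
      have bY := Int.emod_nonneg v.y ha
      have bY' := Int.emod_lt_abs v.y ha
      rw [← hwx] at bx bx'
      rw [← hwy] at bY bY'
      rw [← hwz] at bz bz'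
      have e : |v.a| * |w.d| = |w.x * w.z - w.y ^ 2| := by
        rw [← abs_mul, ← hwa, ← hwc]
      have : |w.x * w.z - w.y ^ 2| < |v.a| * |v.a| := by
        rw [abs_lt]; constructor <;> nlinarith
      rw [← e] at this
      exact lt_of_mul_lt_mul_left this hpos.le
    -- The rotation (M N) ↦ (N, -M) exchanges a and d; the induction hypothesis applies to the
    -- rotated point, and rotation and translation are then undone.
    obtain ⟨M, N, hs, hMN⟩ := ih _ hlt ⟨w.d, -w.z, w.y, -w.x, w.a⟩
      (by simp only [IsCone] at *; linear_combination hwc) rfl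
    set s := -(v.z / v.a)
    set t := v.y / v.a
    set u := -(v.x / v.a)
    refine ⟨N, -M - N * !![s, t; t, u], ?_, ?_⟩
    · simp only [SymmPair, Matrix.sub_apply, Matrix.neg_apply, mul_apply, Fin.sum_univ_two, of_apply,
        cons_val', cons_val_zero, cons_val_one, cons_val_fin_one] at hs ⊢
      linear_combination hs
    · have e : v = w.trans (-s) (-t) (-u) := by
        ext <;> simp only [hw, Plucker.trans] <;> ring
      rw [e]
      simp only [ofPair, Plucker.mk.injEq] at hMN
      obtain ⟨h1, h2, h3, h4, h5⟩ := hMN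
      simp only [SymmPair] at hs
      simp only [Plucker.trans, ← h5, ← h1, Plucker.ext_iff, ofPair, Matrix.sub_apply,
        Matrix.neg_apply, mul_apply, Fin.sum_univ_two, of_apply,
        cons_val', cons_val_zero, cons_val_one, cons_val_fin_one]
      refine ⟨trivial, ?_, ?_, ?_, ?_⟩
      · linear_combination -h4
      · linear_combination h3
      · linear_combination -h2
      · linear_combination h4 * s - 2 * h3 * t + h2 * u + hs * t

/-! ### Blocks of symplectic matrices and their relations. -/

/-- The upper left block `A` of `γ = (A B; C D)`. -/
def blockA (γ : Sp) : M2 ℤ := (γ : Matrix (Fin 2 ⊕ Fin 2) (Fin 2 ⊕ Fin 2) ℤ).toBlocks₁₁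

/-- The upper right block `B` of `γ = (A B; C D)`. -/
def blockB (γ : Sp) : M2 ℤ := (γ : Matrix (Fin 2 ⊕ Fin 2) (Fin 2 ⊕ Fin 2) ℤ).toBlocks₁₂

lemma coe_eq_fromBlocks (γ : Sp) : (γ : Matrix (Fin 2 ⊕ Fin 2) (Fin 2 ⊕ Fin 2) ℤ) =
    fromBlocks (blockA γ) (blockB γ) (blockC γ) (blockD γ) :=
  (fromBlocks_toBlocks _).symm

lemma mul_fromBlocks (γ γ' : Sp) : ((γ * γ' : Sp) : Matrix (Fin 2 ⊕ Fin 2) (Fin 2 ⊕ Fin 2) ℤ) =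
    fromBlocks (blockA γ * blockA γ' + blockB γ * blockC γ')
      (blockA γ * blockB γ' + blockB γ * blockD γ')
      (blockC γ * blockA γ' + blockD γ * blockC γ')
      (blockC γ * blockB γ' + blockD γ * blockD γ') := by
  rw [Submonoid.coe_mul, coe_eq_fromBlocks γ, coe_eq_fromBlocks γ', fromBlocks_multiply]

lemma blockA_mul (γ γ' : Sp) :
    blockA (γ * γ') = blockA γ * blockA γ' + blockB γ * blockC γ' := by
  rw [blockA, mul_fromBlocks, toBlocks_fromBlocks₁₁]

lemma blockB_mul (γ γ' : Sp) :
    blockB (γ * γ') = blockA γ * blockB γ' + blockB γ * blockD γ' := by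
  rw [blockB, mul_fromBlocks, toBlocks_fromBlocks₁₂]

lemma blockC_mul_blocks (γ γ' : Sp) :
    blockC (γ * γ') = blockC γ * blockA γ' + blockD γ * blockC γ' := by
  rw [blockC, mul_fromBlocks, toBlocks_fromBlocks₂₁]

lemma blockD_mul (γ γ' : Sp) :
    blockD (γ * γ') = blockC γ * blockB γ' + blockD γ * blockD γ' := by
  rw [blockD, mul_fromBlocks, toBlocks_fromBlocks₂₂]

lemma column_relations (γ : Sp) :
    (blockA γ)ᵀ * blockC γ = (blockC γ)ᵀ * blockA γ ∧
    (blockB γ)ᵀ * blockD γ = (blockD γ)ᵀ * blockB γ ∧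
    (blockA γ)ᵀ * blockD γ - (blockC γ)ᵀ * blockB γ = 1 := by
  have h := γ.2
  rw [coe_eq_fromBlocks γ] at h
  exact SymplecticGroup.fromBlocks_mem_iff.1 h

lemma mem_symplectic_iff_rows {A B C D : M2 ℤ} :
    fromBlocks A B C D ∈ Matrix.symplecticGroup (Fin 2) ℤ ↔
      A * Bᵀ = B * Aᵀ ∧ C * Dᵀ = D * Cᵀ ∧ A * Dᵀ - B * Cᵀ = 1 := by
  rw [← SymplecticGroup.transpose_mem_iff, fromBlocks_transpose, SymplecticGroup.fromBlocks_mem_iff]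
  simp only [transpose_transpose]

lemma row_relations (γ : Sp) :
    blockA γ * (blockB γ)ᵀ = blockB γ * (blockA γ)ᵀ ∧
    blockC γ * (blockD γ)ᵀ = blockD γ * (blockC γ)ᵀ ∧
    blockA γ * (blockD γ)ᵀ - blockB γ * (blockC γ)ᵀ = 1 := by
  have h := γ.2
  rw [coe_eq_fromBlocks γ] at h
  exact mem_symplectic_iff_rows.1 h

/-- The symplectic matrix with given blocks. -/
def ofBlocks (A B C D : M2 ℤ) (h : A * Bᵀ = B * Aᵀ ∧ C * Dᵀ = D * Cᵀ ∧ A * Dᵀ - B * Cᵀ = 1) : Sp :=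
  ⟨fromBlocks A B C D, mem_symplectic_iff_rows.2 h⟩

section ofBlocks
variable (A B C D : M2 ℤ) (h : A * Bᵀ = B * Aᵀ ∧ C * Dᵀ = D * Cᵀ ∧ A * Dᵀ - B * Cᵀ = 1)
@[simp] lemma blockA_ofBlocks : blockA (ofBlocks A B C D h) = A := toBlocks_fromBlocks₁₁ _ _ _ _
@[simp] lemma blockB_ofBlocks : blockB (ofBlocks A B C D h) = B := toBlocks_fromBlocks₁₂ _ _ _ _
@[simp] lemma blockC_ofBlocks : blockC (ofBlocks A B C D h) = C := toBlocks_fromBlocks₂₁ _ _ _ _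
@[simp] lemma blockD_ofBlocks : blockD (ofBlocks A B C D h) = D := toBlocks_fromBlocks₂₂ _ _ _ _
end ofBlocks

lemma symmPair_iff {M N : M2 ℤ} : SymmPair M N ↔ M * Nᵀ = N * Mᵀ := by
  rw [← Matrix.ext_iff]
  simp only [Fin.forall_fin_two, mul_apply, Fin.sum_univ_two, transpose_apply, SymmPair]
  constructor
  · intro h
    exact ⟨⟨by ring, by linear_combination h⟩, ⟨by linear_combination -h, by ring⟩⟩
  · rintro ⟨⟨-, h⟩, -⟩
    linear_combination h

lemma symmPair_blocks (γ : Sp) : SymmPair (blockC γ) (blockD γ) :=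
  symmPair_iff.2 (row_relations γ).2.1

/-- The Plücker coordinates of the lower blocks of `γ`. -/
def plucker (γ : Sp) : Plucker := ofPair (blockC γ) (blockD γ)

lemma isCone_plucker (γ : Sp) : (plucker γ).IsCone := (symmPair_blocks γ).isCone

/-- Cauchy–Binet: the determinant is bilinear in the 2 × 2 minors of (C D) and of (A B), and
symmetry of the pair eliminates one of the six minors of (C D). Hence the value depends on (C D)
only through its Plücker coordinates. -/
lemma SymmPair.det_sub_eq {C D : M2 ℤ} (h : SymmPair C D) (A B : M2 ℤ) :
    (D * Aᵀ - C * Bᵀ).det =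
      (ofPair C D).d * (A 0 0 * A 1 1 - A 1 0 * A 0 1)
      + (ofPair C D).y * (A 1 0 * B 0 0 - A 0 0 * B 1 0 + A 0 1 * B 1 1 - A 1 1 * B 0 1)
      + (ofPair C D).z * (A 1 0 * B 0 1 - A 0 0 * B 1 1)
      + (ofPair C D).x * (A 0 1 * B 1 0 - A 1 1 * B 0 0)
      + (ofPair C D).a * (B 0 0 * B 1 1 - B 1 0 * B 0 1) := by
  simp only [SymmPair] at h
  simp only [ofPair, det_fin_two, Matrix.sub_apply, mul_apply, Fin.sum_univ_two, transpose_apply]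
  linear_combination (A 0 0 * B 1 0 - A 1 0 * B 0 0) * h

lemma row_relation' (γ : Sp) : blockD γ * (blockA γ)ᵀ - blockC γ * (blockB γ)ᵀ = 1 := by
  have h := congrArg transpose (row_relations γ).2.2
  simpa [transpose_sub, transpose_mul] using h

/-- By `SymmPair.det_sub_eq`, 1 = det(D Aᵀ - C Bᵀ) is an integral combination of the coordinates. -/
lemma isPrimitive_plucker (γ : Sp) : (plucker γ).IsPrimitive := by
  rintro p hp ⟨h1, h2, h3, h4, h5⟩
  have h := (symmPair_blocks γ).det_sub_eq (blockA γ) (blockB γ)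
  rw [row_relation', det_one] at h
  have : (p : ℤ) ∣ 1 := by
    rw [h]
    exact (((((h5.mul_right _).add (h3.mul_right _)).add (h4.mul_right _)).add
      (h2.mul_right _)).add (h1.mul_right _))
  exact hp.one_lt.ne' (by exact_mod_cast Int.eq_one_of_dvd_one (by positivity) this)

/-! ### Primitive points of the cone are the `SL₂(ℤ)`-classes. -/

/-- Symmetric pairs with the same Plücker coordinates span isotropic lattices which are orthogonal
to each other. -/
lemma SymmPair.mul_transpose_eq {C D C' D' A B : M2 ℤ} (h : SymmPair C D) (h' : SymmPair C' D')
    (hv : ofPair C D = ofPair C' D') (h1 : D * Aᵀ - C * Bᵀ = 1) :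
    C' * Dᵀ = D' * Cᵀ := by
  set K := C' * Dᵀ - D' * Cᵀ with hK
  set E : M2 ℤ := !![0, 1; -1, 0] with hE
  simp only [SymmPair] at h h'
  simp only [ofPair, Plucker.mk.injEq] at hv
  obtain ⟨ha, hx, hy, hz, hd⟩ := hv
  -- The entries of Dᵀ E C and Cᵀ E C are Plücker coordinates, so C and D may be replaced by C' and
  -- D' there. This turns K E C into (C' D'ᵀ - D' C'ᵀ) E C', which vanishes by symmetry. The same
  -- argument gives K E D = 0.
  have e1 : K * E * C = 0 := by
    ext i j
    fin_cases i <;> fin_cases j <;>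
    simp [hK, hE, mul_apply, Fin.sum_univ_two]
    · linear_combination D' 0 1 * ha + C' 0 0 * (hy - h + h') - C' 0 1 * hx - C' 0 0 * h'
    · linear_combination -D' 0 0 * ha + C' 0 0 * hz - C' 0 1 * hy - C' 0 1 * h'
    · linear_combination D' 1 1 * ha + C' 1 0 * (hy - h + h') - C' 1 1 * hx - C' 1 0 * h'
    · linear_combination -D' 1 0 * ha + C' 1 0 * hz - C' 1 1 * hy - C' 1 1 * h'
  have e2 : K * E * D = 0 := by
    ext i j
    fin_cases i <;> fin_cases j <;>
    simp [hK, hE, mul_apply, Fin.sum_univ_two]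
    · linear_combination -D' 0 0 * (-hy + h - h') + D' 0 1 * hz - C' 0 1 * hd - D' 0 0 * h'
    · linear_combination -D' 0 0 * hx - D' 0 1 * hy + C' 0 0 * hd - D' 0 1 * h'
    · linear_combination -D' 1 0 * (-hy + h - h') + D' 1 1 * hz - C' 1 1 * hd - D' 1 0 * h'
    · linear_combination -D' 1 0 * hx - D' 1 1 * hy + C' 1 0 * hd - D' 1 1 * h'
  have e3 : K * E = 0 := by
    calc K * E = K * E * (D * Aᵀ - C * Bᵀ) := by rw [h1, Matrix.mul_one]
      _ = K * E * D * Aᵀ - K * E * C * Bᵀ := by simp only [Matrix.mul_sub, Matrix.mul_assoc]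
      _ = 0 := by rw [e1, e2]; simp
  have e4 : K = 0 := by
    have hEE : E * (-E) = 1 := by
      ext i j; fin_cases i <;> fin_cases j <;> simp [hE]
    calc K = K * (E * (-E)) := by rw [hEE, Matrix.mul_one]
      _ = K * E * (-E) := by rw [Matrix.mul_assoc]
      _ = 0 := by rw [e3]; simp
  exact sub_eq_zero.1 e4

/-- Symplectic matrices whose lower blocks have the same Plücker coordinates have lower blocks in
the same `SL₂(ℤ)`-class. -/
lemma exists_sl_of_plucker_eq {γ γ' : Sp} (hv : plucker γ = plucker γ') :
    ∃ G : Matrix.SpecialLinearGroup (Fin 2) ℤ,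
      blockC γ' = (G : M2 ℤ) * blockC γ ∧ blockD γ' = (G : M2 ℤ) * blockD γ := by
  have hK := (symmPair_blocks γ).mul_transpose_eq (symmPair_blocks γ') hv (row_relation' γ)
  obtain ⟨c1, c2, c3⟩ := column_relations γ
  have c4 : (blockD γ)ᵀ * blockA γ - (blockB γ)ᵀ * blockC γ = 1 := by
    have h := congrArg transpose c3
    simpa [transpose_sub, transpose_mul] using h
  -- This is the lower right block of γ' γ⁻¹, whose lower left block vanishes by `hK`. Its
  -- determinant equals the one for γ' = γ, which is 1.
  refine ⟨⟨blockD γ' * (blockA γ)ᵀ - blockC γ' * (blockB γ)ᵀ, ?_⟩, ?_, ?_⟩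
  · have h1 := (symmPair_blocks γ).det_sub_eq (blockA γ) (blockB γ)
    rw [row_relation', det_one] at h1
    have h2 := (symmPair_blocks γ').det_sub_eq (blockA γ) (blockB γ)
    rw [h2, h1]
    rw [plucker, plucker] at hv
    rw [hv]
  · simp only [Matrix.sub_mul, Matrix.mul_assoc, c1]
    rw [← Matrix.mul_assoc (blockD γ'), ← hK, Matrix.mul_assoc, ← Matrix.mul_sub, c4, Matrix.mul_one]
  · simp only [Matrix.sub_mul, Matrix.mul_assoc, c2]
    rw [← Matrix.mul_assoc (blockC γ'), hK, Matrix.mul_assoc, ← Matrix.mul_sub, c3, Matrix.mul_one]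

lemma ofPair_sl_mul (G : Matrix.SpecialLinearGroup (Fin 2) ℤ) (M N : M2 ℤ) :
    ofPair ((G : M2 ℤ) * M) ((G : M2 ℤ) * N) = ofPair M N := by
  have h := G.2
  rw [det_fin_two] at h
  simp only [ofPair, mul_apply, Fin.sum_univ_two, Plucker.mk.injEq]
  refine ⟨?_, ?_, ?_, ?_, ?_⟩
  · linear_combination (M 0 0 * M 1 1 - M 0 1 * M 1 0) * h
  · linear_combination (N 1 1 * M 0 0 - N 0 1 * M 1 0) * h
  · linear_combination (N 1 1 * M 0 1 - N 0 1 * M 1 1) * h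
  · linear_combination (N 0 0 * M 1 1 - N 1 0 * M 0 1) * h
  · linear_combination (N 0 0 * N 1 1 - N 0 1 * N 1 0) * h

/-- A symmetric pair whose maximal minors generate the unit ideal is the lower half of a symplectic
matrix. -/
lemma SymmPair.exists_sp {M N : M2 ℤ} (h : SymmPair M N)
    (hb : ∃ r s t u w : ℤ, r * (ofPair M N).a + s * (ofPair M N).x + t * (ofPair M N).y
      + u * (ofPair M N).z + w * (ofPair M N).d = 1) :
    ∃ γ : Sp, blockC γ = M ∧ blockD γ = N := by
  obtain ⟨r, s, t, u, w, hb⟩ := hb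
  -- X and Y combine adjugate-type matrices with the Bézout coefficients, so that M X + N Y is the
  -- identity.
  set X : M2 ℤ := !![r * M 1 1 + s * N 1 1 , -(r * M 0 1) - s * N 0 1;
    -(r * M 1 0) + t * N 1 1 - u * N 1 0, r * M 0 0 - t * N 0 1 + u * N 0 0] with hX
  set Y : M2 ℤ := !![w * N 1 1 + u * M 1 1, -(w * N 0 1) - u * M 0 1;
    -(w * N 1 0) - s * M 1 0 - t * M 1 1, w * N 0 0 + s * M 0 0 + t * M 0 1] with hY
  have hXY : M * X + N * Y = 1 := by
    simp only [ofPair] at hb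
    ext i j
    fin_cases i <;> fin_cases j <;> simp [hX, hY, mul_apply, Fin.sum_univ_two]
    · linear_combination hb
    · ring
    · ring
    · linear_combination hb
  have hs := symmPair_iff.1 h
  -- The rows (Yᵀ, -Xᵀ) satisfy all relations except symmetry among themselves. The defect is
  -- alternating, hence of the form Sᵀ - S, and adding S (M N) removes it without disturbing the
  -- other relations.
  set k : ℤ := (Yᵀ * X) 0 1 - (Xᵀ * Y) 0 1 with hk
  set S : M2 ℤ := !![0, -k; 0, 0] with hS
  have hT : Xᵀ * Mᵀ + Yᵀ * Nᵀ = 1 := by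
    have h := congrArg transpose hXY
    simpa [transpose_add, transpose_mul] using h
  have hKS : Yᵀ * X - Xᵀ * Y = Sᵀ - S := by
    ext i j
    fin_cases i <;> fin_cases j <;> simp [hS, hk, mul_apply, Fin.sum_univ_two] <;> ring
  have hMN : S * M * Nᵀ * Sᵀ = S * N * Mᵀ * Sᵀ := by
    rw [Matrix.mul_assoc S M, hs, ← Matrix.mul_assoc S N]
  refine ⟨ofBlocks (Yᵀ + S * M) (-Xᵀ + S * N) M N ⟨?_, hs, ?_⟩, by simp, by simp⟩
  · simp only [transpose_add, transpose_neg, transpose_mul, transpose_transpose]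
    have e1 : Sᵀ = Xᵀ * Mᵀ * Sᵀ + Yᵀ * Nᵀ * Sᵀ := by
      rw [← Matrix.add_mul, hT, Matrix.one_mul]
    have e2 : S = S * M * X + S * N * Y := by
      rw [Matrix.mul_assoc, Matrix.mul_assoc, ← Matrix.mul_add, hXY, Matrix.mul_one]
    rw [← sub_eq_zero]
    calc _ = Xᵀ * Y - Yᵀ * X + (Xᵀ * Mᵀ * Sᵀ + Yᵀ * Nᵀ * Sᵀ) - (S * M * X + S * N * Y)
        + (S * M * Nᵀ * Sᵀ - S * N * Mᵀ * Sᵀ) := by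
          simp only [Matrix.add_mul, Matrix.mul_add, Matrix.neg_mul, Matrix.mul_neg,
            ← Matrix.mul_assoc]
          abel
      _ = 0 := by
          rw [← e1, ← e2, hMN, ← neg_sub (Yᵀ * X), hKS]; abel
  · calc _ = (Xᵀ * Mᵀ + Yᵀ * Nᵀ) + (S * (M * Nᵀ) - S * (N * Mᵀ)) := by
          simp only [Matrix.add_mul, Matrix.neg_mul, ← Matrix.mul_assoc]
          abel
      _ = 1 := by rw [hT, hs]; abel

/-- Simultaneous congruences modulo finitely many primes. -/
lemma exists_int_congr (s : Finset ℕ) (hs : ∀ p ∈ s, p.Prime) (f : ℕ → ℤ) :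
    ∃ n : ℤ, ∀ p ∈ s, (p : ℤ) ∣ n - f p := by
  induction s using Finset.induction_on with
  | empty => exact ⟨0, by simp⟩
  | insert p s hp ih =>
    obtain ⟨n, hn⟩ := ih fun r hr => hs r (Finset.mem_insert_of_mem hr)
    have hc : IsCoprime (∏ r ∈ s, (r : ℤ)) (p : ℤ) := by
      refine IsCoprime.prod_left fun r hr => ?_
      rw [Nat.isCoprime_iff_coprime]
      refine (Nat.coprime_primes (hs r (Finset.mem_insert_of_mem hr))
        (hs p (Finset.mem_insert_self _ _))).2 ?_
      rintro rfl
      exact hp hr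
    obtain ⟨u, v, huv⟩ := hc
    refine ⟨n + (f p - n) * (u * ∏ r ∈ s, (r : ℤ)), fun r hr => ?_⟩
    rcases Finset.mem_insert.1 hr with rfl | hr
    · exact ⟨(n - f r) * v, by linear_combination (n - f r) * (-huv)⟩
    · have := hn r hr
      have h2 : (r : ℤ) ∣ (f p - n) * (u * ∏ r ∈ s, (r : ℤ)) :=
        ((Finset.dvd_prod_of_mem _ hr).mul_left _).mul_left _
      rw [add_sub_right_comm]
      exact this.add h2

lemma Plucker.IsPrimitive.exists_combination {v : Plucker} (hv : v.IsPrimitive) :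
    ∃ r s t u w : ℤ, r * v.a + s * v.x + t * v.y + u * v.z + w * v.d = 1 := by
  obtain ⟨a, x, y, z, d⟩ := v
  have bezout (m n : ℤ) : ∃ r s : ℤ, (Int.gcd m n : ℤ) = m * r + n * s :=
    ⟨_, _, Int.gcd_eq_gcd_ab m n⟩
  obtain ⟨r1, s1, h1⟩ := bezout z d
  obtain ⟨r2, s2, h2⟩ := bezout y (Int.gcd z d)
  obtain ⟨r3, s3, h3⟩ := bezout x (Int.gcd y (Int.gcd z d))
  obtain ⟨r4, s4, h4⟩ := bezout a (Int.gcd x (Int.gcd y (Int.gcd z d)))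
  have hg : Int.gcd a (Int.gcd x (Int.gcd y (Int.gcd z d))) = 1 := by
    by_contra hne
    obtain ⟨p, hp, hpd⟩ := Nat.exists_prime_and_dvd hne
    have hpd' : (p : ℤ) ∣ Int.gcd a (Int.gcd x (Int.gcd y (Int.gcd z d))) := by exact_mod_cast hpd
    have e1 := hpd'.trans (Int.gcd_dvd_left _ _)
    have r1 := hpd'.trans (Int.gcd_dvd_right _ _)
    have e2 := r1.trans (Int.gcd_dvd_left _ _)
    have r2 := r1.trans (Int.gcd_dvd_right _ _)
    have e3 := r2.trans (Int.gcd_dvd_left _ _)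
    have r3 := r2.trans (Int.gcd_dvd_right _ _)
    exact hv p hp ⟨e1, e2, e3, r3.trans (Int.gcd_dvd_left _ _), r3.trans (Int.gcd_dvd_right _ _)⟩
  rw [hg] at h4
  rw [h3, h2, h1, Nat.cast_one] at h4
  exact ⟨r4, s4 * r3, s4 * s3 * r2, s4 * s3 * s2 * r1, s4 * s3 * s2 * s1,
    by linear_combination -h4⟩

/-- Primitive integral points of the cone are the coordinates of symplectic matrices. -/
lemma exists_plucker_eq {v : Plucker} (hv : v.IsCone) (hp : v.IsPrimitive) :
    ∃ γ : Sp, plucker γ = v := by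
  obtain ⟨M, N, hs, rfl⟩ := exists_pair v hv
  obtain ⟨γ, rfl, rfl⟩ := hs.exists_sp hp.exists_combination
  exact ⟨γ, rfl⟩

/-! ### Orbits of the congruence subgroup and ranks modulo primes. -/

/-- The condition on `v` modulo `p` that `M` has a given rank modulo `p`. -/
def Plucker.HasRank (p : ℤ) : Fin 3 → Plucker → Prop
  | 0, v => p ∣ v.a ∧ p ∣ v.x ∧ p ∣ v.y ∧ p ∣ v.z
  | 1, v => p ∣ v.a ∧ ¬ (p ∣ v.x ∧ p ∣ v.z)
  | 2, v => ¬ p ∣ v.a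

/-- `diag(d 0, d 1)` is congruent modulo `p` to the standard idempotent of given rank. -/
def DiagCongr (p : ℤ) : Fin 3 → (Fin 2 → ℤ) → Prop
  | 0, d => p ∣ d 0 ∧ p ∣ d 1
  | 1, d => p ∣ d 0 - 1 ∧ p ∣ d 1
  | 2, d => p ∣ d 0 - 1 ∧ p ∣ d 1 - 1

lemma exists_inverse_mod {p : ℕ} (hp : p.Prime) {a : ℤ} (ha : ¬ (p : ℤ) ∣ a) :
    ∃ b : ℤ, (p : ℤ) ∣ 1 - a * b := by
  have : IsCoprime (p : ℤ) a := (Nat.prime_iff_prime_int.1 hp).coprime_iff_not_dvd.2 ha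
  obtain ⟨u, v, h⟩ := this
  exact ⟨v, u, by linear_combination -h⟩

/-- From D adj(D) = d one gets d C = D Q. Here p divides Q, and p ∤ d by primitivity. -/
lemma dvd_blockC_of_hasRank_zero {p : ℕ} (hp : p.Prime) {γ : Sp}
    (h : (plucker γ).HasRank p 0) (i j : Fin 2) : (p : ℤ) ∣ blockC γ i j := by
  have hprim := isPrimitive_plucker γ p hp
  obtain ⟨ha, hx, hy, hz⟩ := h
  have hd : ¬ (p : ℤ) ∣ (plucker γ).d := fun hd => hprim ⟨ha, hx, hy, hz, hd⟩
  have hpi := Nat.prime_iff_prime_int.1 hp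
  suffices h : (p : ℤ) ∣ (plucker γ).d * blockC γ i j from (hpi.dvd_or_dvd h).resolve_left hd
  have hs := symmPair_blocks γ
  simp only [SymmPair] at hs
  have e : (plucker γ).d * blockC γ i j = ![blockD γ i 0 * (plucker γ).x + blockD γ i 1 * (plucker γ).y,
      blockD γ i 0 * (plucker γ).y + blockD γ i 1 * (plucker γ).z] j := by
    fin_cases i <;> fin_cases j <;> simp [plucker, ofPair]
    · linear_combination (-blockD γ 0 1) * hs
    · ring
    · linear_combination (-blockD γ 1 1) * hs
    · ring
  rw [e]
  fin_cases j
  · exact (hx.mul_left _).add (hy.mul_left _)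
  · exact (hy.mul_left _).add (hz.mul_left _)

lemma symm_blockA_blockC (γ : Sp) : blockA γ 0 0 * blockC γ 0 1 + blockA γ 1 0 * blockC γ 1 1 =
    blockC γ 0 0 * blockA γ 0 1 + blockC γ 1 0 * blockA γ 1 1 := by
  have h := congrFun (congrFun (column_relations γ).1 0) 1
  simpa [mul_apply, Fin.sum_univ_two] using h

/-- The condition that `γ` is of the form `(1 -S; 0 1) γ₀ δ` with `δ ∈ Γ₀(p)`, where
`γ₀ = cuspElt d`, `S = (s t; t u)`. -/
def TransCongr (p : ℤ) (d : Fin 2 → ℤ) (γ : Sp) (s t u : ℤ) : Prop :=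
  ∀ j, p ∣ blockC γ 0 j - d 0 * (blockA γ 0 j + s * blockC γ 0 j + t * blockC γ 1 j) ∧
    p ∣ blockC γ 1 j - d 1 * (blockA γ 1 j + t * blockC γ 0 j + u * blockC γ 1 j)

lemma TransCongr.congr {p : ℤ} {d : Fin 2 → ℤ} {γ : Sp} {s t u s' t' u' : ℤ}
    (h : TransCongr p d γ s t u) (hs : p ∣ s' - s) (ht : p ∣ t' - t) (hu : p ∣ u' - u) :
    TransCongr p d γ s' t' u' := by
  intro j
  obtain ⟨h1, h2⟩ := h j
  obtain ⟨e1, h1⟩ := h1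
  obtain ⟨e2, h2⟩ := h2
  obtain ⟨m1, hs⟩ := hs
  obtain ⟨m2, ht⟩ := ht
  obtain ⟨m3, hu⟩ := hu
  exact ⟨⟨e1 - d 0 * (m1 * blockC γ 0 j + m2 * blockC γ 1 j), by
      linear_combination h1 - d 0 * blockC γ 0 j * hs - d 0 * blockC γ 1 j * ht⟩,
    ⟨e2 - d 1 * (m2 * blockC γ 0 j + m3 * blockC γ 1 j), by
      linear_combination h2 - d 1 * blockC γ 0 j * ht - d 1 * blockC γ 1 j * hu⟩⟩

lemma exists_transCongr {p : ℕ} (hp : p.Prime) {d : Fin 2 → ℤ} {γ : Sp} {r : Fin 3}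
    (hd : DiagCongr p r d) (h : (plucker γ).HasRank p r)
    (h1 : r = 1 → ∀ j, (p : ℤ) ∣ blockC γ 1 j) : ∃ s t u, TransCongr p d γ s t u := by
  have hpi := Nat.prime_iff_prime_int.1 hp
  have hAC := symm_blockA_blockC γ
  fin_cases r
  · refine ⟨0, 0, 0, fun j => ⟨?_, ?_⟩⟩
    · exact (dvd_blockC_of_hasRank_zero hp h 0 j).sub (hd.1.mul_right _)
    · exact (dvd_blockC_of_hasRank_zero hp h 1 j).sub (hd.2.mul_right _)
  · have hr := h1 rfl
    -- Modulo p the second row of C vanishes, so the symmetry of Aᵀ C makes the first row of A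
    -- proportional to the nonzero first row of C.
    have : ∃ s : ℤ, ∀ j, (p : ℤ) ∣ blockC γ 0 j - blockA γ 0 j - s * blockC γ 0 j := by
      obtain ⟨m0, hm0⟩ := hr 0
      obtain ⟨m1, hm1⟩ := hr 1
      by_cases h0 : (p : ℤ) ∣ blockC γ 0 0
      · by_cases h01 : (p : ℤ) ∣ blockC γ 0 1
        · exfalso
          refine h.2 ⟨?_, ?_⟩
          · exact (h0.mul_left _).sub ((hr 0).mul_left _)
          · exact ((hr 1).mul_left _).sub (h01.mul_left _)
        · obtain ⟨b, m, hb⟩ := exists_inverse_mod hp h01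
          refine ⟨1 - b * blockA γ 0 1, fun j => ?_⟩
          fin_cases j
          · refine ⟨-m * blockA γ 0 0 + b * (blockA γ 1 0 * m1 - m0 * blockA γ 1 1), ?_⟩
            simp only [Fin.zero_eta]
            linear_combination (-blockA γ 0 0) * hb - b * hAC
              + b * blockA γ 1 0 * hm1 - b * blockA γ 1 1 * hm0
          · refine ⟨-m * blockA γ 0 1, ?_⟩
            simp only [Fin.mk_one]
            linear_combination (-blockA γ 0 1) * hb
      · obtain ⟨b, m, hb⟩ := exists_inverse_mod hp h0
        refine ⟨1 - b * blockA γ 0 0, fun j => ?_⟩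
        fin_cases j
        · refine ⟨-m * blockA γ 0 0, ?_⟩
          simp only [Fin.zero_eta]
          linear_combination (-blockA γ 0 0) * hb
        · refine ⟨-m * blockA γ 0 1 + b * (m0 * blockA γ 1 1 - m1 * blockA γ 1 0), ?_⟩
          simp only [Fin.mk_one]
          linear_combination (-blockA γ 0 1) * hb + b * hAC
            + b * blockA γ 1 1 * hm0 - b * blockA γ 1 0 * hm1
    obtain ⟨s, hs⟩ := this
    refine ⟨s, 0, 0, fun j => ⟨?_, ?_⟩⟩
    · obtain ⟨m, hm⟩ := hs j
      obtain ⟨e, he⟩ := hd.1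
      refine ⟨m - e * (blockA γ 0 j + s * blockC γ 0 j), ?_⟩
      linear_combination hm - (blockA γ 0 j + s * blockC γ 0 j) * he
    · exact (hr j).sub (hd.2.mul_right _)
  -- Here C is invertible modulo p and S = 1 - A C⁻¹ is the solution; it is symmetric because Aᵀ C
  -- is.
  · obtain ⟨b, m, hb⟩ := exists_inverse_mod hp h
    simp only [plucker, ofPair] at hb
    obtain ⟨⟨e0, hd0⟩, ⟨e1, hd1⟩⟩ := hd
    set A := blockA γ
    set C := blockC γ
    have hT : ∃ s t u : ℤ, ∀ j, (p : ℤ) ∣ C 0 j - (A 0 j + s * C 0 j + t * C 1 j) ∧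
        (p : ℤ) ∣ C 1 j - (A 1 j + t * C 0 j + u * C 1 j) := by
      set a := C 0 0 * C 1 1 - C 0 1 * C 1 0
      refine ⟨b * (a - (A 0 0 * C 1 1 - A 0 1 * C 1 0)), -b * (A 0 1 * C 0 0 - A 0 0 * C 0 1),
        b * (a - (A 1 1 * C 0 0 - A 1 0 * C 0 1)), fun j => ⟨?_, ?_⟩⟩
      · refine ⟨m * (C 0 j - A 0 j), ?_⟩
        fin_cases j
        · simp only [Fin.zero_eta]
          linear_combination (C 0 0 - A 0 0) * hb
        · simp only [Fin.mk_one]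
          linear_combination (C 0 1 - A 0 1) * hb
      · refine ⟨m * (C 1 j - A 1 j), ?_⟩
        fin_cases j
        · simp only [Fin.zero_eta]
          linear_combination (C 1 0 - A 1 0) * hb - b * C 0 0 * hAC
        · simp only [Fin.mk_one]
          linear_combination (C 1 1 - A 1 1) * hb - b * C 0 1 * hAC
    obtain ⟨s, t, u, hT⟩ := hT
    refine ⟨s, t, u, fun j => ⟨?_, ?_⟩⟩
    · obtain ⟨m, hm⟩ := (hT j).1
      exact ⟨m - e0 * (A 0 j + s * C 0 j + t * C 1 j), by
        linear_combination hm - (A 0 j + s * C 0 j + t * C 1 j) * hd0⟩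
    · obtain ⟨m, hm⟩ := (hT j).2
      exact ⟨m - e1 * (A 1 j + t * C 0 j + u * C 1 j), by
        linear_combination hm - (A 1 j + t * C 0 j + u * C 1 j) * hd1⟩

lemma exists_row_mod {p : ℕ} (hp : p.Prime) (C : M2 ℤ)
    (h : (p : ℤ) ∣ C 0 0 * C 1 1 - C 0 1 * C 1 0) :
    ∃ g : ℤ × ℤ, ¬ ((p : ℤ) ∣ g.1 ∧ (p : ℤ) ∣ g.2) ∧
      ∀ j, (p : ℤ) ∣ g.1 * C 0 j + g.2 * C 1 j := by
  obtain ⟨m, hm⟩ := h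
  by_cases h0 : (p : ℤ) ∣ C 0 0 ∧ (p : ℤ) ∣ C 1 0
  · by_cases h1 : (p : ℤ) ∣ C 0 1 ∧ (p : ℤ) ∣ C 1 1
    · refine ⟨(1, 0), ?_, fun j => ?_⟩
      · rintro ⟨h, -⟩
        exact hp.one_lt.ne' (by exact_mod_cast Int.eq_one_of_dvd_one (by positivity) h)
      · fin_cases j
        · simpa using h0.1
        · simpa using h1.1
    · refine ⟨(C 1 1, -C 0 1), by simpa [and_comm] using h1, fun j => ?_⟩
      fin_cases j
      · exact ⟨m, by simp only [Fin.zero_eta]; linear_combination hm⟩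
      · exact ⟨0, by simp only [Fin.mk_one]; ring⟩
  · refine ⟨(C 1 0, -C 0 0), by simpa [and_comm] using h0, fun j => ?_⟩
    fin_cases j
    · exact ⟨0, by simp only [Fin.zero_eta]; ring⟩
    · exact ⟨-m, by simp only [Fin.mk_one]; linear_combination -hm⟩

/-- A matrix which is singular modulo finitely many primes can be multiplied by an element of
`SL₂(ℤ)` so that its second row vanishes modulo these primes. -/
lemma exists_sl_mul_row_dvd (s : Finset ℕ) (hs : ∀ p ∈ s, p.Prime) (C : M2 ℤ)
    (h : ∀ p ∈ s, (p : ℤ) ∣ C 0 0 * C 1 1 - C 0 1 * C 1 0) :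
    ∃ G : Matrix.SpecialLinearGroup (Fin 2) ℤ, ∀ p ∈ s, ∀ j, (p : ℤ) ∣ ((G : M2 ℤ) * C) 1 j := by
  classical
  have key : ∀ p : ℕ, ∃ g : ℤ × ℤ, p ∈ s → ¬ ((p : ℤ) ∣ g.1 ∧ (p : ℤ) ∣ g.2) ∧
      ∀ j, (p : ℤ) ∣ g.1 * C 0 j + g.2 * C 1 j := by
    intro p
    by_cases hp : p ∈ s
    · obtain ⟨g, hg⟩ := exists_row_mod (hs p hp) C (h p hp)
      exact ⟨g, fun _ => hg⟩
    · exact ⟨0, fun h => absurd h hp⟩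
  choose g hg using key
  -- The row vectors killing C modulo each p are glued to one integral row (g1, g2). Keeping g1
  -- nonzero leaves finitely many further primes at which g1 and g2 might fail to be coprime.
  obtain ⟨g1, hg1, hne⟩ : ∃ g1 : ℤ, (∀ p ∈ s, (p : ℤ) ∣ g1 - (g p).1) ∧ g1 ≠ 0 := by
    obtain ⟨n, hn⟩ := exists_int_congr s hs fun p => (g p).1
    by_cases h0 : n = 0
    · refine ⟨∏ p ∈ s, (p : ℤ), fun p hp => ?_, ?_⟩
      · have := hn p hp
        rw [h0, zero_sub] at this
        exact (Finset.dvd_prod_of_mem _ hp).add this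
      · exact Finset.prod_ne_zero_iff.2 fun p hp => by exact_mod_cast (hs p hp).ne_zero
    · exact ⟨n, hn, h0⟩
  -- Prescribing g2 ≡ 1 at the other primes dividing g1 makes the row primitive, hence the second
  -- row of a matrix in `SL₂(ℤ)`.
  obtain ⟨g2, hg2⟩ := exists_int_congr (s ∪ g1.natAbs.primeFactors)
    (fun p hp => (Finset.mem_union.1 hp).elim (hs p) Nat.prime_of_mem_primeFactors)
    fun p => if p ∈ s then (g p).2 else 1
  have hco : IsCoprime g2 g1 := by
    rw [Int.isCoprime_iff_gcd_eq_one]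
    by_contra hne1
    obtain ⟨p, hp, hpd⟩ := Nat.exists_prime_and_dvd hne1
    have hpd' : (p : ℤ) ∣ Int.gcd g2 g1 := by exact_mod_cast hpd
    have h2 := hpd'.trans (Int.gcd_dvd_left _ _)
    have h1 := hpd'.trans (Int.gcd_dvd_right _ _)
    by_cases hps : p ∈ s
    · have e1 := hg1 p hps
      have e2 := hg2 p (Finset.mem_union_left _ hps)
      simp only [hps, if_true] at e2
      refine (hg p hps).1 ⟨?_, ?_⟩
      · have := h1.sub e1; rwa [sub_sub_cancel] at this
      · have := h2.sub e2; rwa [sub_sub_cancel] at this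
    · have e2 := hg2 p (Finset.mem_union_right _ (Nat.mem_primeFactors.2
        ⟨hp, Int.natCast_dvd.1 h1, Int.natAbs_ne_zero.2 hne⟩))
      simp only [hps, if_false] at e2
      have := h2.sub e2
      rw [sub_sub_cancel] at this
      exact hp.one_lt.ne' (by exact_mod_cast Int.eq_one_of_dvd_one (by positivity) this)
  obtain ⟨a, b, hab⟩ := hco
  refine ⟨⟨!![a, -b; g1, g2], by rw [det_fin_two_of]; linear_combination hab⟩, fun p hp j => ?_⟩
  obtain ⟨m1, e1⟩ := hg1 p hp
  obtain ⟨m2, e2⟩ := hg2 p (Finset.mem_union_left _ hp)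
  obtain ⟨m, hm⟩ := (hg p hp).2 j
  simp only [hp, if_true] at e2
  refine ⟨m + m1 * C 0 j + m2 * C 1 j, ?_⟩
  simp only [mul_apply, Fin.sum_univ_two, of_apply, cons_val', cons_val_zero, cons_val_one,
    cons_val_fin_one]
  linear_combination hm + C 0 j * e1 + C 1 j * e2

/-- The element `(G⁻ᵀ 0; 0 G)`. -/
def levi (G : Matrix.SpecialLinearGroup (Fin 2) ℤ) : Sp :=
  ofBlocks ((G⁻¹ : Matrix.SpecialLinearGroup (Fin 2) ℤ) : M2 ℤ)ᵀ 0 0 (G : M2 ℤ) (by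
    refine ⟨by simp, by simp, ?_⟩
    rw [← transpose_mul, ← Matrix.SpecialLinearGroup.coe_mul]
    simp)

/-- The translation `(1 S; 0 1)` with `S = (s t; t u)`. -/
def translation (s t u : ℤ) : Sp :=
  ofBlocks 1 !![s, t; t, u] 0 1 (by
    refine ⟨?_, by simp, by simp⟩
    ext i j; fin_cases i <;> fin_cases j <;> simp)

@[simp] lemma blockC_levi_mul (G : Matrix.SpecialLinearGroup (Fin 2) ℤ) (γ : Sp) :
    blockC (levi G * γ) = (G : M2 ℤ) * blockC γ := by
  rw [blockC_mul_blocks]; simp [levi]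

@[simp] lemma blockD_levi_mul (G : Matrix.SpecialLinearGroup (Fin 2) ℤ) (γ : Sp) :
    blockD (levi G * γ) = (G : M2 ℤ) * blockD γ := by
  rw [blockD_mul]; simp [levi]

lemma plucker_levi_mul (G : Matrix.SpecialLinearGroup (Fin 2) ℤ) (γ : Sp) :
    plucker (levi G * γ) = plucker γ := by
  rw [plucker, blockC_levi_mul, blockD_levi_mul, ofPair_sl_mul, plucker]

@[simp] lemma blockA_translation_mul (s t u : ℤ) (γ : Sp) :
    blockA (translation s t u * γ) = blockA γ + !![s, t; t, u] * blockC γ := by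
  rw [blockA_mul]; simp [translation]

@[simp] lemma blockC_translation_mul (s t u : ℤ) (γ : Sp) :
    blockC (translation s t u * γ) = blockC γ := by
  rw [blockC_mul_blocks]; simp [translation]

@[simp] lemma blockD_translation_mul (s t u : ℤ) (γ : Sp) :
    blockD (translation s t u * γ) = blockD γ := by
  rw [blockD_mul]; simp [translation]

lemma plucker_translation_mul (s t u : ℤ) (γ : Sp) :
    plucker (translation s t u * γ) = plucker γ := by
  rw [plucker, blockC_translation_mul, blockD_translation_mul, plucker]

@[simp] lemma blockA_cuspElt (d : Fin 2 → ℤ) : blockA (cuspElt d) = 1 := toBlocks_fromBlocks₁₁ _ _ _ _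
@[simp] lemma blockB_cuspElt (d : Fin 2 → ℤ) : blockB (cuspElt d) = 0 := toBlocks_fromBlocks₁₂ _ _ _ _
@[simp] lemma blockC_cuspElt (d : Fin 2 → ℤ) : blockC (cuspElt d) = diagonal d :=
  toBlocks_fromBlocks₂₁ _ _ _ _
@[simp] lemma blockD_cuspElt (d : Fin 2 → ℤ) : blockD (cuspElt d) = 1 := toBlocks_fromBlocks₂₂ _ _ _ _

lemma blockC_cuspElt_mul (d : Fin 2 → ℤ) (γ : Sp) :
    blockC (cuspElt d * γ) = diagonal d * blockA γ + blockC γ := by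
  rw [blockC_mul_blocks]; simp

lemma blockD_cuspElt_mul (d : Fin 2 → ℤ) (γ : Sp) :
    blockD (cuspElt d * γ) = diagonal d * blockB γ + blockD γ := by
  rw [blockD_mul]; simp

lemma sp_ext {γ γ' : Sp} (hA : blockA γ = blockA γ') (hB : blockB γ = blockB γ')
    (hC : blockC γ = blockC γ') (hD : blockD γ = blockD γ') : γ = γ' := by
  apply Subtype.ext
  rw [coe_eq_fromBlocks γ, coe_eq_fromBlocks γ', hA, hB, hC, hD]

lemma cuspElt_inv (d : Fin 2 → ℤ) : (cuspElt d)⁻¹ = cuspElt (-d) := by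
  rw [inv_eq_iff_mul_eq_one]
  have h1 : blockA (1 : Sp) = 1 ∧ blockB (1 : Sp) = 0 ∧ blockC (1 : Sp) = 0 ∧ blockD (1 : Sp) = 1 := by
    simp [blockA, blockB, blockC, blockD, ← fromBlocks_one]
  apply sp_ext
  · rw [blockA_mul]; simp [h1]
  · rw [blockB_mul]; simp [h1]
  · rw [blockC_cuspElt_mul]; simp [h1]
  · rw [blockD_cuspElt_mul]; simp [h1]

/-- Every primitive integral point of the cone with the rank of the cusp at all primes dividing
the square-free level lies in the orbit. -/
lemma exists_gamma0_plucker_eq {N : ℕ} (hN : Squarefree N) {rk : ℕ → Fin 3} {d : Fin 2 → ℤ}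
    (hd : ∀ p : ℕ, p.Prime → p ∣ N → DiagCongr p (rk p) d) {v : Plucker} (hv : v.IsCone)
    (hprim : v.IsPrimitive) (hr : ∀ p : ℕ, p.Prime → p ∣ N → v.HasRank p (rk p)) :
    ∃ δ : Gamma0 N, plucker (cuspElt d * δ) = v := by
  obtain ⟨γ₁, rfl⟩ := exists_plucker_eq hv hprim
  have hpf : ∀ p ∈ N.primeFactors, p.Prime ∧ p ∣ N := fun p hp =>
    ⟨Nat.prime_of_mem_primeFactors hp, Nat.dvd_of_mem_primeFactors hp⟩
  -- Left multiplication by Levi elements and translations preserves Plücker coordinates. The Levi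
  -- factor moves the kernel to the second row at all rank-one primes; one translation then settles
  -- all primes at once.
  obtain ⟨G, hG⟩ := exists_sl_mul_row_dvd (N.primeFactors.filter fun p => rk p = 1)
    (fun p hp => (hpf p (Finset.mem_filter.1 hp).1).1) (blockC γ₁) (fun p hp => by
      obtain ⟨hp, hp1⟩ := Finset.mem_filter.1 hp
      have := hr p (hpf p hp).1 (hpf p hp).2
      rw [hp1] at this
      exact this.1)
  rw [← plucker_levi_mul G] at hr
  rw [← plucker_levi_mul G γ₁]
  rw [← blockC_levi_mul] at hG
  generalize levi G * γ₁ = γ at *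
  have key : ∀ p : ℕ, ∃ s t u, p ∈ N.primeFactors → TransCongr p d γ s t u := by
    intro p
    by_cases hp : p ∈ N.primeFactors
    · obtain ⟨s, t, u, h⟩ := exists_transCongr (hpf p hp).1 (hd p (hpf p hp).1 (hpf p hp).2)
        (hr p (hpf p hp).1 (hpf p hp).2) (fun h1 => hG p (Finset.mem_filter.2 ⟨hp, h1⟩))
      exact ⟨s, t, u, fun _ => h⟩
    · exact ⟨0, 0, 0, fun h => absurd h hp⟩
  choose fs ft fu hf using key
  obtain ⟨s, hs⟩ := exists_int_congr N.primeFactors (fun p hp => (hpf p hp).1) fs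
  obtain ⟨t, ht⟩ := exists_int_congr N.primeFactors (fun p hp => (hpf p hp).1) ft
  obtain ⟨u, hu⟩ := exists_int_congr N.primeFactors (fun p hp => (hpf p hp).1) fu
  have hmem : (cuspElt d)⁻¹ * (translation s t u * γ) ∈ Gamma0 N := by
    intro i j
    rw [← Nat.prod_primeFactors_of_squarefree hN, Nat.cast_prod]
    refine Finset.prod_dvd_of_coprime (fun p hp r hr hpr => ?_) (fun p hp => ?_)
    · rw [Function.onFun, Nat.isCoprime_iff_coprime]
      exact (Nat.coprime_primes (hpf p hp).1 (hpf r hr).1).2 hpr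
    · obtain ⟨h0, h1⟩ := ((hf p hp).congr (hs p hp) (ht p hp) (hu p hp)) j
      rw [cuspElt_inv, blockC_cuspElt_mul, blockA_translation_mul, blockC_translation_mul]
      fin_cases i
      · simp only [Fin.zero_eta, Matrix.add_apply, diagonal_mul, Pi.neg_apply]
        simp only [mul_apply, Fin.sum_univ_two, of_apply, cons_val', cons_val_zero, cons_val_one,
          cons_val_fin_one]
        obtain ⟨m, hm⟩ := h0
        exact ⟨m, by linear_combination hm⟩
      · simp only [Fin.mk_one, Matrix.add_apply, diagonal_mul, Pi.neg_apply]
        simp only [mul_apply, Fin.sum_univ_two, of_apply, cons_val', cons_val_zero, cons_val_one,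
          cons_val_fin_one]
        obtain ⟨m, hm⟩ := h1
        exact ⟨m, by linear_combination hm⟩
  refine ⟨⟨_, hmem⟩, ?_⟩
  rw [mul_inv_cancel_left, plucker_translation_mul]

/-! ### Components of a character of square-free modulus. -/

/-- The Chinese remainder isomorphism takes the pair (b, 1) to b, because b ≡ 1 modulo N / M. -/
lemma component_apply {N : ℕ} (hN : Squarefree N) (χ : DirichletCharacter ℂ N) {M : ℕ} (hM : M ∣ N)
    {b : ℤ} (hb : IsCoprime b N) (h1 : ((N / M : ℕ) : ℤ) ∣ b - 1) :
    component χ M (b : ZMod M) = χ (b : ZMod N) := by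
  have hmul : M * (N / M) = N := Nat.mul_div_cancel' hM
  have hco : M.Coprime (N / M) := Nat.coprime_of_squarefree_mul (by rwa [hmul])
  have h : M * (N / M) = N ∧ M.Coprime (N / M) := ⟨hmul, hco⟩
  have hbM : IsUnit (b : ZMod M) := by
    obtain ⟨u, v, huv⟩ := hb
    refine IsUnit.of_mul_eq_one (u : ZMod M) ?_
    have := congrArg (Int.cast : ℤ → ZMod M) huv
    push_cast at this
    rw [(ZMod.natCast_eq_zero_iff N M).2 hM] at this
    rw [mul_comm]; simpa using this
  obtain ⟨u, hu⟩ := hbM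
  rw [component, dif_pos h, ← hu, MulChar.ofUnitHom_coe]
  simp only [MonoidHom.coe_comp, Function.comp_apply, MulChar.coe_toUnitHom]
  congr 1
  rw [Units.coe_map]
  simp only [MonoidHom.coe_comp, Function.comp_apply, MonoidHom.inl_apply]
  have hb1 : ((b : ℤ) : ZMod (N / M)) = 1 := by
    rw [← sub_eq_zero]
    have := (ZMod.intCast_zmod_eq_zero_iff_dvd (b - 1) (N / M)).2 h1
    simpa using this
  have e : (((MulEquiv.prodUnits (M := ZMod M) (N := ZMod (N / M))).symm (u, 1) :
      (ZMod M × ZMod (N / M))ˣ) : ZMod M × ZMod (N / M)) = ((b : ℤ) : ZMod M × ZMod (N / M)) := by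
    ext
    · simpa [MulEquiv.prodUnits] using hu
    · simpa [MulEquiv.prodUnits] using hb1.symm
  erw [e]
  simp

lemma prime_intCast_coprime_iff {N : ℕ} {b : ℤ} :
    IsCoprime b N ↔ ∀ p : ℕ, p.Prime → p ∣ N → ¬ (p : ℤ) ∣ b := by
  constructor
  · rintro h p hp hpN hpb
    have := h.isUnit_of_dvd' hpb (by exact_mod_cast hpN)
    exact (Nat.prime_iff_prime_int.1 hp).not_isUnit this
  · intro h
    rw [Int.isCoprime_iff_gcd_eq_one]
    by_contra hne
    obtain ⟨p, hp, hpd⟩ := Nat.exists_prime_and_dvd hne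
    have hpd' : (p : ℤ) ∣ Int.gcd b N := by exact_mod_cast hpd
    exact h p hp (by exact_mod_cast hpd'.trans (Int.gcd_dvd_right _ _))
      (hpd'.trans (Int.gcd_dvd_left _ _))

lemma dvd_of_squarefree_of_primes {m : ℕ} (hm : Squarefree m) {b : ℤ}
    (h : ∀ p : ℕ, p.Prime → p ∣ m → (p : ℤ) ∣ b) : (m : ℤ) ∣ b := by
  rw [← Nat.prod_primeFactors_of_squarefree hm, Nat.cast_prod]
  refine Finset.prod_dvd_of_coprime (fun p hp r hr hpr => ?_) (fun p hp => ?_)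
  · rw [Function.onFun, Nat.isCoprime_iff_coprime]
    exact (Nat.coprime_primes (Nat.prime_of_mem_primeFactors hp)
      (Nat.prime_of_mem_primeFactors hr)).2 hpr
  · exact h p (Nat.prime_of_mem_primeFactors hp) (Nat.dvd_of_mem_primeFactors hp)

lemma intCast_eq_of_dvd_sub {m : ℕ} {a b : ℤ} (h : (m : ℤ) ∣ a - b) : (a : ZMod m) = (b : ZMod m) := by
  rw [← sub_eq_zero]
  have := (ZMod.intCast_zmod_eq_zero_iff_dvd (a - b) m).2 h
  simpa using this

/-- Elements with prescribed residue at `p` and residue `1` at all other primes dividing `N`. -/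
lemma exists_lift_at_prime {N : ℕ} (hN : Squarefree N) {p : ℕ} (hp : p.Prime) {n : ℤ}
    (hn : ¬ (p : ℤ) ∣ n) : ∃ b : ℤ, IsCoprime b N ∧ (p : ℤ) ∣ b - n ∧
      ∀ r : ℕ, r.Prime → r ∣ N → r ≠ p → (r : ℤ) ∣ b - 1 := by
  obtain ⟨b, hb⟩ := exists_int_congr (insert p N.primeFactors)
    (fun r hr => (Finset.mem_insert.1 hr).elim (fun h => h ▸ hp) Nat.prime_of_mem_primeFactors)
    fun r => if r = p then n else 1
  have h1 : (p : ℤ) ∣ b - n := by simpa using hb p (Finset.mem_insert_self _ _)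
  have h2 : ∀ r : ℕ, r.Prime → r ∣ N → r ≠ p → (r : ℤ) ∣ b - 1 := fun r hr hrN hrp => by
    simpa [hrp] using hb r (Finset.mem_insert_of_mem (Nat.mem_primeFactors.2 ⟨hr, hrN, hN.ne_zero⟩))
  refine ⟨b, prime_intCast_coprime_iff.2 fun r hr hrN hrb => ?_, h1, h2⟩
  by_cases hrp : r = p
  · subst hrp
    have := hrb.sub h1
    rw [sub_sub_cancel] at this
    exact hn this
  · have := hrb.sub (h2 r hr hrN hrp)
    rw [sub_sub_cancel] at this
    exact (Nat.prime_iff_prime_int.1 hr).not_dvd_one this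

/-- As b ≡ 1 modulo every prime of N except p, both sides equal χ(b). -/
lemma component_prime_apply {N : ℕ} (hN : Squarefree N) (χ : DirichletCharacter ℂ N) {m p : ℕ}
    (hm : m ∣ N) (hp : p.Prime) (hpm : p ∣ m) {n b : ℤ} (hb : IsCoprime b N) (hbn : (p : ℤ) ∣ b - n)
    (h1 : ∀ r : ℕ, r.Prime → r ∣ N → r ≠ p → (r : ℤ) ∣ b - 1) :
    component χ m (b : ZMod m) = component χ p (n : ZMod p) := by
  have key : ∀ m : ℕ, m ∣ N → p ∣ m → ((N / m : ℕ) : ℤ) ∣ b - 1 := fun m hm hpm => by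
    have hmul : m * (N / m) = N := Nat.mul_div_cancel' hm
    have hco : m.Coprime (N / m) := Nat.coprime_of_squarefree_mul (by rwa [hmul])
    refine dvd_of_squarefree_of_primes (hN.squarefree_of_dvd (Nat.div_dvd_of_dvd hm))
      fun r hr hrd => h1 r hr (hrd.trans (Nat.div_dvd_of_dvd hm)) ?_
    rintro rfl
    exact hr.one_lt.ne' (Nat.dvd_one.1 (hco ▸ Nat.dvd_gcd hpm hrd))
  rw [component_apply hN χ hm hb (key m hm hpm), ← intCast_eq_of_dvd_sub hbn,
    component_apply hN χ (hpm.trans hm) hb (key p (hpm.trans hm) dvd_rfl)]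

/-- A component of a character of square-free modulus is the product of the components at primes. -/
lemma component_eq_prod {N : ℕ} (hN : Squarefree N) (χ : DirichletCharacter ℂ N) {m : ℕ}
    (hm : m ∣ N) {n : ℤ} (hn : IsCoprime n m) :
    component χ m (n : ZMod m) = ∏ p ∈ m.primeFactors, component χ p (n : ZMod p) := by
  have hn' := prime_intCast_coprime_iff.1 hn
  have key : ∀ p : ℕ, ∃ b : ℤ, p ∈ m.primeFactors → IsCoprime b N ∧ (p : ℤ) ∣ b - n ∧
      ∀ r : ℕ, r.Prime → r ∣ N → r ≠ p → (r : ℤ) ∣ b - 1 := fun p => by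
    by_cases hp : p ∈ m.primeFactors
    · obtain ⟨b, hb⟩ := exists_lift_at_prime hN (Nat.prime_of_mem_primeFactors hp)
        (hn' p (Nat.prime_of_mem_primeFactors hp) (Nat.dvd_of_mem_primeFactors hp))
      exact ⟨b, fun _ => hb⟩
    · exact ⟨0, fun h => absurd h hp⟩
  choose b hb using key
  have hprod : (n : ZMod m) = ((∏ p ∈ m.primeFactors, b p : ℤ) : ZMod m) := by
    refine intCast_eq_of_dvd_sub (dvd_of_squarefree_of_primes (hN.squarefree_of_dvd hm)
      fun p hp hpm => ?_)
    have hpm' : p ∈ m.primeFactors := Nat.mem_primeFactors.2 ⟨hp, hpm, fun h => hN.ne_zero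
      (by rw [h] at hm; exact Nat.eq_zero_of_zero_dvd hm)⟩
    rw [← ZMod.intCast_zmod_eq_zero_iff_dvd, Int.cast_sub, Int.cast_prod, sub_eq_zero,
      Finset.prod_eq_single_of_mem p hpm']
    · exact (intCast_eq_of_dvd_sub (hb p hpm').2.1).symm
    · intro r hr hrp
      rw [intCast_eq_of_dvd_sub ((hb r hr).2.2 p hp (hpm.trans hm) hrp.symm), Int.cast_one]
  rw [hprod, Int.cast_prod, map_prod]
  refine Finset.prod_congr rfl fun p hp => ?_
  obtain ⟨h1, h2, h3⟩ := hb p hp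
  exact component_prime_apply hN χ hm (Nat.prime_of_mem_primeFactors hp)
    (Nat.dvd_of_mem_primeFactors hp) h1 h2 h3

lemma apply_eq_prod_component {N : ℕ} (hN : Squarefree N) (χ : DirichletCharacter ℂ N) {n : ℤ}
    (hn : IsCoprime n N) :
    χ (n : ZMod N) = ∏ p ∈ N.primeFactors, component χ p (n : ZMod p) := by
  rw [← component_eq_prod hN χ dvd_rfl hn, component_apply hN χ dvd_rfl hn]
  rw [Nat.div_self (Nat.pos_of_ne_zero hN.ne_zero)]
  simp

lemma component_sq_eq_one {N : ℕ} (hN : Squarefree N) {χ : DirichletCharacter ℂ N} {m p : ℕ}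
    (hm : m ∣ N) (hχ : component χ m ^ 2 = 1) (hp : p.Prime) (hpm : p ∣ m) :
    component χ p ^ 2 = 1 := by
  ext u
  obtain ⟨n, hn⟩ := ZMod.intCast_surjective (u : ZMod p)
  have hpn : ¬ (p : ℤ) ∣ n := fun h => by
    have h0 : (n : ZMod p) = 0 := (ZMod.intCast_zmod_eq_zero_iff_dvd n p).2 h
    have := Fact.mk hp
    exact u.ne_zero (hn ▸ h0)
  obtain ⟨b, hb, h1, h2⟩ := exists_lift_at_prime hN hp hpn
  have e := component_prime_apply hN χ hm hp hpm hb h1 h2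
  have hu : IsUnit (b : ZMod m) := by
    obtain ⟨s, t, hst⟩ := hb
    refine IsUnit.of_mul_eq_one (s : ZMod m) ?_
    have := congrArg (Int.cast : ℤ → ZMod m) hst
    push_cast at this
    rw [(ZMod.natCast_eq_zero_iff N m).2 hm] at this
    rw [mul_comm]; simpa using this
  have h3 : (component χ m ^ 2) (b : ZMod m) = 1 := by rw [hχ, MulChar.one_apply hu]
  rw [MulChar.one_apply u.isUnit, ← hn, MulChar.pow_apply' _ two_ne_zero, ← e,
    ← MulChar.pow_apply' _ two_ne_zero, h3]

/-! ### Coefficients as products of local factors. -/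

open Classical in
/-- The local factor at `p` of the summand of the Eisenstein series of rank `r` at `p`. -/
noncomputable def localFactor {p : ℕ} (χ : DirichletCharacter ℂ p) : Fin 3 → Plucker → ℂ
  | 0, v => if (p : ℤ) ∣ v.a ∧ (p : ℤ) ∣ v.x ∧ (p : ℤ) ∣ v.y ∧ (p : ℤ) ∣ v.z then
      (starRingEnd ℂ) (χ (v.d : ZMod p)) else 0
  | 1, v => if (p : ℤ) ∣ v.a then
      (if (p : ℤ) ∣ v.x then χ (v.z : ZMod p) else χ (v.x : ZMod p)) else 0
  | 2, v => χ (v.a : ZMod p)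

lemma intCast_eq_zero_of_dvd {p : ℕ} {n : ℤ} (h : (p : ℤ) ∣ n) : (n : ZMod p) = 0 :=
  (ZMod.intCast_zmod_eq_zero_iff_dvd n p).2 h

lemma dvd_of_intCast_eq_zero {p : ℕ} {n : ℤ} (h : (n : ZMod p) = 0) : (p : ℤ) ∣ n :=
  (ZMod.intCast_zmod_eq_zero_iff_dvd n p).1 h

lemma map_eq_zero_of_dvd {p : ℕ} (hp : p.Prime) (χ : DirichletCharacter ℂ p) {n : ℤ}
    (h : (p : ℤ) ∣ n) : χ (n : ZMod p) = 0 := by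
  have := Fact.mk hp
  rw [intCast_eq_zero_of_dvd h, MulChar.map_zero]

lemma hasRank_of_localFactor_ne_zero {p : ℕ} (hp : p.Prime) {χ : DirichletCharacter ℂ p} {r : Fin 3}
    {v : Plucker} (h : localFactor χ r v ≠ 0) : v.HasRank p r := by
  fin_cases r
  · by_contra h'
    exact h (if_neg h')
  · by_contra h'
    apply h
    have h' : (p : ℤ) ∣ v.a → (p : ℤ) ∣ v.x ∧ (p : ℤ) ∣ v.z := fun h1 => by
      by_contra h2
      exact h' ⟨h1, h2⟩
    simp only [localFactor]
    split_ifs with h1 h2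
    · exact map_eq_zero_of_dvd hp χ (h' h1).2
    · by_contra h3
      exact h2 (h' h1).1
    · rfl
  · intro h'
    exact h (map_eq_zero_of_dvd hp χ h')

lemma norm_localFactor_le {p : ℕ} (χ : DirichletCharacter ℂ p) (r : Fin 3)
    (v : Plucker) : ‖localFactor χ r v‖ ≤ 1 := by
  fin_cases r
  · simp only [localFactor]
    split_ifs
    · rw [RCLike.norm_conj]; exact DirichletCharacter.norm_le_one χ _
    · simp
  · simp only [localFactor]
    split_ifs
    · exact DirichletCharacter.norm_le_one χ _
    · exact DirichletCharacter.norm_le_one χ _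
    · simp
  · exact DirichletCharacter.norm_le_one χ _

open Classical in
/-- The coefficient of the summand of the Eisenstein series of the cusp with rank `rk p` at the
primes `p ∣ N`, as a function on Plücker coordinates. -/
noncomputable def weight (N : ℕ) (χ : DirichletCharacter ℂ N) (rk : ℕ → Fin 3) (v : Plucker) : ℂ :=
  if v.IsCone ∧ v.IsPrimitive then
    ∏ p ∈ N.primeFactors, localFactor (component χ p) (rk p) v else 0

lemma norm_weight_le (N : ℕ) (χ : DirichletCharacter ℂ N) (rk : ℕ → Fin 3) (v : Plucker) :
    ‖weight N χ rk v‖ ≤ 1 := by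
  rw [weight]
  split_ifs
  · rw [norm_prod]
    exact Finset.prod_le_one (fun _ _ => norm_nonneg _) fun p _ => norm_localFactor_le _ _ _
  · simp

lemma conj_apply_eq {n : ℕ} [NeZero n] (χ : DirichletCharacter ℂ n) {a b : ZMod n} (h : a * b = 1) :
    (starRingEnd ℂ) (χ a) = χ b := by
  have h1 : χ a * χ b = 1 := by rw [← map_mul, h, map_one]
  have hn : ‖χ a‖ = 1 := by
    have := DirichletCharacter.unit_norm_eq_one χ (Units.mk a b h (by rw [mul_comm, h]))
    simpa using this
  have h2 : (starRingEnd ℂ) (χ a) * χ a = 1 := by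
    rw [mul_comm, Complex.mul_conj, Complex.normSq_eq_norm_sq, hn]; simp
  calc (starRingEnd ℂ) (χ a) = (starRingEnd ℂ) (χ a) * (χ a * χ b) := by rw [h1, mul_one]
    _ = χ b := by rw [← mul_assoc, h2, one_mul]

lemma sq_apply_eq_one {p : ℕ} (hp : p.Prime) {χ : DirichletCharacter ℂ p} (hχ : χ ^ 2 = 1)
    {a : ZMod p} (ha : a ≠ 0) : χ (a ^ 2) = 1 := by
  have := Fact.mk hp
  rw [map_pow, ← MulChar.pow_apply' _ two_ne_zero, hχ, MulChar.one_apply (IsUnit.mk0 a ha)]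

lemma conj_apply_of_sq_eq_one {p : ℕ} (hp : p.Prime) {χ : DirichletCharacter ℂ p} (hχ : χ ^ 2 = 1)
    {a : ZMod p} (ha : a ≠ 0) : (starRingEnd ℂ) (χ a) = χ a := by
  have := Fact.mk hp
  rw [conj_apply_eq χ (mul_inv_cancel₀ ha)]
  have h1 : χ a * χ a = 1 := by rw [← map_mul, ← pow_two, sq_apply_eq_one hp hχ ha]
  have h2 : χ a * χ a⁻¹ = 1 := by rw [← map_mul, mul_inv_cancel₀ ha, map_one]
  have h3 : χ a ≠ 0 := fun h => by simp [h] at h1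
  exact mul_left_cancel₀ h3 (h2.trans h1.symm)

lemma det_blockA_mul_det_blockD {n : ℕ} {δ : Sp} (hC : ∀ i j, (n : ℤ) ∣ blockC δ i j) :
    (((blockA δ).det : ℤ) : ZMod n) * (((blockD δ).det : ℤ) : ZMod n) = 1 := by
  have h := (column_relations δ).2.2
  have e := congrArg (fun M : M2 ℤ => (M.map (Int.cast : ℤ → ZMod n)).det) h
  have hC' : (blockC δ).map (Int.cast : ℤ → ZMod n) = 0 := by
    ext i j
    simpa using intCast_eq_zero_of_dvd (hC i j)
  have hcast (M : M2 ℤ) : ((M.det : ℤ) : ZMod n) = (M.map (Int.cast : ℤ → ZMod n)).det :=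
    (Int.castRingHom (ZMod n)).map_det M
  have e2 : ((blockA δ)ᵀ * blockD δ - (blockC δ)ᵀ * blockB δ).map (Int.cast : ℤ → ZMod n) =
      ((blockA δ).map (Int.cast : ℤ → ZMod n))ᵀ * (blockD δ).map (Int.cast : ℤ → ZMod n) := by
    ext i j
    have h0 : ∀ i j, ((blockC δ i j : ℤ) : ZMod n) = 0 := fun i j => intCast_eq_zero_of_dvd (hC i j)
    simp [mul_apply, h0]
  rw [hcast, hcast, ← det_transpose, ← det_mul, ← e2, h]
  simp

/-- Modulo p the pair is (diag(d) A, diag(d) B + D) with A Dᵀ = 1. For rank 0 its last coordinate is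
det D. For rank 1 the diagonal entries of Q are det D times squares, invisible to a quadratic
character. For rank 2 the first coordinate is det A = (det D)⁻¹. -/
lemma localFactor_orbit {p : ℕ} (hp : p.Prime) (χ : DirichletCharacter ℂ p) {r : Fin 3}
    {d : Fin 2 → ℤ} (hd : DiagCongr p r d) (hχ : r = 1 → χ ^ 2 = 1) {δ : Sp}
    (hC : ∀ i j, (p : ℤ) ∣ blockC δ i j) :
    localFactor χ r (plucker (cuspElt d * δ)) =
      (starRingEnd ℂ) (χ ((blockD δ).det : ZMod p)) := by
  have hF := Fact.mk hp
  have hC' : ∀ i j, ((blockC δ i j : ℤ) : ZMod p) = 0 := fun i j => intCast_eq_zero_of_dvd (hC i j)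
  have hAD : ∀ i j, ((blockA δ i 0 : ℤ) : ZMod p) * (blockD δ j 0 : ℤ) +
      (blockA δ i 1 : ℤ) * (blockD δ j 1 : ℤ) = if i = j then 1 else 0 := fun i j => by
    have h := congrFun (congrFun (row_relations δ).2.2 i) j
    simp only [Matrix.sub_apply, mul_apply, Fin.sum_univ_two, transpose_apply, Matrix.one_apply] at h
    have := congrArg (Int.cast : ℤ → ZMod p) h
    push_cast at this
    simpa [hC'] using this
  have hDA : ∀ i j, ((blockD δ 0 i : ℤ) : ZMod p) * (blockA δ 0 j : ℤ) +
      (blockD δ 1 i : ℤ) * (blockA δ 1 j : ℤ) = if i = j then 1 else 0 := fun i j => by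
    have h := congrFun (congrFun (column_relations δ).2.2 j) i
    simp only [Matrix.sub_apply, mul_apply, Fin.sum_univ_two, transpose_apply, Matrix.one_apply] at h
    have := congrArg (Int.cast : ℤ → ZMod p) h
    push_cast at this
    simp only [hC', zero_mul, add_zero, sub_zero] at this
    rw [mul_comm, mul_comm ((blockD δ 1 i : ℤ) : ZMod p), this]
    simp [eq_comm]
  have h00 := hAD 0 0
  have h01 := hAD 0 1
  have h10 := hAD 1 0
  have h11 := hAD 1 1
  have k00 := hDA 0 0
  have k01 := hDA 0 1
  have k10 := hDA 1 0
  have k11 := hDA 1 1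
  have hMc : ∀ i j, ((blockC (cuspElt d * δ) i j : ℤ) : ZMod p) = d i * blockA δ i j := fun i j => by
    rw [blockC_cuspElt_mul, Matrix.add_apply, diagonal_mul]; push_cast; rw [hC', add_zero]
  have hNc : ∀ i j, ((blockD (cuspElt d * δ) i j : ℤ) : ZMod p) = d i * blockB δ i j + blockD δ i j :=
    fun i j => by
      rw [blockD_cuspElt_mul, Matrix.add_apply, diagonal_mul]; push_cast; rfl
  have va : ((plucker (cuspElt d * δ)).a : ZMod p) = d 0 * d 1 *
      (blockA δ 0 0 * blockA δ 1 1 - blockA δ 0 1 * blockA δ 1 0) := by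
    simp only [plucker, ofPair]; push_cast; simp only [hMc]; ring
  have vx : ((plucker (cuspElt d * δ)).x : ZMod p) =
      (d 1 * blockB δ 1 1 + blockD δ 1 1) * (d 0 * blockA δ 0 0) -
      (d 0 * blockB δ 0 1 + blockD δ 0 1) * (d 1 * blockA δ 1 0) := by
    simp only [plucker, ofPair]; push_cast; simp only [hMc, hNc]
  have vy : ((plucker (cuspElt d * δ)).y : ZMod p) =
      (d 1 * blockB δ 1 1 + blockD δ 1 1) * (d 0 * blockA δ 0 1) -
      (d 0 * blockB δ 0 1 + blockD δ 0 1) * (d 1 * blockA δ 1 1) := by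
    simp only [plucker, ofPair]; push_cast; simp only [hMc, hNc]
  have vz : ((plucker (cuspElt d * δ)).z : ZMod p) =
      (d 0 * blockB δ 0 0 + blockD δ 0 0) * (d 1 * blockA δ 1 1) -
      (d 1 * blockB δ 1 0 + blockD δ 1 0) * (d 0 * blockA δ 0 1) := by
    simp only [plucker, ofPair]; push_cast; simp only [hMc, hNc]
  have vd : ((plucker (cuspElt d * δ)).d : ZMod p) =
      (d 0 * blockB δ 0 0 + blockD δ 0 0) * (d 1 * blockB δ 1 1 + blockD δ 1 1) -
      (d 0 * blockB δ 0 1 + blockD δ 0 1) * (d 1 * blockB δ 1 0 + blockD δ 1 0) := by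
    simp only [plucker, ofPair]; push_cast; simp only [hNc]
  have he : (((blockD δ).det : ℤ) : ZMod p) =
      blockD δ 0 0 * blockD δ 1 1 - blockD δ 0 1 * blockD δ 1 0 := by
    rw [det_fin_two]; push_cast; rfl
  simp only [if_true, Fin.zero_eq_one_iff, Fin.one_eq_zero_iff, OfNat.ofNat_ne_one, if_false]
    at h00 h01 h10 h11 k00 k01 k10 k11
  have hae : ((blockA δ 0 0 : ZMod p) * blockA δ 1 1 - blockA δ 0 1 * blockA δ 1 0) *
      (((blockD δ).det : ℤ) : ZMod p) = 1 := by
    rw [he]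
    linear_combination (blockA δ 1 0 * blockD δ 1 0 + blockA δ 1 1 * blockD δ 1 1 : ZMod p) * h00 +
      h11 - (blockA δ 1 0 * blockD δ 0 0 + blockA δ 1 1 * blockD δ 0 1 : ZMod p) * h01
  have he0 : (((blockD δ).det : ℤ) : ZMod p) ≠ 0 := fun h => by simp [h] at hae
  fin_cases r
  · obtain ⟨hd0, hd1⟩ := hd
    have hd0 := intCast_eq_zero_of_dvd hd0
    have hd1 := intCast_eq_zero_of_dvd hd1
    simp only [hd0, hd1, zero_mul, mul_zero, zero_add, sub_zero] at va vx vy vz vd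
    simp only [localFactor]
    rw [if_pos ⟨dvd_of_intCast_eq_zero va, dvd_of_intCast_eq_zero vx, dvd_of_intCast_eq_zero vy,
      dvd_of_intCast_eq_zero vz⟩, vd, he]
  · have hχ := hχ rfl
    obtain ⟨hd0, hd1⟩ := hd
    have hd0 := intCast_eq_of_dvd_sub hd0
    have hd1 := intCast_eq_zero_of_dvd hd1
    simp only [hd0, hd1, Int.cast_one, zero_mul, mul_zero, one_mul, zero_add, zero_sub, sub_zero]
      at va vx vz
    have hx : ((plucker (cuspElt d * δ)).x : ZMod p) =
        (((blockD δ).det : ℤ) : ZMod p) * (blockA δ 0 0 : ZMod p) ^ 2 := by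
      rw [vx, he]
      linear_combination (-(blockA δ 0 0 : ZMod p)) * blockD δ 1 1 * k00 +
        (blockA δ 0 0 : ZMod p) * blockD δ 1 0 * k10
    have hz : ((plucker (cuspElt d * δ)).z : ZMod p) =
        (((blockD δ).det : ℤ) : ZMod p) * (blockA δ 0 1 : ZMod p) ^ 2 := by
      rw [vz, he]
      linear_combination (-(blockA δ 0 1 : ZMod p)) * blockD δ 1 1 * k01 +
        (blockA δ 0 1 : ZMod p) * blockD δ 1 0 * k11
    rw [conj_apply_of_sq_eq_one hp hχ he0]
    simp only [localFactor]
    rw [if_pos (dvd_of_intCast_eq_zero va)]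
    split_ifs with h
    -- The first row of A is nonzero modulo p, so when its first entry vanishes the second one does
    -- not.
    · have hA0 : (blockA δ 0 0 : ZMod p) = 0 := by
        rw [intCast_eq_zero_of_dvd h] at hx
        rcases mul_eq_zero.1 hx.symm with h' | h'
        · exact absurd h' he0
        · exact pow_eq_zero_iff two_ne_zero |>.1 h'
      have hA1 : (blockA δ 0 1 : ZMod p) ≠ 0 := fun hA1 => by
        rw [hA0, hA1] at h00; simp at h00
      rw [hz, map_mul, sq_apply_eq_one hp hχ hA1, mul_one]
    · have hA0 : (blockA δ 0 0 : ZMod p) ≠ 0 := fun hA0 => by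
        apply h
        apply dvd_of_intCast_eq_zero
        rw [hx, hA0]; simp
      rw [hx, map_mul, sq_apply_eq_one hp hχ hA0, mul_one]
  · obtain ⟨hd0, hd1⟩ := hd
    have hd0 := intCast_eq_of_dvd_sub hd0
    have hd1 := intCast_eq_of_dvd_sub hd1
    simp only [hd0, hd1, Int.cast_one, one_mul] at va
    rw [conj_apply_eq χ (by rw [mul_comm]; exact hae)]
    simp only [localFactor]
    rw [va]

/-- The coefficient in the Eisenstein series in terms of Plücker coordinates. -/
lemma weight_orbit {N : ℕ} (hN : Squarefree N) (χ : DirichletCharacter ℂ N) {rk : ℕ → Fin 3}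
    {d : Fin 2 → ℤ} (hd : ∀ p : ℕ, p.Prime → p ∣ N → DiagCongr p (rk p) d)
    (hχ : ∀ p : ℕ, p.Prime → p ∣ N → rk p = 1 → component χ p ^ 2 = 1) (δ : Gamma0 N) :
    weight N χ rk (plucker (cuspElt d * δ)) =
      (starRingEnd ℂ) (χ (((blockD (δ : Sp)).det : ℤ) : ZMod N)) := by
  have hC : ∀ p : ℕ, p ∣ N → ∀ i j, (p : ℤ) ∣ blockC (δ : Sp) i j := fun p hp i j =>
    (Int.natCast_dvd_natCast.2 hp).trans (δ.2 i j)
  have hco : IsCoprime (blockD (δ : Sp)).det (N : ℤ) := by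
    rw [prime_intCast_coprime_iff]
    intro p hp hpN hpd
    have := Fact.mk hp
    have h := det_blockA_mul_det_blockD (δ := (δ : Sp)) (hC p hpN)
    rw [intCast_eq_zero_of_dvd hpd, mul_zero] at h
    exact zero_ne_one h
  rw [weight, if_pos ⟨isCone_plucker _, isPrimitive_plucker _⟩, apply_eq_prod_component hN χ hco,
    map_prod]
  refine Finset.prod_congr rfl fun p hp => ?_
  have hp' := Nat.prime_of_mem_primeFactors hp
  have hpN := Nat.dvd_of_mem_primeFactors hp
  exact localFactor_orbit hp' _ (hd p hp' hpN) (hχ p hp' hpN) (hC p hpN)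

/-! ### The Eisenstein series as a sum over the cone, and its transformation law. -/

lemma orbit_rel_iff {N : ℕ} {γ₀ : Sp} {δ δ' : Gamma0 N} :
    (orbitSetoid N γ₀) δ δ' ↔ plucker (γ₀ * δ) = plucker (γ₀ * δ') := by
  constructor
  · rintro ⟨G, hC, hD⟩
    rw [plucker, plucker, hC, hD, ofPair_sl_mul]
  · exact exists_sl_of_plucker_eq

/-- The Plücker coordinates of an `SL₂(ℤ)`-class in the orbit. -/
def orbitPlucker (N : ℕ) (γ₀ : Sp) : Quotient (orbitSetoid N γ₀) → Plucker :=
  Quotient.lift (fun δ => plucker (γ₀ * δ)) fun _ _ h => orbit_rel_iff.1 h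

lemma orbitPlucker_injective (N : ℕ) (γ₀ : Sp) : Function.Injective (orbitPlucker N γ₀) := by
  intro c c'
  induction c using Quotient.inductionOn
  induction c' using Quotient.inductionOn
  exact fun h => Quotient.sound (orbit_rel_iff.2 h)

lemma orbitPlucker_out {N : ℕ} {γ₀ : Sp} (c : Quotient (orbitSetoid N γ₀)) :
    plucker (γ₀ * (c.out : Gamma0 N)) = orbitPlucker N γ₀ c := by
  conv_rhs => rw [← c.out_eq]
  rfl

lemma oneSlash_eq (k : ℕ) (γ : Sp) (τ : M2 ℂ) :
    oneSlash k (blockC γ) (blockD γ) τ = (plucker γ).lin τ ^ (-(k : ℤ)) := by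
  rw [oneSlash, (symmPair_blocks γ).det_eq_lin, plucker]

/-- The cusp `diag(d 0, d 1)` has rank `rk p` at the primes `p ∣ N`, and `χ_p² = 1` if this rank
is one. -/
structure CuspData (N : ℕ) (χ : DirichletCharacter ℂ N) (rk : ℕ → Fin 3) (d : Fin 2 → ℤ) : Prop where
  squarefree : Squarefree N
  congr : ∀ p : ℕ, p.Prime → p ∣ N → DiagCongr p (rk p) d
  sq_eq_one : ∀ p : ℕ, p.Prime → p ∣ N → rk p = 1 → component χ p ^ 2 = 1

section
variable {N k : ℕ} {χ : DirichletCharacter ℂ N} {rk : ℕ → Fin 3} {d : Fin 2 → ℤ}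

lemma CuspData.weight_eq (h : CuspData N χ rk d) (δ : Gamma0 N) :
    weight N χ rk (plucker (cuspElt d * δ)) =
      (starRingEnd ℂ) (χ (((blockD (δ : Sp)).det : ℤ) : ZMod N)) :=
  weight_orbit h.squarefree χ h.congr h.sq_eq_one δ

lemma CuspData.eisenstein_eq_tsum_quotient (h : CuspData N χ rk d) (τ : M2 ℂ) :
    eisenstein N k χ (cuspElt d) τ = (1 / 2) * ∑' c : Quotient (orbitSetoid N (cuspElt d)),
      weight N χ rk (orbitPlucker N (cuspElt d) c) *
        (orbitPlucker N (cuspElt d) c).lin τ ^ (-(k : ℤ)) := by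
  rw [eisenstein]
  congr 1
  refine tsum_congr fun c => ?_
  rw [oneSlash_eq, ← h.weight_eq, orbitPlucker_out]

/-- The Eisenstein series as a sum over all integral points of the cone. -/
lemma CuspData.eisenstein_eq_tsum (h : CuspData N χ rk d) (τ : M2 ℂ) :
    eisenstein N k χ (cuspElt d) τ =
      (1 / 2) * ∑' v : Plucker, weight N χ rk v * v.lin τ ^ (-(k : ℤ)) := by
  rw [h.eisenstein_eq_tsum_quotient]
  congr 1
  refine (orbitPlucker_injective N (cuspElt d)).tsum_eq
    (f := fun v : Plucker => weight N χ rk v * v.lin τ ^ (-(k : ℤ))) ?_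
  -- A point of nonzero weight has the prescribed rank at every prime of N, so it lies in the orbit;
  -- all other points contribute zero.
  intro v hv
  have hw : weight N χ rk v ≠ 0 := left_ne_zero_of_mul hv
  rw [weight] at hw
  split_ifs at hw with hc
  · rw [Finset.prod_ne_zero_iff] at hw
    obtain ⟨δ, hδ⟩ := exists_gamma0_plucker_eq h.squarefree h.congr hc.1 hc.2 fun p hp hpN =>
      hasRank_of_localFactor_ne_zero hp
        (hw p (Nat.mem_primeFactors.2 ⟨hp, hpN, h.squarefree.ne_zero⟩))
    exact ⟨Quotient.mk _ δ, hδ⟩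
  · exact absurd rfl hw

lemma orbit_rel_mul {γ₀ : Sp} {δ δ' : Gamma0 N} (h : (orbitSetoid N γ₀) δ δ') (γ : Gamma0 N) :
    (orbitSetoid N γ₀) (δ * γ) (δ' * γ) := by
  obtain ⟨G, hC, hD⟩ := h
  refine ⟨G, ?_, ?_⟩
  · rw [Subgroup.coe_mul, Subgroup.coe_mul, ← mul_assoc, ← mul_assoc, blockC_mul_blocks, hC, hD,
      blockC_mul_blocks (γ₀ * δ), Matrix.mul_add, Matrix.mul_assoc, Matrix.mul_assoc]
  · rw [Subgroup.coe_mul, Subgroup.coe_mul, ← mul_assoc, ← mul_assoc, blockD_mul, hC, hD,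
      blockD_mul (γ₀ * δ), Matrix.mul_add, Matrix.mul_assoc, Matrix.mul_assoc]

/-- Right multiplication by an element of `Γ₀(N)` on the `SL₂(ℤ)`-classes in the orbit. -/
def orbitMulRight (γ₀ : Sp) (γ : Gamma0 N) :
    Quotient (orbitSetoid N γ₀) ≃ Quotient (orbitSetoid N γ₀) :=
  Quotient.congr (Equiv.mulRight γ) fun δ δ' =>
    ⟨fun h => orbit_rel_mul h γ, fun h => by
      have := orbit_rel_mul (γ₀ := γ₀) h γ⁻¹
      simpa using this⟩

/-- The cocycle relation for det(Cτ + D). The point σ = γ'τ enters through an equation free of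
inverses, so no invertibility is needed. -/
lemma lin_plucker_mul (γ γ' : Sp) {τ σ : M2 ℂ}
    (hσ : σ * ((blockC γ').map (Int.cast : ℤ → ℂ) * τ + (blockD γ').map (Int.cast : ℤ → ℂ)) =
      (blockA γ').map (Int.cast : ℤ → ℂ) * τ + (blockB γ').map (Int.cast : ℤ → ℂ)) :
    (plucker (γ * γ')).lin τ = (plucker γ).lin σ *
      ((blockC γ').map (Int.cast : ℤ → ℂ) * τ + (blockD γ').map (Int.cast : ℤ → ℂ)).det := by
  rw [plucker, ← (symmPair_blocks (γ * γ')).det_eq_lin, plucker, ← (symmPair_blocks γ).det_eq_lin,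
    ← det_mul, blockC_mul_blocks, blockD_mul]
  congr 1
  have hm (M M' : M2 ℤ) : (M * M').map (Int.cast : ℤ → ℂ) =
      M.map (Int.cast : ℤ → ℂ) * M'.map (Int.cast : ℤ → ℂ) := Matrix.map_mul (f := Int.castRingHom ℂ)
  have ha (M M' : M2 ℤ) : (M + M').map (Int.cast : ℤ → ℂ) =
      M.map (Int.cast : ℤ → ℂ) + M'.map (Int.cast : ℤ → ℂ) :=
    Matrix.map_add _ (fun _ _ => Int.cast_add _ _) _ _
  rw [Matrix.add_mul, Matrix.mul_assoc, hσ]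
  simp only [hm, ha, Matrix.add_mul, Matrix.mul_add, Matrix.mul_assoc]
  abel

lemma det_blockD_mul {δ γ : Sp} (hC : ∀ i j, (N : ℤ) ∣ blockC δ i j) :
    (((blockD (δ * γ)).det : ℤ) : ZMod N) =
      (((blockD δ).det : ℤ) : ZMod N) * (((blockD γ).det : ℤ) : ZMod N) := by
  have h0 : ∀ i j, ((blockC δ i j : ℤ) : ZMod N) = 0 := fun i j => intCast_eq_zero_of_dvd (hC i j)
  rw [blockD_mul]
  simp only [det_fin_two, Matrix.add_apply, mul_apply, Fin.sum_univ_two]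
  push_cast
  simp only [h0]
  ring

/-- The transformation law of the Eisenstein series under `Γ₀(N)`. -/
lemma CuspData.eisenstein_transform (h : CuspData N χ rk d) (γ : Gamma0 N) {τ σ : M2 ℂ}
    (hσ : σ * ((blockC (γ : Sp)).map (Int.cast : ℤ → ℂ) * τ +
        (blockD (γ : Sp)).map (Int.cast : ℤ → ℂ)) =
      (blockA (γ : Sp)).map (Int.cast : ℤ → ℂ) * τ + (blockB (γ : Sp)).map (Int.cast : ℤ → ℂ)) :
    eisenstein N k χ (cuspElt d) τ = (starRingEnd ℂ) (χ (((blockD (γ : Sp)).det : ℤ) : ZMod N)) *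
      ((blockC (γ : Sp)).map (Int.cast : ℤ → ℂ) * τ +
        (blockD (γ : Sp)).map (Int.cast : ℤ → ℂ)).det ^ (-(k : ℤ)) *
      eisenstein N k χ (cuspElt d) σ := by
  rw [h.eisenstein_eq_tsum_quotient, h.eisenstein_eq_tsum_quotient,
    ← (orbitMulRight (cuspElt d) γ).tsum_eq fun c => weight N χ rk (orbitPlucker N (cuspElt d) c) *
        (orbitPlucker N (cuspElt d) c).lin τ ^ (-(k : ℤ)), mul_left_comm]
  congr 1
  rw [← tsum_mul_left]
  refine tsum_congr fun c => ?_
  induction c using Quotient.inductionOn with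
  | h δ =>
  have e1 : orbitPlucker N (cuspElt d) (orbitMulRight (cuspElt d) γ (Quotient.mk _ δ)) =
    plucker (cuspElt d * (δ * γ : Gamma0 N)) := rfl
  have e2 : orbitPlucker N (cuspElt d) (Quotient.mk _ δ) = plucker (cuspElt d * δ) := rfl
  rw [e1, e2, h.weight_eq, h.weight_eq, Subgroup.coe_mul, det_blockD_mul δ.2, map_mul, map_mul,
    ← mul_assoc, lin_plucker_mul _ _ hσ, mul_zpow]
  ring

end

/-! ### The count over a finite field. -/

lemma sum_rotate {F : Type*} [Fintype F] (f : F → F → F → ℂ) :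
    ∑ s : F, ∑ t : F, ∑ u : F, f s t u = ∑ u : F, ∑ t : F, ∑ s : F, f s t u := by
  rw [Finset.sum_comm]
  have : ∀ t : F, ∑ s : F, ∑ u : F, f s t u = ∑ u : F, ∑ s : F, f s t u := fun t => Finset.sum_comm
  simp only [this]
  rw [Finset.sum_comm]

section Count

variable {F : Type*} [Field F] [Fintype F] [DecidableEq F]

/-- The value of a quadratic character at a singular symmetric matrix `(x y; y z)`, expressed by
its diagonal entries. -/
noncomputable def singularChar (χ : MulChar F ℂ) (x z : F) : ℂ := if x = 0 then χ z else χ x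

lemma sum_ite_linear_eq {a : F} (ha : a ≠ 0) (b : F) (c : ℂ) :
    ∑ s : F, (if b + a * s = 0 then c else 0) = c := by
  rw [Finset.sum_eq_single (-b / a)]
  · rw [if_pos]; field_simp; ring
  · intro s _ hs
    rw [if_neg]
    intro h
    apply hs
    field_simp
    linear_combination h
  · simp

/-- If x ≠ 0, then y is free and determines z, so χ(x) occurs once for every y. If x = 0, then y = 0
and z is free, which supplies the additional 1. -/
lemma sum_singularChar (χ : MulChar F ℂ) :
    ∑ x : F, ∑ y : F, ∑ z : F, (if x * z - y ^ 2 = 0 then singularChar χ x z else 0) =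
      (Fintype.card F + 1) * ∑ w : F, χ w := by
  have h1 : ∀ x : F, ∑ y : F, ∑ z : F, (if x * z - y ^ 2 = 0 then singularChar χ x z else 0) =
      Fintype.card F * χ x + if x = 0 then ∑ w : F, χ w else 0 := by
    intro x
    by_cases hx : x = 0
    · subst hx
      rw [Finset.sum_eq_single 0]
      · simp [singularChar, MulChar.map_zero]
      · intro y _ hy
        simp [hy]
      · simp
    · have : ∀ y : F, ∑ z : F, (if x * z - y ^ 2 = 0 then singularChar χ x z else 0) = χ x := by
        intro y
        simp only [singularChar, hx, if_false]
        refine Eq.trans (Finset.sum_congr rfl fun z _ => ?_) (sum_ite_linear_eq hx (-y ^ 2) (χ x))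
        congr 2
        ring
      simp [this, hx]
  simp only [h1, Finset.sum_add_distrib, ← Finset.mul_sum, Finset.sum_ite_eq', Finset.mem_univ,
    if_true]
  ring

/-- The number of symmetric matrices `S = (s t; t u)` weighted by a quadratic character. -/
lemma sum_singularChar_translate (χ : MulChar F ℂ) {a x y z d : F} (h : x * z - y ^ 2 = a * d) :
    ∑ s : F, ∑ t : F, ∑ u : F,
      (if d - (x * s + 2 * y * t + z * u) + a * (s * u - t ^ 2) = 0 then
        singularChar χ (x - a * u) (z - a * s) else 0) =
      (if a = 0 then (Fintype.card F : ℂ) ^ 2 * singularChar χ x z else 0) +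
        (Fintype.card F + 1) * (∑ w : F, χ w) * χ a := by
  by_cases ha : a = 0
  · subst ha
    have hsimp : ∀ s t u : F, (if d - (x * s + 2 * y * t + z * u) + 0 * (s * u - t ^ 2) = 0 then
        singularChar χ (x - 0 * u) (z - 0 * s) else 0) =
        if d - (x * s + 2 * y * t + z * u) = 0 then singularChar χ x z else 0 := by
      intro s t u; simp
    simp only [hsimp, if_true, MulChar.map_zero, mul_zero, add_zero]
    -- With a = 0 the condition is linear in S. A nonzero diagonal entry of Q lets one solve for s
    -- or u; if both vanish, `singularChar` is zero anyway.
    by_cases hz : z = 0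
    · by_cases hx : x = 0
      · simp [singularChar, hx, hz, MulChar.map_zero]
      · rw [sum_rotate]
        have : ∀ u t : F, ∑ s : F, (if d - (x * s + 2 * y * t + z * u) = 0 then
            singularChar χ x z else 0) = singularChar χ x z := by
          intro u t
          refine Eq.trans (Finset.sum_congr rfl fun s _ => ?_)
            (sum_ite_linear_eq (neg_ne_zero.2 hx) (d - 2 * y * t - z * u) _)
          congr 2
          ring
        simp only [this, Finset.sum_const, Finset.card_univ, nsmul_eq_mul]
        ring
    · have : ∀ s t : F, ∑ u : F, (if d - (x * s + 2 * y * t + z * u) = 0 then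
            singularChar χ x z else 0) = singularChar χ x z := by
        intro s t
        refine Eq.trans (Finset.sum_congr rfl fun u _ => ?_)
          (sum_ite_linear_eq (neg_ne_zero.2 hz) (d - x * s - 2 * y * t) _)
        congr 2
        ring
      simp only [this, Finset.sum_const, Finset.card_univ, nsmul_eq_mul]
      ring
  -- Multiplication by a permutes F, so the full character sum absorbs χ(a).
  · have hχ : (∑ w : F, χ w) * χ a = ∑ w : F, χ w := by
      rw [Finset.sum_mul, ← Equiv.sum_comp (Equiv.mulRight₀ a ha) fun w => χ w]
      simp
    rw [if_neg ha, zero_add, mul_assoc, hχ, ← sum_singularChar]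
    have e : ∀ b c : F, b ≠ 0 → ∀ f : F → ℂ, ∑ s : F, f (c + b * s) = ∑ s : F, f s := by
      intro b c hb f
      exact ((Equiv.mulLeft₀ b hb).trans (Equiv.addLeft c)).sum_comp f
    have hna : -a ≠ 0 := neg_ne_zero.2 ha
    rw [← sum_rotate fun z y x : F => if x * z - y ^ 2 = 0 then singularChar χ x z else 0]
    refine Eq.trans (Finset.sum_congr rfl fun s _ => ?_) (e (-a) z hna _)
    refine Eq.trans (Finset.sum_congr rfl fun t _ => ?_) (e a y ha _)
    refine Eq.trans (Finset.sum_congr rfl fun u _ => ?_) (e (-a) x hna _)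
    -- By the cone equation, a times the left-hand quantity is det(Q - a adj S). The affine
    -- substitution therefore reduces the sum to one over all singular symmetric matrices.
    have hiff : d - (x * s + 2 * y * t + z * u) + a * (s * u - t ^ 2) = 0 ↔
        (x + -a * u) * (z + -a * s) - (y + a * t) ^ 2 = 0 := by
      have : (x + -a * u) * (z + -a * s) - (y + a * t) ^ 2 =
          a * (d - (x * s + 2 * y * t + z * u) + a * (s * u - t ^ 2)) := by
        linear_combination h
      rw [this, mul_eq_zero, or_iff_right ha]
    simp only [hiff, neg_mul, ← sub_eq_add_neg]

end Count

/-! ### The terms of the Hecke operator on Plücker coordinates. -/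

/-- `d - tr(QS) + a det S` for `S = (s t; t u)`. -/
def Plucker.residue (s t u : ℤ) (v : Plucker) : ℤ :=
  v.d - (v.x * s + 2 * v.y * t + v.z * u) + v.a * (s * u - t ^ 2)

/-- If `q ∣ v.residue s t u`, the point sent to `v` by the term `S = (s t; t u)` of the Hecke
operator `T(q)`. -/
def Plucker.heckePreimage (q s t u : ℤ) (v : Plucker) : Plucker where
  a := q * v.a
  x := v.x - v.a * u
  y := v.y + v.a * t
  z := v.z - v.a * s
  d := v.residue s t u / q

lemma Plucker.mul_heckePreimage_d {q : ℕ} {s t u : ℤ} {v : Plucker}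
    (hr : (q : ℤ) ∣ v.residue s t u) :
    (q : ℤ) * (v.heckePreimage q s t u).d = v.residue s t u :=
  Int.mul_ediv_cancel' hr

/-- det(Q - a adj S) = det Q - a tr(QS) + a² det S, and subtracting a times the residue leaves det Q
- a d. -/
lemma Plucker.isCone_heckePreimage_iff {q : ℕ} {s t u : ℤ} {v : Plucker}
    (hr : (q : ℤ) ∣ v.residue s t u) :
    (v.heckePreimage q s t u).IsCone ↔ v.IsCone := by
  have h := mul_heckePreimage_d hr
  simp only [residue] at h
  rw [IsCone, IsCone]
  simp only [heckePreimage] at h ⊢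
  constructor
  · intro h1; linear_combination h1 + v.a * h
  · intro h1; linear_combination h1 - v.a * h

lemma Plucker.dvdAll_heckePreimage_iff {q : ℕ} (hq : q.Prime) {s t u : ℤ} {v : Plucker}
    (hr : (q : ℤ) ∣ v.residue s t u) {p : ℕ} (hp : p.Prime) (hpq : p ≠ q) :
    (v.heckePreimage q s t u).DvdAll p ↔ v.DvdAll p := by
  have h := mul_heckePreimage_d hr
  have hpi := Nat.prime_iff_prime_int.1 hp
  have hpq' : ¬ (p : ℤ) ∣ q := fun h => hpq ((Nat.prime_dvd_prime_iff_eq hp hq).1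
    (by exact_mod_cast h))
  simp only [residue] at h
  constructor
  · rintro ⟨h1, h2, h3, h4, h5⟩
    have a1 : (p : ℤ) ∣ v.a := (hpi.dvd_or_dvd h1).resolve_left hpq'
    have a2 : (p : ℤ) ∣ v.x := (dvd_sub_left (a1.mul_right _)).1 h2
    have a3 : (p : ℤ) ∣ v.y := (dvd_add_left (a1.mul_right _)).1 h3
    have a4 : (p : ℤ) ∣ v.z := (dvd_sub_left (a1.mul_right _)).1 h4
    refine ⟨a1, a2, a3, a4, ?_⟩
    have e : v.d = q * (v.heckePreimage q s t u).d + (v.x * s + v.y * (2 * t) + v.z * u)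
      - v.a * (s * u - t ^ 2) := by linear_combination -h
    rw [e]
    exact ((h5.mul_left _).add (((a2.mul_right _).add (a3.mul_right _)).add (a4.mul_right _))).sub
      (a1.mul_right _)
  · rintro ⟨a1, a2, a3, a4, a5⟩
    refine ⟨a1.mul_left _, a2.sub (a1.mul_right _), a3.add (a1.mul_right _),
      a4.sub (a1.mul_right _), (hpi.dvd_or_dvd ?_).resolve_left hpq'⟩
    rw [h]
    have e : v.d - (v.x * s + 2 * v.y * t + v.z * u) + v.a * (s * u - t ^ 2) =
      v.d - (v.x * s + v.y * (2 * t) + v.z * u) + v.a * (s * u - t ^ 2) := by ring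
    rw [e]
    exact (a5.sub (((a2.mul_right _).add (a3.mul_right _)).add (a4.mul_right _))).add
      (a1.mul_right _)

/-- Away from q the change of coordinates is invertible. At q a nonzero rank-one factor says that q
does not divide both diagonal entries of the transformed Q, and this forces both points to be
primitive at q. -/
lemma Plucker.isPrimitive_heckePreimage_iff {q : ℕ} (hq : q.Prime) {s t u : ℤ} {v : Plucker}
    (hr : (q : ℤ) ∣ v.residue s t u) {χ : DirichletCharacter ℂ q}
    (h : localFactor χ 1 (v.heckePreimage q s t u) ≠ 0) :
    (v.heckePreimage q s t u).IsPrimitive ↔ v.IsPrimitive := by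
  have hrank := hasRank_of_localFactor_ne_zero hq h
  refine forall_congr' fun p => forall_congr' fun hp => ?_
  by_cases hpq : p = q
  · subst hpq
    refine not_congr ⟨fun h' => absurd ⟨h'.2.1, h'.2.2.2.1⟩ hrank.2, fun h' => ?_⟩
    exact absurd ⟨h'.2.1.sub (h'.1.mul_right _), h'.2.2.2.1.sub (h'.1.mul_right _)⟩ hrank.2
  · rw [dvdAll_heckePreimage_iff hq hr hp hpq]

/-- For p ≠ q, a is multiplied by q; when p ∣ a, Q is unchanged modulo p, and when p divides Q as
well, d is divided by q modulo p. Conjugation in the rank 0 factor turns χ(q)⁻¹ into χ(q), while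
rank 1 sees only Q. -/
lemma localFactor_heckePreimage {q : ℕ} (hq : q.Prime) {s t u : ℤ} {v : Plucker}
    (hr : (q : ℤ) ∣ v.residue s t u) {p : ℕ} (hp : p.Prime) (hpq : p ≠ q) (χ : DirichletCharacter ℂ p)
    (r : Fin 3) : localFactor χ r (v.heckePreimage q s t u) =
      (if r = 1 then 1 else χ (q : ZMod p)) * localFactor χ r v := by
  have h := mul_heckePreimage_d hr
  have := Fact.mk hp
  have hpi := Nat.prime_iff_prime_int.1 hp
  have hpq' : ¬ (p : ℤ) ∣ q := fun h => hpq ((Nat.prime_dvd_prime_iff_eq hp hq).1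
    (by exact_mod_cast h))
  have hq0 : (q : ZMod p) ≠ 0 := fun h0 => hpq' (dvd_of_intCast_eq_zero (by simpa using h0))
  have ha : (p : ℤ) ∣ (v.heckePreimage q s t u).a ↔ (p : ℤ) ∣ v.a :=
    ⟨fun h => (hpi.dvd_or_dvd h).resolve_left hpq', fun h => h.mul_left _⟩
  fin_cases r
  · rw [if_neg (by decide)]
    simp only [localFactor, ha]
    by_cases h1 : (p : ℤ) ∣ v.a
    · have hx : (p : ℤ) ∣ (v.heckePreimage q s t u).x ↔ (p : ℤ) ∣ v.x := dvd_sub_left (h1.mul_right _)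
      have hy : (p : ℤ) ∣ (v.heckePreimage q s t u).y ↔ (p : ℤ) ∣ v.y := dvd_add_left (h1.mul_right _)
      have hz : (p : ℤ) ∣ (v.heckePreimage q s t u).z ↔ (p : ℤ) ∣ v.z := dvd_sub_left (h1.mul_right _)
      simp only [hx, hy, hz]
      split_ifs with h2
      · have hd : (v.d : ZMod p) = q * ((v.heckePreimage q s t u).d : ZMod p) := by
          have := congrArg (Int.cast : ℤ → ZMod p) h
          simp only [residue] at this
          push_cast at this
          rw [intCast_eq_zero_of_dvd h2.1, intCast_eq_zero_of_dvd h2.2.1,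
            intCast_eq_zero_of_dvd h2.2.2.1, intCast_eq_zero_of_dvd h2.2.2.2] at this
          rw [this]; ring
        rw [hd, map_mul, map_mul, conj_apply_eq χ (mul_inv_cancel₀ hq0), ← mul_assoc]
        rw [← map_mul, mul_inv_cancel₀ hq0, map_one, one_mul]
      · simp
    · simp [h1]
  · simp only [localFactor, ha]
    by_cases h1 : (p : ℤ) ∣ v.a
    · have hx : (p : ℤ) ∣ (v.heckePreimage q s t u).x ↔ (p : ℤ) ∣ v.x := dvd_sub_left (h1.mul_right _)
      have hxc : ((v.heckePreimage q s t u).x : ZMod p) = v.x := by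
        simp [heckePreimage, intCast_eq_zero_of_dvd h1]
      have hzc : ((v.heckePreimage q s t u).z : ZMod p) = v.z := by
        simp [heckePreimage, intCast_eq_zero_of_dvd h1]
      simp only [hx, hxc, hzc]
      simp
    · simp [h1]
  · simp [localFactor, heckePreimage]

lemma localFactor_one_eq_singularChar {q : ℕ} [Fact q.Prime] (χ : DirichletCharacter ℂ q)
    (v : Plucker) : localFactor χ 1 v =
      if (v.a : ZMod q) = 0 then singularChar χ (v.x : ZMod q) (v.z : ZMod q) else 0 := by
  simp only [localFactor, singularChar, ← ZMod.intCast_zmod_eq_zero_iff_dvd]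

/-- The first coordinate qa is automatically divisible by q, so only the residue condition remains
and the finite field count applies. -/
lemma sum_localFactor_heckePreimage {q : ℕ} [Fact q.Prime] (χ : DirichletCharacter ℂ q) {v : Plucker}
    (hv : v.IsCone) :
    ∑ s : ZMod q, ∑ t : ZMod q, ∑ u : ZMod q,
      (if (q : ℤ) ∣ v.residue s.val t.val u.val then
        localFactor χ 1 (v.heckePreimage q s.val t.val u.val) else 0) =
      (q : ℂ) ^ 2 * localFactor χ 1 v + (q + 1) * (∑ w : ZMod q, χ w) * localFactor χ 2 v := by
  have h : (v.x : ZMod q) * v.z - (v.y : ZMod q) ^ 2 = v.a * v.d := by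
    have := congrArg (Int.cast : ℤ → ZMod q) hv
    push_cast at this
    exact this
  have := sum_singularChar_translate χ h
  rw [ZMod.card] at this
  rw [localFactor_one_eq_singularChar, mul_ite, mul_zero]
  refine Eq.trans ?_ this
  refine Finset.sum_congr rfl fun s _ => Finset.sum_congr rfl fun t _ =>
    Finset.sum_congr rfl fun u _ => ?_
  simp only [localFactor_one_eq_singularChar, ← ZMod.intCast_zmod_eq_zero_iff_dvd]
  simp [residue, heckePreimage]

/-- The coefficients of the image of an Eisenstein series under `T(q)`. -/
lemma sum_weight_heckePreimage {N : ℕ} (hN : Squarefree N) (χ : DirichletCharacter ℂ N)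
    (rk : ℕ → Fin 3) {q : ℕ} [hq : Fact q.Prime] (hqN : q ∣ N) (hrk : rk q = 1) (v : Plucker) :
    ∑ s : ZMod q, ∑ t : ZMod q, ∑ u : ZMod q,
      (if (q : ℤ) ∣ v.residue s.val t.val u.val then
        weight N χ rk (v.heckePreimage q s.val t.val u.val) else 0) =
      (∏ p ∈ N.primeFactors.erase q, if rk p = 1 then 1 else component χ p (q : ZMod p)) *
        ((q : ℂ) ^ 2 * weight N χ rk v + (q + 1) * (∑ w : ZMod q, component χ q w) *
          weight N χ (Function.update rk q 2) v) := by
  classical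
  have hmem : q ∈ N.primeFactors := Nat.mem_primeFactors.2 ⟨hq.out, hqN, hN.ne_zero⟩
  set R := ∏ p ∈ N.primeFactors.erase q, localFactor (component χ p) (rk p) v with hR
  set C := ∏ p ∈ N.primeFactors.erase q, if rk p = 1 then 1 else component χ p (q : ZMod p)
  have hw : ∀ v', weight N χ rk v' = if v'.IsCone ∧ v'.IsPrimitive then
      localFactor (component χ q) 1 v' *
        ∏ p ∈ N.primeFactors.erase q, localFactor (component χ p) (rk p) v' else 0 := by
    intro v'
    rw [weight, ← Finset.mul_prod_erase _ _ hmem, hrk]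
  have hw2 : weight N χ (Function.update rk q 2) v = if v.IsCone ∧ v.IsPrimitive then
      localFactor (component χ q) 2 v * R else 0 := by
    rw [weight, ← Finset.mul_prod_erase _ _ hmem, Function.update_self]
    congr 2
    refine Finset.prod_congr rfl fun p hp => ?_
    rw [Function.update_of_ne (Finset.ne_of_mem_erase hp)]
  -- Only the local factor at q depends on S; the factors at the other primes come out of the triple
  -- sum.
  have hterm : ∀ s t u : ℤ, (if (q : ℤ) ∣ v.residue s t u then
      weight N χ rk (v.heckePreimage q s t u) else 0) =
      (if v.IsCone ∧ v.IsPrimitive then C * R else 0) * (if (q : ℤ) ∣ v.residue s t u then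
        localFactor (component χ q) 1 (v.heckePreimage q s t u) else 0) := by
    intro s t u
    by_cases hr : (q : ℤ) ∣ v.residue s t u
    · rw [if_pos hr, if_pos hr, hw]
      by_cases h0 : localFactor (component χ q) 1 (v.heckePreimage q s t u) = 0
      · simp [h0]
      · rw [isCone_heckePreimage_iff hr, isPrimitive_heckePreimage_iff hq.out hr h0]
        have : ∏ p ∈ N.primeFactors.erase q,
            localFactor (component χ p) (rk p) (v.heckePreimage q s t u) = C * R := by
          rw [← Finset.prod_mul_distrib]
          refine Finset.prod_congr rfl fun p hp => ?_
          exact localFactor_heckePreimage hq.out hr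
            (Nat.prime_of_mem_primeFactors (Finset.mem_of_mem_erase hp))
            (Finset.ne_of_mem_erase hp) _ _
        rw [this]
        split_ifs
        · ring
        · simp
    · rw [if_neg hr, if_neg hr, mul_zero]
  simp only [hterm, ← Finset.mul_sum]
  rw [hw, hw2]
  by_cases hv : v.IsCone ∧ v.IsPrimitive
  · rw [if_pos hv, if_pos hv, if_pos hv, sum_localFactor_heckePreimage _ hv.1]
    ring
  · simp [hv]

/-! ### Divisor bound and summability over the cone. -/

/-- For p ≥ 16 this follows from e + 1 ≤ 2^e. For smaller p, Bernoulli gives e + 1 ≤ 8 (9/8)^e, and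
(9/8)⁴ ≤ 2. Only the at most 16 primes below 16 cost a constant. -/
lemma add_one_pow_four_le {p : ℕ} (hp : 2 ≤ p) (e : ℕ) :
    (e + 1) ^ 4 ≤ (if p < 16 then 8 ^ 4 else 1) * p ^ e := by
  split_ifs with h
  · have h1 : (1 + (e : ℝ) * (1 / 8)) ≤ (1 + 1 / 8) ^ e :=
      one_add_mul_le_pow (by norm_num) e
    have h2 : ((e : ℝ) + 1) ≤ 8 * (9 / 8) ^ e := by
      have : (1 + 1 / 8 : ℝ) = 9 / 8 := by norm_num
      rw [this] at h1
      have he : (0 : ℝ) ≤ e := Nat.cast_nonneg e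
      linarith
    have h3 : ((e : ℝ) + 1) ^ 4 ≤ 8 ^ 4 * (p : ℝ) ^ e := by
      calc ((e : ℝ) + 1) ^ 4 ≤ (8 * (9 / 8) ^ e) ^ 4 := by gcongr
        _ = 8 ^ 4 * ((9 / 8) ^ 4) ^ e := by rw [mul_pow, ← pow_mul, ← pow_mul, mul_comm e]
        _ ≤ 8 ^ 4 * (p : ℝ) ^ e := by
          have : ((9 : ℝ) / 8) ^ 4 ≤ p := by
            have : (2 : ℝ) ≤ p := by exact_mod_cast hp
            refine le_trans ?_ this
            norm_num
          gcongr
    exact_mod_cast h3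
  · rw [one_mul]
    calc (e + 1) ^ 4 ≤ (2 ^ e) ^ 4 := by
          gcongr
          exact Nat.lt_two_pow_self
      _ = 16 ^ e := by rw [← pow_mul, mul_comm, pow_mul]; norm_num
      _ ≤ p ^ e := by gcongr; omega

/-- A bound for the number of divisors. -/
lemma card_divisors_pow_four_le (n : ℕ) (hn : n ≠ 0) : n.divisors.card ^ 4 ≤ (8 ^ 4) ^ 16 * n := by
  rw [Nat.card_divisors hn, ← Finset.prod_pow]
  calc ∏ p ∈ n.primeFactors, (n.factorization p + 1) ^ 4
      ≤ ∏ p ∈ n.primeFactors, ((if p < 16 then 8 ^ 4 else 1) * p ^ n.factorization p) :=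
        Finset.prod_le_prod' fun p hp =>
          add_one_pow_four_le (Nat.prime_of_mem_primeFactors hp).two_le _
    _ = (∏ p ∈ n.primeFactors, if p < 16 then 8 ^ 4 else 1) * n := by
        rw [Finset.prod_mul_distrib]
        congr 1
        exact Nat.prod_factorization_pow_eq_self hn
    _ ≤ (8 ^ 4) ^ 16 * n := by
        gcongr
        rw [← Finset.prod_filter, Finset.prod_const]
        refine Nat.pow_le_pow_right (by norm_num) ?_
        calc (n.primeFactors.filter (· < 16)).card ≤ (Finset.range 16).card :=
              Finset.card_le_card fun p hp => Finset.mem_range.2 (Finset.mem_filter.1 hp).2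
          _ = 16 := Finset.card_range 16

/-- `max(1, |n|)`. -/
noncomputable def height (n : ℤ) : ℝ := max 1 |(n : ℝ)|

lemma one_le_height (n : ℤ) : 1 ≤ height n := le_max_left _ _

lemma height_pos (n : ℤ) : 0 < height n := zero_lt_one.trans_le (one_le_height n)

lemma abs_le_height (n : ℤ) : |(n : ℝ)| ≤ height n := le_max_right _ _

lemma summable_height_rpow {r : ℝ} (hr : r < -1) : Summable fun n : ℤ => height n ^ r := by
  have h : Summable fun n : ℕ => height (n : ℤ) ^ r := by
    rw [← summable_nat_add_iff 1]
    refine ((summable_nat_add_iff 1).2 (Real.summable_nat_rpow.2 hr)).congr fun n => ?_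
    rw [height, max_eq_right]
    · congr 1
      push_cast
      rw [abs_of_nonneg]
      positivity
    · push_cast
      rw [abs_of_nonneg (by positivity)]
      simp
  refine Summable.of_nat_of_neg h (h.congr fun n => ?_)
  simp [height]

/-- The maximum of the heights. -/
noncomputable def height3 (v : ℤ × ℤ × ℤ) : ℝ := max (height v.1) (max (height v.2.1) (height v.2.2))

lemma one_le_height3 (v : ℤ × ℤ × ℤ) : 1 ≤ height3 v := (one_le_height _).trans (le_max_left _ _)

/-- The maximum dominates each height, so its r-th power is at most the product of the three powers
with exponent r/3 < -1. -/
lemma summable_height3_rpow {r : ℝ} (hr : r < -3) : Summable fun v : ℤ × ℤ × ℤ => height3 v ^ r := by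
  have h1 := summable_height_rpow (r := r / 3) (by linarith)
  have h0 : ∀ n, 0 ≤ height n ^ (r / 3) := fun n => Real.rpow_nonneg (height_pos n).le _
  have h2 := h1.mul_of_nonneg (h1.mul_of_nonneg h1 h0 h0) h0
    (fun x => mul_nonneg (h0 _) (h0 _))
  refine Summable.of_nonneg_of_le
    (fun v => Real.rpow_nonneg (zero_le_one.trans (one_le_height3 v)) _) (fun v => ?_) h2
  have hpos : 0 < height3 v := zero_lt_one.trans_le (one_le_height3 v)
  have e : height3 v ^ r = height3 v ^ (r / 3) * (height3 v ^ (r / 3) * height3 v ^ (r / 3)) := by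
    rw [← Real.rpow_add hpos, ← Real.rpow_add hpos]; congr 1; ring
  have hle : ∀ n, height n ≤ height3 v → height3 v ^ (r / 3) ≤ height n ^ (r / 3) := fun n hn =>
    Real.rpow_le_rpow_of_nonpos (height_pos n) hn (by linarith)
  rw [e]
  have hn := Real.rpow_nonneg hpos.le (r / 3)
  refine mul_le_mul (hle _ (le_max_left _ _)) (mul_le_mul (hle _ ?_) (hle _ ?_) hn (h0 _))
    (mul_nonneg hn hn) (h0 _)
  · exact (le_max_left _ _).trans (le_max_right _ _)
  · exact (le_max_right _ _).trans (le_max_right _ _)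

/-- The maximum of the heights of the coordinates. -/
noncomputable def Plucker.height (v : Plucker) : ℝ :=
  max (max (Siegel.height v.a) (Siegel.height v.d)) (height3 (v.x, v.y, v.z))

lemma Plucker.one_le_height (v : Plucker) : 1 ≤ v.height :=
  (one_le_height3 _).trans (le_max_right _ _)

/-- Meant for a stratum on which three coordinates determine the point: it is dominated by a sum
over ℤ³ with exponent -4 < -3. -/
lemma summable_indicator_of_injOn {S : Set Plucker} {f : Plucker → ℤ × ℤ × ℤ} (hf : S.InjOn f)
    (h : ∀ v ∈ S, height3 (f v) ≤ v.height) :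
    Summable (S.indicator fun v => v.height ^ (-4 : ℝ)) := by
  rw [← summable_subtype_iff_indicator]
  refine Summable.of_nonneg_of_le
    (fun v => Real.rpow_nonneg (zero_le_one.trans v.1.one_le_height) _) (fun v => ?_)
    ((summable_height3_rpow (r := -4) (by norm_num)).comp_injective (Set.injOn_iff_injective.1 hf))
  exact Real.rpow_le_rpow_of_nonpos (zero_lt_one.trans_le (one_le_height3 _)) (h v v.2) (by norm_num)

lemma card_divisors_le_of_bound {n : ℕ} (hn : n ≠ 0) {m : ℝ} (hm : 1 ≤ m) (h : (n : ℝ) ≤ 2 * m ^ 2) :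
    (n.divisors.card : ℝ) ≤ 2 * (8 ^ 4) ^ 16 * m ^ (1 / 2 : ℝ) := by
  have h1 : ((n.divisors.card : ℝ)) ^ 4 ≤ (8 ^ 4) ^ 16 * n := by
    exact_mod_cast card_divisors_pow_four_le n hn
  refine le_of_pow_le_pow_left₀ (n := 4) (by norm_num) (by positivity) (h1.trans ?_)
  have h2 : (m ^ (1 / 2 : ℝ)) ^ 4 = m ^ 2 := by
    rw [← Real.rpow_natCast, ← Real.rpow_mul (by positivity), ← Real.rpow_natCast]
    norm_num
  rw [mul_pow, h2]
  generalize hK : ((8 ^ 4) ^ 16 : ℝ) = K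
  have hK1 : 1 ≤ K := by rw [← hK]; norm_num
  calc K * n ≤ K * (2 * m ^ 2) := by gcongr
    _ = (2 * K) ^ 1 * m ^ 2 := by ring
    _ ≤ (2 * K) ^ 4 * m ^ 2 := by
      gcongr
      · linarith
      · norm_num

lemma abs_det_le (Q : ℤ × ℤ × ℤ) :
    |((Q.1 * Q.2.2 - Q.2.1 ^ 2 : ℤ) : ℝ)| ≤ 2 * height3 Q ^ 2 := by
  obtain ⟨x, y, z⟩ := Q
  have h0 := one_le_height3 (x, y, z)
  have hx : |(x : ℝ)| ≤ height3 (x, y, z) := (abs_le_height x).trans (le_max_left _ _)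
  have hy : |(y : ℝ)| ≤ height3 (x, y, z) :=
    (abs_le_height y).trans ((le_max_left _ _).trans (le_max_right _ _))
  have hz : |(z : ℝ)| ≤ height3 (x, y, z) :=
    (abs_le_height z).trans ((le_max_right _ _).trans (le_max_right _ _))
  push_cast
  calc |(x : ℝ) * z - y ^ 2| ≤ |(x : ℝ) * z| + |(y : ℝ) ^ 2| := abs_sub _ _
    _ = |(x : ℝ)| * |(z : ℝ)| + |(y : ℝ)| ^ 2 := by rw [abs_mul, abs_pow]
    _ ≤ height3 (x, y, z) * height3 (x, y, z) + height3 (x, y, z) ^ 2 := by gcongr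
    _ = 2 * height3 (x, y, z) ^ 2 := by ring

-- For fixed Q with det Q ≠ 0, the number of divisors of det Q is O(height^{1/2}). This loses 1/2 in
-- the exponent, and -4 + 1/2 = -7/2 is still below -3.
open Classical in
lemma summable_pairs_divisor : Summable fun P : (ℤ × ℤ × ℤ) × ℤ =>
    if P.1.1 * P.1.2.2 - P.1.2.1 ^ 2 ≠ 0 ∧ P.2 ∣ P.1.1 * P.1.2.2 - P.1.2.1 ^ 2 then
      height3 P.1 ^ (-4 : ℝ) else 0 := by
  have hpos : ∀ Q : ℤ × ℤ × ℤ, 0 ≤ height3 Q ^ (-4 : ℝ) := fun Q =>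
    Real.rpow_nonneg (zero_le_one.trans (one_le_height3 _)) _
  have key : ∀ Q : ℤ × ℤ × ℤ, ∃ D : Finset ℤ,
      (D.card : ℝ) ≤ 4 * (8 ^ 4) ^ 16 * height3 Q ^ (1 / 2 : ℝ) ∧
      ∀ a ∉ D, (if Q.1 * Q.2.2 - Q.2.1 ^ 2 ≠ 0 ∧ a ∣ Q.1 * Q.2.2 - Q.2.1 ^ 2 then
        height3 Q ^ (-4 : ℝ) else 0) = 0 := by
    intro Q
    by_cases h0 : Q.1 * Q.2.2 - Q.2.1 ^ 2 = 0
    · refine ⟨∅, ?_, fun a _ => by simp [h0]⟩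
      have := one_le_height3 Q
      simp only [Finset.card_empty, Nat.cast_zero]
      positivity
    · set n := (Q.1 * Q.2.2 - Q.2.1 ^ 2).natAbs with hn
      refine ⟨n.divisors.image (fun m : ℕ => (m : ℤ)) ∪ n.divisors.image (fun m : ℕ => -(m : ℤ)),
        ?_, fun a ha => if_neg ?_⟩
      · have hb := card_divisors_le_of_bound (n := n) (Int.natAbs_ne_zero.2 h0) (one_le_height3 Q) (by
          rw [hn, Nat.cast_natAbs, Int.cast_abs]
          exact abs_det_le Q)
        have hc : (n.divisors.image (fun m : ℕ => (m : ℤ)) ∪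
            n.divisors.image (fun m : ℕ => -(m : ℤ))).card ≤ n.divisors.card + n.divisors.card :=
          (Finset.card_union_le _ _).trans (add_le_add Finset.card_image_le Finset.card_image_le)
        have hc' : ((n.divisors.image (fun m : ℕ => (m : ℤ)) ∪
            n.divisors.image (fun m : ℕ => -(m : ℤ))).card : ℝ) ≤
            n.divisors.card + n.divisors.card := by exact_mod_cast hc
        linarith
      · rintro ⟨-, had⟩
        apply ha
        have hm : a.natAbs ∈ n.divisors :=
          Nat.mem_divisors.2 ⟨Int.natAbs_dvd_natAbs.2 had, Int.natAbs_ne_zero.2 h0⟩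
        rw [Finset.mem_union, Finset.mem_image, Finset.mem_image]
        rcases Int.natAbs_eq a with h | h
        · exact Or.inl ⟨_, hm, h.symm⟩
        · exact Or.inr ⟨_, hm, h.symm⟩
  rw [summable_prod_of_nonneg (fun P => by
    simp only [Pi.zero_apply]
    split_ifs
    · exact hpos _
    · exact le_rfl)]
  constructor
  · intro Q
    obtain ⟨D, -, hD⟩ := key Q
    exact summable_of_ne_finset_zero hD
  · refine Summable.of_nonneg_of_le (f := fun Q => 4 * (8 ^ 4) ^ 16 * height3 Q ^ (-7 / 2 : ℝ))
      (fun Q => tsum_nonneg fun a => ?_) (fun Q => ?_)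
      ((summable_height3_rpow (by norm_num)).mul_left _)
    · split_ifs
      · exact hpos _
      · exact le_rfl
    · obtain ⟨D, hD, hD'⟩ := key Q
      have hQ : 0 < height3 Q := zero_lt_one.trans_le (one_le_height3 Q)
      simp only
      rw [tsum_eq_sum hD']
      calc _ ≤ ∑ a ∈ D, height3 Q ^ (-4 : ℝ) := Finset.sum_le_sum fun a _ => by
            split_ifs
            · exact le_rfl
            · exact hpos _
        _ = D.card * height3 Q ^ (-4 : ℝ) := by rw [Finset.sum_const, nsmul_eq_mul]
        _ ≤ 4 * (8 ^ 4) ^ 16 * height3 Q ^ (1 / 2 : ℝ) * height3 Q ^ (-4 : ℝ) :=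
            mul_le_mul_of_nonneg_right hD (hpos Q)
        _ = 4 * (8 ^ 4) ^ 16 * height3 Q ^ (-7 / 2 : ℝ) := by
            rw [mul_assoc, ← Real.rpow_add hQ]; norm_num

/-- When a d ≠ 0 the point is determined by Q and a, where a divides det Q. -/
lemma summable_nondegenerate : Summable (Set.indicator {v : Plucker | v.IsCone ∧ v.a * v.d ≠ 0}
    fun v => v.height ^ (-4 : ℝ)) := by
  rw [← summable_subtype_iff_indicator]
  set f : {v : Plucker | v.IsCone ∧ v.a * v.d ≠ 0} → (ℤ × ℤ × ℤ) × ℤ :=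
    fun v => ((v.1.x, v.1.y, v.1.z), v.1.a) with hf
  have hinj : Function.Injective f := by
    rintro ⟨v, hv, hv0⟩ ⟨w, hw, hw0⟩ h
    simp only [hf, Prod.mk.injEq] at h
    obtain ⟨⟨hx, hy, hz⟩, ha⟩ := h
    refine Subtype.ext (Plucker.ext ha hx hy hz ?_)
    have ha0 : v.a ≠ 0 := left_ne_zero_of_mul hv0
    apply mul_left_cancel₀ ha0
    rw [← hv, ha, ← hw, hx, hy, hz]
  refine Summable.of_nonneg_of_le
    (fun v => Real.rpow_nonneg (zero_le_one.trans v.1.one_le_height) _) (fun v => ?_)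
    (summable_pairs_divisor.comp_injective hinj)
  obtain ⟨v, hv, hv0⟩ := v
  have : v.x * v.z - v.y ^ 2 ≠ 0 ∧ v.a ∣ v.x * v.z - v.y ^ 2 := by
    rw [hv]; exact ⟨hv0, dvd_mul_right _ _⟩
  simp only [Function.comp_apply, hf]
  rw [if_pos this]
  exact Real.rpow_le_rpow_of_nonpos (zero_lt_one.trans_le (one_le_height3 _)) (le_max_right _ _)
    (by norm_num)

/-- Summability over the integral points of the cone. -/
lemma summable_height_cone : Summable (Set.indicator {v : Plucker | v.IsCone}
    fun v => v.height ^ (-4 : ℝ)) := by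
  have hA : ∀ v : Plucker, Siegel.height v.a ≤ v.height := fun v =>
    (le_max_left _ _).trans (le_max_left _ _)
  have hD : ∀ v : Plucker, Siegel.height v.d ≤ v.height := fun v =>
    (le_max_right _ _).trans (le_max_left _ _)
  have hX : ∀ v : Plucker, Siegel.height v.x ≤ v.height := fun v =>
    (le_max_left _ _).trans (le_max_right _ _)
  have hY : ∀ v : Plucker, Siegel.height v.y ≤ v.height := fun v =>
    ((le_max_left _ _).trans (le_max_right _ _)).trans (le_max_right _ _)
  have hZ : ∀ v : Plucker, Siegel.height v.z ≤ v.height := fun v =>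
    ((le_max_right _ _).trans (le_max_right _ _)).trans (le_max_right _ _)
  -- The remaining points have a = 0 or d = 0, so xz = y². If x ≠ 0, then x and y determine z; if x
  -- = 0, then y = 0. In each case three coordinates suffice, and overlaps between strata are
  -- harmless for an upper bound.
  have s1 : Summable (Set.indicator {v : Plucker | v.IsCone ∧ v.a = 0 ∧ v.x ≠ 0}
      fun v => v.height ^ (-4 : ℝ)) := by
    refine summable_indicator_of_injOn (f := fun v => (v.x, v.y, v.d)) ?_
      fun v _ => max_le (hX v) (max_le (hY v) (hD v))
    rintro ⟨a, x, y, z, d⟩ ⟨hc, ha, hx⟩ ⟨a', x', y', z', d'⟩ ⟨hc', ha', hx'⟩ h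
    simp only [IsCone, Prod.mk.injEq] at *
    obtain ⟨rfl, rfl, rfl⟩ := h
    subst ha ha'
    refine Plucker.ext rfl rfl rfl (mul_left_cancel₀ hx (?_ : x * z = x * z')) rfl
    linarith
  have s2 : Summable (Set.indicator {v : Plucker | v.IsCone ∧ v.a = 0 ∧ v.x = 0}
      fun v => v.height ^ (-4 : ℝ)) := by
    refine summable_indicator_of_injOn (f := fun v => (v.y, v.z, v.d)) ?_
      fun v _ => max_le (hY v) (max_le (hZ v) (hD v))
    rintro ⟨a, x, y, z, d⟩ ⟨hc, ha, hx⟩ ⟨a', x', y', z', d'⟩ ⟨hc', ha', hx'⟩ h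
    simp only [Prod.mk.injEq] at *
    obtain ⟨rfl, rfl, rfl⟩ := h
    subst ha ha' hx hx'
    rfl
  have s3 : Summable (Set.indicator {v : Plucker | v.IsCone ∧ v.d = 0 ∧ v.x ≠ 0}
      fun v => v.height ^ (-4 : ℝ)) := by
    refine summable_indicator_of_injOn (f := fun v => (v.x, v.y, v.a)) ?_
      fun v _ => max_le (hX v) (max_le (hY v) (hA v))
    rintro ⟨a, x, y, z, d⟩ ⟨hc, ha, hx⟩ ⟨a', x', y', z', d'⟩ ⟨hc', ha', hx'⟩ h
    simp only [IsCone, Prod.mk.injEq] at *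
    obtain ⟨rfl, rfl, rfl⟩ := h
    subst ha ha'
    refine Plucker.ext rfl rfl rfl (mul_left_cancel₀ hx (?_ : x * z = x * z')) rfl
    linarith
  have s4 : Summable (Set.indicator {v : Plucker | v.IsCone ∧ v.d = 0 ∧ v.x = 0}
      fun v => v.height ^ (-4 : ℝ)) := by
    refine summable_indicator_of_injOn (f := fun v => (v.y, v.z, v.a)) ?_
      fun v _ => max_le (hY v) (max_le (hZ v) (hA v))
    rintro ⟨a, x, y, z, d⟩ ⟨hc, ha, hx⟩ ⟨a', x', y', z', d'⟩ ⟨hc', ha', hx'⟩ h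
    simp only [Prod.mk.injEq] at *
    obtain ⟨rfl, rfl, rfl⟩ := h
    subst ha ha' hx hx'
    rfl
  have hnn : ∀ (S : Set Plucker) (v : Plucker),
      0 ≤ S.indicator (fun v => v.height ^ (-4 : ℝ)) v := fun S v =>
    Set.indicator_nonneg (fun v _ => Real.rpow_nonneg (zero_le_one.trans v.one_le_height) _) v
  refine Summable.of_nonneg_of_le (hnn _) (fun v => ?_)
    ((((summable_nondegenerate.add s1).add s2).add s3).add s4)
  by_cases hv : v.IsCone
  · have n0 := hnn {v : Plucker | v.IsCone ∧ v.a * v.d ≠ 0} v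
    have n1 := hnn {v : Plucker | v.IsCone ∧ v.a = 0 ∧ v.x ≠ 0} v
    have n2 := hnn {v : Plucker | v.IsCone ∧ v.a = 0 ∧ v.x = 0} v
    have n3 := hnn {v : Plucker | v.IsCone ∧ v.d = 0 ∧ v.x ≠ 0} v
    have n4 := hnn {v : Plucker | v.IsCone ∧ v.d = 0 ∧ v.x = 0} v
    rw [Set.indicator_of_mem (show v ∈ {v : Plucker | v.IsCone} from hv)]
    by_cases ha : v.a = 0
    · by_cases hx : v.x = 0
      · rw [Set.indicator_of_mem (s := {v : Plucker | v.IsCone ∧ v.a = 0 ∧ v.x = 0}) ⟨hv, ha, hx⟩]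
        linarith
      · rw [Set.indicator_of_mem (s := {v : Plucker | v.IsCone ∧ v.a = 0 ∧ v.x ≠ 0}) ⟨hv, ha, hx⟩]
        linarith
    · by_cases hd : v.d = 0
      · by_cases hx : v.x = 0
        · rw [Set.indicator_of_mem (s := {v : Plucker | v.IsCone ∧ v.d = 0 ∧ v.x = 0}) ⟨hv, hd, hx⟩]
          linarith
        · rw [Set.indicator_of_mem (s := {v : Plucker | v.IsCone ∧ v.d = 0 ∧ v.x ≠ 0}) ⟨hv, hd, hx⟩]
          linarith
      · rw [Set.indicator_of_mem (s := {v : Plucker | v.IsCone ∧ v.a * v.d ≠ 0})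
          ⟨hv, mul_ne_zero ha hd⟩]
        linarith
  · rw [Set.indicator_of_notMem (show v ∉ {v : Plucker | v.IsCone} from hv)]
    exact add_nonneg (add_nonneg (add_nonneg (add_nonneg (hnn _ v) (hnn _ v)) (hnn _ v))
      (hnn _ v)) (hnn _ v)

/-! ### Lower bound for the linear form, and absolute convergence. -/

/-- The function `a det τ + tr(Qτ) + d` for real coordinates `(a, x, y, z, d)`. -/
noncomputable def realLin (w : Fin 5 → ℝ) (τ : M2 ℂ) : ℂ :=
  w 0 * τ.det + w 1 * τ 0 0 + w 2 * (τ 0 1 + τ 1 0) + w 3 * τ 1 1 + w 4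

/-- Write τ = X + iY and B = Q + a adj X. Vanishing of the imaginary part says tr(BY) = 0; vanishing
of the real part and the cone equation give det B = a² det Y ≥ 0. With Y positive definite this is
possible only for B = 0 and a = 0, whence w = 0. -/
lemma realLin_ne_zero {τ : M2 ℂ} (hτ : τ ∈ upperHalfSpace) {w : Fin 5 → ℝ} (hw : w ≠ 0)
    (hc : w 1 * w 3 - w 2 ^ 2 = w 0 * w 4) : realLin w τ ≠ 0 := by
  intro h
  apply hw
  have hs : τ 1 0 = τ 0 1 := by
    have := congrFun (congrFun hτ.1 0) 1
    simpa using this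
  have hy1 : 0 < (τ 0 0).im := by
    have := hτ.2.diag_pos (i := 0)
    simpa using this
  have hΔ : 0 < (τ 0 0).im * (τ 1 1).im - (τ 0 1).im ^ 2 := by
    have := hτ.2.det_pos
    rw [det_fin_two] at this
    simp only [map_apply, hs] at this
    linarith [sq (τ 0 1).im]
  have hre := congrArg Complex.re h
  have him := congrArg Complex.im h
  rw [realLin, det_fin_two, hs] at hre him
  simp only [Complex.add_re, Complex.add_im, Complex.mul_re, Complex.mul_im, Complex.sub_re,
    Complex.sub_im, Complex.ofReal_re, Complex.ofReal_im, Complex.zero_re, Complex.zero_im,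
    zero_mul, sub_zero, add_zero] at hre him
  generalize (τ 0 0).re = x1 at *
  generalize (τ 0 1).re = x2 at *
  generalize (τ 1 1).re = x3 at *
  generalize (τ 0 0).im = y1 at *
  generalize (τ 0 1).im = y2 at *
  generalize (τ 1 1).im = y3 at *
  set Δ := y1 * y3 - y2 ^ 2 with hΔd
  set a := w 0
  set B1 := w 1 + a * x3 with hB1
  set B2 := w 2 - a * x2 with hB2
  set B3 := w 3 + a * x1 with hB3
  have e1 : B1 * B3 - B2 ^ 2 = a ^ 2 * Δ := by
    rw [hB1, hB2, hB3, hΔd]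
    linear_combination hc + a * hre
  have e2 : B1 * y1 + 2 * B2 * y2 + B3 * y3 = 0 := by
    rw [hB1, hB2, hB3]
    linear_combination him
  -- The three squares add up to y1² tr((BY)²) = y1² (tr(BY)² - 2 det B det Y), so all terms of this
  -- vanishing sum are nonnegative.
  have e3 : (B1 * y1 ^ 2 + 2 * B2 * y1 * y2 + B3 * y2 ^ 2) ^ 2 + 2 * Δ * (B2 * y1 + B3 * y2) ^ 2 +
      Δ ^ 2 * B3 ^ 2 + 2 * y1 ^ 2 * a ^ 2 * Δ ^ 2 = 0 := by
    have : (B1 * y1 ^ 2 + 2 * B2 * y1 * y2 + B3 * y2 ^ 2) ^ 2 + 2 * Δ * (B2 * y1 + B3 * y2) ^ 2 +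
      Δ ^ 2 * B3 ^ 2 = y1 ^ 2 * ((B1 * y1 + 2 * B2 * y2 + B3 * y3) ^ 2
        - 2 * (B1 * B3 - B2 ^ 2) * Δ) := by
      rw [hΔd]; ring
    rw [this, e1, e2]; ring
  have p1 := sq_nonneg (B1 * y1 ^ 2 + 2 * B2 * y1 * y2 + B3 * y2 ^ 2)
  have p2 : 0 ≤ 2 * Δ * (B2 * y1 + B3 * y2) ^ 2 := by positivity
  have p3 : 0 ≤ Δ ^ 2 * B3 ^ 2 := by positivity
  have p4 : 0 ≤ 2 * y1 ^ 2 * a ^ 2 * Δ ^ 2 := by positivity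
  have ha : a = 0 := by
    have : 2 * y1 ^ 2 * a ^ 2 * Δ ^ 2 = 0 := by linarith
    simpa [hy1.ne', hΔ.ne'] using this
  have h3 : B3 = 0 := by
    have : Δ ^ 2 * B3 ^ 2 = 0 := by linarith
    simpa [hΔ.ne'] using this
  have h2 : B2 = 0 := by
    have : 2 * Δ * (B2 * y1 + B3 * y2) ^ 2 = 0 := by linarith
    simpa [hΔ.ne', h3, hy1.ne'] using this
  have h1 : B1 = 0 := by
    rw [h2, h3] at e2
    simpa [hy1.ne'] using e2
  rw [ha] at hB1 hB2 hB3 hre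
  have w1 : w 1 = 0 := by linarith
  have w2 : w 2 = 0 := by linarith
  have w3 : w 3 = 0 := by linarith
  have w4 : w 4 = 0 := by rw [w1, w2, w3] at hre; linarith
  ext i
  fin_cases i
  · exact ha
  · exact w1
  · exact w2
  · exact w3
  · exact w4

/-- On the cone, `realLin` is bounded below by a multiple of the norm. -/
lemma exists_mul_norm_le_realLin {τ : M2 ℂ} (hτ : τ ∈ upperHalfSpace) :
    ∃ c : ℝ, 0 < c ∧ ∀ w : Fin 5 → ℝ, w 1 * w 3 - w 2 ^ 2 = w 0 * w 4 →
      c * ‖w‖ ≤ ‖realLin w τ‖ := by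
  -- The cone meets the unit sphere in a compact set on which the form does not vanish; homogeneity
  -- extends the minimum to all of the cone.
  have hK : IsCompact (Metric.sphere (0 : Fin 5 → ℝ) 1 ∩
      {w | w 1 * w 3 - w 2 ^ 2 = w 0 * w 4}) :=
    (isCompact_sphere _ _).inter_right (isClosed_eq (by fun_prop) (by fun_prop))
  have hcont : Continuous fun w : Fin 5 → ℝ => ‖realLin w τ‖ := by
    unfold realLin
    fun_prop
  obtain ⟨c, hc, hcK⟩ := hK.exists_forall_le' hcont.continuousOn (a := 0) fun w hw =>
    norm_pos_iff.2 (realLin_ne_zero hτ (ne_zero_of_mem_unit_sphere ⟨w, hw.1⟩) hw.2)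
  refine ⟨c, hc, fun w hw => ?_⟩
  by_cases h0 : w = 0
  · simp [h0]
  have hn : 0 < ‖w‖ := norm_pos_iff.2 h0
  have h1 := hcK (‖w‖⁻¹ • w) ⟨by simp [norm_smul, hn.ne'], by
    simp only [Set.mem_ofPred_eq, Pi.smul_apply, smul_eq_mul]
    linear_combination ‖w‖⁻¹ ^ 2 * hw⟩
  have h2 : realLin (‖w‖⁻¹ • w) τ = (‖w‖⁻¹ : ℝ) * realLin w τ := by
    simp only [realLin, Pi.smul_apply, smul_eq_mul]
    push_cast
    ring
  rw [h2, norm_mul, Complex.norm_real, Real.norm_of_nonneg (inv_nonneg.2 hn.le),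
    ← div_eq_inv_mul, le_div_iff₀ hn] at h1
  exact h1

/-- The coordinates as a real vector. -/
def Plucker.toReal (v : Plucker) : Fin 5 → ℝ := ![v.a, v.x, v.y, v.z, v.d]

lemma Plucker.realLin_toReal (v : Plucker) (τ : M2 ℂ) : realLin v.toReal τ = v.lin τ := by
  simp [realLin, toReal, lin]

lemma Plucker.IsCone.toReal {v : Plucker} (hv : v.IsCone) :
    v.toReal 1 * v.toReal 3 - v.toReal 2 ^ 2 = v.toReal 0 * v.toReal 4 := by
  have h : (v.x * v.z - v.y ^ 2 : ℝ) = v.a * v.d := by exact_mod_cast hv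
  simpa [Plucker.toReal] using h

lemma Plucker.toReal_ne_zero {v : Plucker} (hv : v.IsPrimitive) : v.toReal ≠ 0 := by
  intro h
  have h0 := congrFun h 0
  have h1 := congrFun h 1
  have h2 := congrFun h 2
  have h3 := congrFun h 3
  have h4 := congrFun h 4
  simp [Plucker.toReal] at h0 h1 h2 h3 h4
  refine hv 2 Nat.prime_two ?_
  simp [DvdAll, h0, h1, h2, h3, h4]

lemma Plucker.lin_ne_zero {τ : M2 ℂ} (hτ : τ ∈ upperHalfSpace) {v : Plucker} (hv : v.IsCone)
    (hp : v.IsPrimitive) : v.lin τ ≠ 0 := by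
  rw [← realLin_toReal]
  exact realLin_ne_zero hτ (toReal_ne_zero hp) hv.toReal

/-- A primitive point is a nonzero integral vector, so its sup norm is at least 1 and the maxima
with 1 in the heights are harmless. -/
lemma Plucker.height_le_norm {v : Plucker} (hv : v.IsPrimitive) : v.height ≤ ‖v.toReal‖ := by
  have hb : ∀ i, |v.toReal i| ≤ ‖v.toReal‖ := fun i => norm_le_pi_norm v.toReal i
  have h1 : 1 ≤ ‖v.toReal‖ := by
    by_contra hlt
    push Not at hlt
    have key : ∀ n : ℤ, |(n : ℝ)| ≤ ‖v.toReal‖ → n = 0 := fun n hn => by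
      have : |(n : ℝ)| < 1 := hn.trans_lt hlt
      rw [← Int.cast_abs] at this
      have : |n| < 1 := by exact_mod_cast this
      exact Int.abs_lt_one_iff.1 this
    refine toReal_ne_zero hv ?_
    ext i
    fin_cases i
    · simpa [toReal] using key v.a (hb 0)
    · simpa [toReal] using key v.x (hb 1)
    · simpa [toReal] using key v.y (hb 2)
    · simpa [toReal] using key v.z (hb 3)
    · simpa [toReal] using key v.d (hb 4)
  exact max_le (max_le (max_le h1 (hb 0)) (max_le h1 (hb 4)))
    (max_le (max_le h1 (hb 1)) (max_le (max_le h1 (hb 2)) (max_le h1 (hb 3))))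

/-- Absolute convergence of the Eisenstein series. -/
lemma summable_mul_lin {τ : M2 ℂ} (hτ : τ ∈ upperHalfSpace) {k : ℕ} (hk : 4 ≤ k) {f : Plucker → ℂ}
    (hf : ∀ v, ‖f v‖ ≤ 1) (hsupp : ∀ v, f v ≠ 0 → v.IsCone ∧ v.IsPrimitive) :
    Summable fun v : Plucker => f v * v.lin τ ^ (-(k : ℤ)) := by
  obtain ⟨c, hc, hle⟩ := exists_mul_norm_le_realLin hτ
  refine Summable.of_norm_bounded (summable_height_cone.mul_left ((c ^ k)⁻¹)) fun v => ?_
  by_cases h0 : f v = 0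
  · rw [h0, zero_mul, norm_zero]
    refine mul_nonneg (by positivity) (Set.indicator_nonneg (fun v _ =>
      Real.rpow_nonneg (zero_le_one.trans v.one_le_height) _) v)
  · obtain ⟨hv, hp⟩ := hsupp v h0
    have hh := v.one_le_height
    rw [Set.indicator_of_mem (show v ∈ {v : Plucker | v.IsCone} from hv), norm_mul]
    have h1 : c * v.height ≤ ‖v.lin τ‖ := by
      rw [← realLin_toReal]
      exact (mul_le_mul_of_nonneg_left (height_le_norm hp) hc.le).trans (hle _ hv.toReal)
    have hpos : 0 < c * v.height := by positivity
    calc ‖f v‖ * ‖v.lin τ ^ (-(k : ℤ))‖ ≤ 1 * ‖v.lin τ ^ (-(k : ℤ))‖ := by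
          gcongr; exact hf v
      _ = (‖v.lin τ‖ ^ k)⁻¹ := by rw [one_mul, _root_.zpow_neg, zpow_natCast, norm_inv, norm_pow]
      _ ≤ ((c * v.height) ^ k)⁻¹ := by gcongr
      _ = (c ^ k)⁻¹ * (v.height ^ k)⁻¹ := by rw [mul_pow, mul_inv]
      _ ≤ (c ^ k)⁻¹ * (v.height ^ 4)⁻¹ := by gcongr
      _ = (c ^ k)⁻¹ * v.height ^ (-4 : ℝ) := by
          rw [Real.rpow_neg (by positivity)]
          norm_cast

/-! ### Coset representatives for the Hecke operator. -/

lemma slash_heckeDelta_inv (k : ℕ) (f : M2 ℂ → ℂ) {q : ℕ} (hq : q ≠ 0) (γ : Sp) (τ : M2 ℂ) :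
    slash k f ((heckeDelta q ℝ)⁻¹ *
        (γ : Matrix (Fin 2 ⊕ Fin 2) (Fin 2 ⊕ Fin 2) ℤ).map (Int.cast : ℤ → ℝ)) τ =
      (q : ℂ) ^ (-(k : ℤ)) * ((blockC γ).map (Int.cast : ℤ → ℂ) * τ +
        (blockD γ).map (Int.cast : ℤ → ℂ)).det ^ (-(k : ℤ)) *
      f ((q : ℂ)⁻¹ • (((blockA γ).map (Int.cast : ℤ → ℂ) * τ + (blockB γ).map (Int.cast : ℤ → ℂ)) *
        ((blockC γ).map (Int.cast : ℤ → ℂ) * τ + (blockD γ).map (Int.cast : ℤ → ℂ))⁻¹)) := by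
  have hq' : (q : ℝ) ≠ 0 := by exact_mod_cast hq
  have hinv : (heckeDelta q ℝ)⁻¹ = fromBlocks ((q : ℝ)⁻¹ • (1 : M2 ℝ)) 0 0 1 := by
    apply Matrix.inv_eq_left_inv
    rw [heckeDelta, fromBlocks_multiply]
    simp [smul_smul, hq', ← fromBlocks_one]
  have hprod : (heckeDelta q ℝ)⁻¹ *
      (γ : Matrix (Fin 2 ⊕ Fin 2) (Fin 2 ⊕ Fin 2) ℤ).map (Int.cast : ℤ → ℝ) =
      fromBlocks ((q : ℝ)⁻¹ • (blockA γ).map (Int.cast : ℤ → ℝ))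
        ((q : ℝ)⁻¹ • (blockB γ).map (Int.cast : ℤ → ℝ))
        ((blockC γ).map (Int.cast : ℤ → ℝ)) ((blockD γ).map (Int.cast : ℤ → ℝ)) := by
    rw [hinv, coe_eq_fromBlocks, fromBlocks_map, fromBlocks_multiply]
    simp
  have hdet : ((heckeDelta q ℝ)⁻¹ *
      (γ : Matrix (Fin 2 ⊕ Fin 2) (Fin 2 ⊕ Fin 2) ℤ).map (Int.cast : ℤ → ℝ)).det =
        ((q : ℝ)⁻¹) ^ 2 := by
    rw [det_mul, hinv, det_fromBlocks_zero₂₁]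
    have h1 : ((γ : Matrix (Fin 2 ⊕ Fin 2) (Fin 2 ⊕ Fin 2) ℤ).map (Int.cast : ℤ → ℝ)).det = 1 := by
      have := (Int.castRingHom ℝ).map_det (γ : Matrix (Fin 2 ⊕ Fin 2) (Fin 2 ⊕ Fin 2) ℤ)
      rw [SymplecticGroup.det_eq_one γ.2, map_one] at this
      exact this.symm
    rw [h1]
    simp
  have hpow : (((q : ℝ)⁻¹) ^ 2) ^ ((k : ℝ) / 2) = ((q : ℝ) ^ k)⁻¹ := by
    rw [← Real.rpow_natCast, ← Real.rpow_mul (by positivity)]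
    rw [show ((2 : ℕ) : ℝ) * ((k : ℝ) / 2) = k by push_cast; ring, Real.rpow_natCast, inv_pow]
  have hm (M : M2 ℤ) : (M.map (Int.cast : ℤ → ℝ)).map Complex.ofReal =
      M.map (Int.cast : ℤ → ℂ) := by
    ext i j; simp
  have hms (M : M2 ℤ) : ((q : ℝ)⁻¹ • M.map (Int.cast : ℤ → ℝ)).map Complex.ofReal =
      (q : ℂ)⁻¹ • M.map (Int.cast : ℤ → ℂ) := by
    ext i j; simp
  rw [slash, hdet, hpow, hprod]
  simp only [toBlocks_fromBlocks₁₁, toBlocks_fromBlocks₁₂, toBlocks_fromBlocks₂₁,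
    toBlocks_fromBlocks₂₂, hm, hms, smul_mul, ← smul_add]
  congr 2
  rw [_root_.zpow_neg, zpow_natCast]
  push_cast
  rfl

lemma translation_mem (N : ℕ) (s t u : ℤ) : translation s t u ∈ Gamma0 N := by
  intro i j
  simp [translation]

/-- The translation `(1 S; 0 1)` as an element of `Γ₀(N)`. -/
def gamma0Translation (N : ℕ) (s t u : ℤ) : Gamma0 N := ⟨translation s t u, translation_mem N s t u⟩

lemma heckeDelta_mul_iff {q : ℕ} {γ γ' : Sp} :
    (γ : Matrix (Fin 2 ⊕ Fin 2) (Fin 2 ⊕ Fin 2) ℤ) * heckeDelta q ℤ =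
      heckeDelta q ℤ * (γ' : Matrix (Fin 2 ⊕ Fin 2) (Fin 2 ⊕ Fin 2) ℤ) ↔
      (q : ℤ) • blockA γ = (q : ℤ) • blockA γ' ∧ blockB γ = (q : ℤ) • blockB γ' ∧
        (q : ℤ) • blockC γ = blockC γ' ∧ blockD γ = blockD γ' := by
  rw [coe_eq_fromBlocks γ, coe_eq_fromBlocks γ', heckeDelta, fromBlocks_multiply,
    fromBlocks_multiply, fromBlocks_inj]
  simp only [Matrix.mul_smul, Matrix.smul_mul, Matrix.mul_one, Matrix.one_mul, Matrix.mul_zero,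
    Matrix.zero_mul, add_zero, zero_add]

/-- Conjugation by δ replaces B by B/q and C by qC, so integrality of B/q is the only condition. -/
lemma mem_heckeSubgroup_iff {N q : ℕ} (hq : q ≠ 0) {γ : Gamma0 N} :
    γ ∈ heckeSubgroup N q ↔ ∀ i j, (q : ℤ) ∣ blockB (γ : Sp) i j := by
  have hq' : (q : ℤ) ≠ 0 := by exact_mod_cast hq
  constructor
  · rintro ⟨γ', h⟩ i j
    rw [(heckeDelta_mul_iff.1 h).2.1]
    exact ⟨_, rfl⟩
  · intro h
    set B' : M2 ℤ := Matrix.of fun i j => blockB (γ : Sp) i j / q with hB'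
    have hB : blockB (γ : Sp) = (q : ℤ) • B' := by
      ext i j
      rw [Matrix.smul_apply, hB', of_apply, smul_eq_mul, Int.mul_ediv_cancel' (h i j)]
    obtain ⟨r1, r2, r3⟩ := row_relations (γ : Sp)
    have hrel : blockA (γ : Sp) * B'ᵀ = B' * (blockA (γ : Sp))ᵀ ∧
        ((q : ℤ) • blockC (γ : Sp)) * (blockD (γ : Sp))ᵀ =
          blockD (γ : Sp) * ((q : ℤ) • blockC (γ : Sp))ᵀ ∧
        blockA (γ : Sp) * (blockD (γ : Sp))ᵀ - B' * ((q : ℤ) • blockC (γ : Sp))ᵀ = 1 := by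
      rw [hB] at r1 r3
      refine ⟨?_, ?_, ?_⟩
      · rw [transpose_smul, Matrix.mul_smul, Matrix.smul_mul] at r1
        exact smul_right_injective _ hq' r1
      · rw [Matrix.smul_mul, r2, transpose_smul, Matrix.mul_smul]
      · rw [transpose_smul, Matrix.mul_smul, ← Matrix.smul_mul]
        exact r3
    refine ⟨⟨ofBlocks _ _ _ _ hrel, ?_⟩, heckeDelta_mul_iff.2 ⟨?_, ?_, ?_, ?_⟩⟩
    · intro i j
      rw [blockC_ofBlocks, Matrix.smul_apply, smul_eq_mul]
      exact (γ.2 i j).mul_left _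
    · simp
    · simpa using hB
    · simp
    · simp

lemma translation_inv (s t u : ℤ) : (translation s t u)⁻¹ = translation (-s) (-t) (-u) := by
  rw [inv_eq_iff_mul_eq_one]
  have h1 : blockA (1 : Sp) = 1 ∧ blockB (1 : Sp) = 0 ∧ blockC (1 : Sp) = 0 ∧ blockD (1 : Sp) = 1 := by
    simp [blockA, blockB, blockC, blockD, ← fromBlocks_one]
  apply sp_ext
  · rw [blockA_translation_mul]; simp [h1, translation]
  · rw [blockB_mul, h1.2.1]
    ext i j
    fin_cases i <;> fin_cases j <;> simp [translation]
  · rw [blockC_translation_mul]; simp [h1, translation]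
  · rw [blockD_translation_mul]; simp [h1, translation]

lemma blockA_mul_translation (γ : Sp) (s t u : ℤ) : blockA (γ * translation s t u) = blockA γ := by
  rw [blockA_mul]; simp [translation]

lemma blockB_mul_translation (γ : Sp) (s t u : ℤ) :
    blockB (γ * translation s t u) = blockA γ * !![s, t; t, u] + blockB γ := by
  rw [blockB_mul]; simp [translation]

lemma blockC_mul_translation (γ : Sp) (s t u : ℤ) : blockC (γ * translation s t u) = blockC γ := by
  rw [blockC_mul_blocks]; simp [translation]

lemma blockD_mul_translation (γ : Sp) (s t u : ℤ) :
    blockD (γ * translation s t u) = blockC γ * !![s, t; t, u] + blockD γ := by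
  rw [blockD_mul]; simp [translation]

/-- The coset of a translation. -/
def translationCoset (N q : ℕ) (S : ZMod q × ZMod q × ZMod q) :
    Quotient (QuotientGroup.rightRel (heckeSubgroup N q)) :=
  Quotient.mk _ (gamma0Translation N S.1.val S.2.1.val S.2.2.val)

/-- As C ≡ 0 modulo q, A is invertible modulo q, and γ times the inverse of the translation by S has
upper right block B - AS. This vanishes modulo q for exactly one class of S. -/
lemma translationCoset_bijective {N q : ℕ} [NeZero q] (hqN : q ∣ N) :
    Function.Bijective (translationCoset N q) := by
  have hq := NeZero.ne q
  constructor
  · rintro ⟨s, t, u⟩ ⟨s', t', u'⟩ h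
    have h := Quotient.exact h
    rw [← Quotient.eq_iff_equiv, Quotient.eq, QuotientGroup.rightRel_apply,
      mem_heckeSubgroup_iff hq] at h
    simp only [gamma0Translation, Subgroup.coe_mul, Subgroup.coe_inv, translation_inv,
      blockB_mul_translation] at h
    have key : ∀ a b : ZMod q, (q : ℤ) ∣ -(a.val : ℤ) + b.val → a = b := fun a b hab => by
      have := intCast_eq_zero_of_dvd hab
      push_cast at this
      simp only [ZMod.natCast_val, ZMod.cast_id', id_eq] at this
      linear_combination -this
    have h00 := h 0 0
    have h01 := h 0 1
    have h11 := h 1 1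
    simp [translation, -ZMod.natCast_val] at h00 h01 h11
    rw [key _ _ h00, key _ _ h01, key _ _ h11]
  · intro c
    induction c using Quotient.inductionOn with
    | h γ =>
    -- Modulo q one has A Dᵀ = 1, so Dᵀ B represents A⁻¹ B; it is symmetric by the column relations.
    set T := (blockD (γ : Sp))ᵀ * blockB (γ : Sp) with hT
    refine ⟨((T 0 0 : ℤ), (T 0 1 : ℤ), (T 1 1 : ℤ)), Quotient.sound ?_⟩
    rw [← Quotient.eq_iff_equiv, Quotient.eq, QuotientGroup.rightRel_apply,
      mem_heckeSubgroup_iff hq]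
    intro i j
    simp only [gamma0Translation, Subgroup.coe_mul, Subgroup.coe_inv, translation_inv,
      blockB_mul_translation]
    apply dvd_of_intCast_eq_zero
    have hC : ∀ i j, ((blockC (γ : Sp) i j : ℤ) : ZMod q) = 0 := fun i j =>
      intCast_eq_zero_of_dvd ((Int.natCast_dvd_natCast.2 hqN).trans (γ.2 i j))
    have hsym : T 1 0 = T 0 1 := by
      have := congrFun (congrFun (column_relations (γ : Sp)).2.1 0) 1
      rw [hT, ← this]
      simp [mul_apply, Fin.sum_univ_two]
      ring
    have hAD := (row_relations (γ : Sp)).2.2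
    have hAT : blockA (γ : Sp) * T = blockB (γ : Sp) +
        blockB (γ : Sp) * (blockC (γ : Sp))ᵀ * blockB (γ : Sp) := by
      rw [hT, ← Matrix.mul_assoc, eq_add_of_sub_eq hAD, Matrix.add_mul, Matrix.one_mul]
    have hAT' := congrArg (Int.cast : ℤ → ZMod q) (congrFun (congrFun hAT i) j)
    simp only [Matrix.add_apply, mul_apply, Fin.sum_univ_two, transpose_apply] at hAT' ⊢
    push_cast at hAT' ⊢
    simp only [hC, mul_zero, zero_mul, add_zero] at hAT'
    rw [← hAT']
    fin_cases j
    · simp [hsym]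
      ring
    · simp
      ring

section
variable {N k : ℕ} {χ : DirichletCharacter ℂ N} {rk : ℕ → Fin 3} {d : Fin 2 → ℤ}

lemma det_add_ne_zero {τ : M2 ℂ} (hτ : τ ∈ upperHalfSpace) (γ : Sp) :
    ((blockC γ).map (Int.cast : ℤ → ℂ) * τ + (blockD γ).map (Int.cast : ℤ → ℂ)).det ≠ 0 := by
  rw [(symmPair_blocks γ).det_eq_lin]
  exact lin_ne_zero hτ (isCone_plucker γ) (isPrimitive_plucker γ)

/-- The summand of the Hecke operator in the coset of a translation. -/
lemma CuspData.hecke_summand (h : CuspData N χ rk d) {q : ℕ} (hq : q ≠ 0) {τ : M2 ℂ}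
    (hτ : τ ∈ upperHalfSpace) {s t u : ℤ} {γ : Gamma0 N}
    (hγ : γ * (gamma0Translation N s t u)⁻¹ ∈ heckeSubgroup N q) :
    (starRingEnd ℂ) (χ (((blockD (γ : Sp)).det : ℤ) : ZMod N)) *
      slash k (eisenstein N k χ (cuspElt d)) ((heckeDelta q ℝ)⁻¹ *
        ((γ : Sp) : Matrix (Fin 2 ⊕ Fin 2) (Fin 2 ⊕ Fin 2) ℤ).map (Int.cast : ℤ → ℝ)) τ =
    (q : ℂ) ^ (-(k : ℤ)) * eisenstein N k χ (cuspElt d)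
      ((q : ℂ)⁻¹ • (τ + (!![s, t; t, u] : M2 ℤ).map (Int.cast : ℤ → ℂ))) := by
  have hq' : (q : ℂ) ≠ 0 := by exact_mod_cast hq
  set S : M2 ℤ := !![s, t; t, u] with hS
  -- With η = δ η' δ⁻¹ one has δ⁻¹ γ = η' δ⁻¹ (1 S; 0 1). The transformation law for η' therefore
  -- removes the dependence on γ, including the character value by `hdet`.
  obtain ⟨η', hη'⟩ := hγ
  set η : Sp := ((γ * (gamma0Translation N s t u)⁻¹ : Gamma0 N) : Sp) with hη
  have hηγ : (γ : Sp) = η * translation s t u := by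
    rw [hη, Subgroup.coe_mul, Subgroup.coe_inv, gamma0Translation]
    simp
  obtain ⟨hA, hB, hC, hD⟩ := heckeDelta_mul_iff.1 hη'
  have hA : blockA η = blockA (η' : Sp) :=
    smul_right_injective _ (show (q : ℤ) ≠ 0 by exact_mod_cast hq) hA
  have gA : blockA (γ : Sp) = blockA (η' : Sp) := by rw [hηγ, blockA_mul_translation, hA]
  have gB : blockB (γ : Sp) = blockA (η' : Sp) * S + (q : ℤ) • blockB (η' : Sp) := by
    rw [hηγ, blockB_mul_translation, hA, hB]
  have gC : (q : ℤ) • blockC (γ : Sp) = blockC (η' : Sp) := by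
    rw [hηγ, blockC_mul_translation, hC]
  have gD : blockD (γ : Sp) = blockC (γ : Sp) * S + blockD (η' : Sp) := by
    rw [hηγ, blockD_mul_translation, blockC_mul_translation, hD]
  have hdet : (((blockD (γ : Sp)).det : ℤ) : ZMod N) = (((blockD (η' : Sp)).det : ℤ) : ZMod N) := by
    have hmem : η ∈ Gamma0 N := (γ * (gamma0Translation N s t u)⁻¹).2
    rw [hηγ, det_blockD_mul hmem, hD]
    simp [translation]
  have hm (M M' : M2 ℤ) : (M * M').map (Int.cast : ℤ → ℂ) =
      M.map (Int.cast : ℤ → ℂ) * M'.map (Int.cast : ℤ → ℂ) := Matrix.map_mul (f := Int.castRingHom ℂ)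
  have ha (M M' : M2 ℤ) : (M + M').map (Int.cast : ℤ → ℂ) =
      M.map (Int.cast : ℤ → ℂ) + M'.map (Int.cast : ℤ → ℂ) :=
    Matrix.map_add _ (fun _ _ => Int.cast_add _ _) _ _
  have hsm (M : M2 ℤ) : ((q : ℤ) • M).map (Int.cast : ℤ → ℂ) =
      (q : ℂ) • M.map (Int.cast : ℤ → ℂ) := by
    ext i j
    simp only [map_apply, Matrix.smul_apply, smul_eq_mul, Int.cast_mul, Int.cast_natCast]
  have e1 : (blockC (η' : Sp)).map (Int.cast : ℤ → ℂ) *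
      ((q : ℂ)⁻¹ • (τ + S.map (Int.cast : ℤ → ℂ))) + (blockD (η' : Sp)).map (Int.cast : ℤ → ℂ) =
      (blockC (γ : Sp)).map (Int.cast : ℤ → ℂ) * τ + (blockD (γ : Sp)).map (Int.cast : ℤ → ℂ) := by
    rw [← gC, hsm, Matrix.mul_smul, Matrix.smul_mul, smul_smul, inv_mul_cancel₀ hq', one_smul, gD,
      ha, hm, Matrix.mul_add, add_assoc]
  have e2 : (blockA (η' : Sp)).map (Int.cast : ℤ → ℂ) *
      ((q : ℂ)⁻¹ • (τ + S.map (Int.cast : ℤ → ℂ))) + (blockB (η' : Sp)).map (Int.cast : ℤ → ℂ) =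
      (q : ℂ)⁻¹ • ((blockA (γ : Sp)).map (Int.cast : ℤ → ℂ) * τ +
        (blockB (γ : Sp)).map (Int.cast : ℤ → ℂ)) := by
    rw [gA, gB, ha, hm, hsm, Matrix.mul_smul, smul_add, smul_add, smul_smul, inv_mul_cancel₀ hq',
      one_smul, Matrix.mul_add, smul_add, add_assoc]
  have hne := det_add_ne_zero hτ (γ : Sp)
  rw [slash_heckeDelta_inv k _ hq, h.eisenstein_transform η'
    (τ := (q : ℂ)⁻¹ • (τ + S.map (Int.cast : ℤ → ℂ)))
    (σ := (q : ℂ)⁻¹ • (((blockA (γ : Sp)).map (Int.cast : ℤ → ℂ) * τ +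
      (blockB (γ : Sp)).map (Int.cast : ℤ → ℂ)) * ((blockC (γ : Sp)).map (Int.cast : ℤ → ℂ) * τ +
      (blockD (γ : Sp)).map (Int.cast : ℤ → ℂ))⁻¹)) ?_]
  · rw [e1, hdet]
    ring
  · rw [e1, e2, Matrix.smul_mul, Matrix.mul_assoc, nonsing_inv_mul _ (isUnit_iff_ne_zero.2 hne),
      Matrix.mul_one]

/-- At a prime `q` dividing the level, `T(q)` is given by translations. -/
lemma CuspData.heckeT_eq (h : CuspData N χ rk d) {q : ℕ} [NeZero q] (hqN : q ∣ N) {τ : M2 ℂ}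
    (hτ : τ ∈ upperHalfSpace) :
    heckeT N k χ q (eisenstein N k χ (cuspElt d)) τ = (q : ℂ) ^ (-3 : ℤ) *
      ∑ s : ZMod q, ∑ t : ZMod q, ∑ u : ZMod q, eisenstein N k χ (cuspElt d)
        ((q : ℂ)⁻¹ • (τ + (!![(s.val : ℤ), t.val; t.val, u.val] : M2 ℤ).map (Int.cast : ℤ → ℂ))) := by
  have hq := NeZero.ne q
  have hq' : (q : ℂ) ≠ 0 := by exact_mod_cast hq
  rw [heckeT, ← finsum_eq_of_bijective (translationCoset N q)
    (f := fun S : ZMod q × ZMod q × ZMod q => (q : ℂ) ^ (-(k : ℤ)) * eisenstein N k χ (cuspElt d)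
      ((q : ℂ)⁻¹ • (τ + (!![(S.1.val : ℤ), S.2.1.val; S.2.1.val, S.2.2.val] : M2 ℤ).map
        (Int.cast : ℤ → ℂ)))) (translationCoset_bijective hqN),
    finsum_eq_sum_of_fintype, Fintype.sum_prod_type]
  · simp only [Fintype.sum_prod_type, ← Finset.mul_sum]
    rw [← mul_assoc, ← zpow_add₀ hq']
    congr 2
    ring
  · intro S
    refine (h.hecke_summand hq hτ ?_).symm
    rw [← QuotientGroup.rightRel_apply]
    apply Quotient.exact
    exact (Quotient.out_eq _).symm

end

/-! ### The action of the Hecke operator on the series. -/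

lemma weight_ne_zero {N : ℕ} {χ : DirichletCharacter ℂ N} {rk : ℕ → Fin 3} {v : Plucker}
    (h : weight N χ rk v ≠ 0) : v.IsCone ∧ v.IsPrimitive ∧
      ∀ p ∈ N.primeFactors, localFactor (component χ p) (rk p) v ≠ 0 := by
  rw [weight] at h
  split_ifs at h with h1
  · exact ⟨h1.1, h1.2, Finset.prod_ne_zero_iff.1 h⟩
  · exact absurd rfl h

open Classical in
/-- The coefficient at `v` of the term `S = (s t; t u)` of the Hecke operator `T(q)`. -/
noncomputable def heckeWeight (N : ℕ) (χ : DirichletCharacter ℂ N) (rk : ℕ → Fin 3) (q : ℕ)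
    (s t u : ℤ) (v : Plucker) : ℂ :=
  if (q : ℤ) ∣ v.residue s t u then weight N χ rk (v.heckePreimage q s t u) else 0

section
variable {N : ℕ} {χ : DirichletCharacter ℂ N} {rk : ℕ → Fin 3} {q : ℕ} {s t u : ℤ} {v : Plucker}

lemma norm_heckeWeight_le : ‖heckeWeight N χ rk q s t u v‖ ≤ 1 := by
  rw [heckeWeight]
  split_ifs
  · exact norm_weight_le _ _ _ _
  · simp

lemma heckeWeight_ne_zero (hN : N ≠ 0) (hq : q.Prime) (hqN : q ∣ N) (hrk : rk q = 1)
    (h : heckeWeight N χ rk q s t u v ≠ 0) : v.IsCone ∧ v.IsPrimitive := by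
  rw [heckeWeight] at h
  split_ifs at h with hr
  · obtain ⟨h1, h2, h3⟩ := weight_ne_zero h
    have h4 := h3 q (Nat.mem_primeFactors.2 ⟨hq, hqN, hN⟩)
    rw [hrk] at h4
    exact ⟨(isCone_heckePreimage_iff hr).1 h1, (isPrimitive_heckePreimage_iff hq hr h4).1 h2⟩
  · exact absurd rfl h

/-- The defining property of `heckePreimage`: its coordinates are chosen so that substituting (τ +
S)/q gives back the form of v up to the factor 1/q. -/
lemma Plucker.lin_heckePreimage (hq : q ≠ 0) {τ : M2 ℂ} (hτ : τ.IsSymm)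
    (hr : (q : ℤ) ∣ v.residue s t u) :
    (v.heckePreimage q s t u).lin ((q : ℂ)⁻¹ • (τ + (!![s, t; t, u] : M2 ℤ).map
      (Int.cast : ℤ → ℂ))) = (q : ℂ)⁻¹ * v.lin τ := by
  have hq' : (q : ℂ) ≠ 0 := by exact_mod_cast hq
  have h := congrArg (Int.cast : ℤ → ℂ) (mul_heckePreimage_d hr)
  have hs : τ 1 0 = τ 0 1 := hτ.apply 0 1
  push_cast at h
  have hd : ((v.heckePreimage q s t u).d : ℂ) = (q : ℂ)⁻¹ * (v.residue s t u : ℤ) := by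
    rw [← h, inv_mul_cancel_left₀ hq']
  simp only [lin, hd]
  simp only [heckePreimage, residue, det_fin_two, Matrix.smul_apply, Matrix.add_apply, map_apply,
    of_apply, cons_val', cons_val_zero, cons_val_one, cons_val_fin_one, smul_eq_mul, hs]
  push_cast
  field_simp
  ring

lemma Plucker.heckePreimage_injOn (hq : q ≠ 0) :
    Set.InjOn (heckePreimage q s t u) {v | (q : ℤ) ∣ v.residue s t u} := by
  intro v hv w hw h
  have hq' : (q : ℤ) ≠ 0 := by exact_mod_cast hq
  have ed := mul_heckePreimage_d hv
  rw [h, mul_heckePreimage_d hw] at ed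
  simp only [heckePreimage, Plucker.mk.injEq] at h
  obtain ⟨h1, h2, h3, h4, -⟩ := h
  have ha : v.a = w.a := mul_left_cancel₀ hq' h1
  rw [ha] at h2 h3 h4
  have hx : v.x = w.x := by linarith
  have hy : v.y = w.y := by linarith
  have hz : v.z = w.z := by linarith
  simp only [residue, ha, hx, hy, hz] at ed
  exact Plucker.ext ha hx hy hz (by linarith)

lemma Plucker.exists_heckePreimage_eq (hq : q ≠ 0) (h : (q : ℤ) ∣ v.a) :
    ∃ w : Plucker, (q : ℤ) ∣ w.residue s t u ∧ w.heckePreimage q s t u = v := by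
  have hq' : (q : ℤ) ≠ 0 := by exact_mod_cast hq
  obtain ⟨b, hb⟩ := h
  set w : Plucker := ⟨b, v.x + b * u, v.y - b * t, v.z + b * s,
    q * v.d + v.x * s + 2 * v.y * t + v.z * u + b * (s * u - t ^ 2)⟩ with hw
  have e : w.residue s t u = q * v.d := by
    simp only [residue, hw]
    ring
  refine ⟨w, ⟨_, e⟩, ?_⟩
  have hd : (w.heckePreimage q s t u).d = v.d := by
    simp only [heckePreimage]
    rw [e, Int.mul_ediv_cancel_left _ hq']
  refine Plucker.ext ?_ ?_ ?_ ?_ hd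
  · exact hb.symm
  · simp [heckePreimage, hw]
  · simp [heckePreimage, hw]
  · simp [heckePreimage, hw]

/-- Substitute `heckePreimage` for the summation variable. It is injective on points with divisible
residue and reaches every point with q ∣ a, in particular the whole support of a weight of rank one
at q. -/
lemma tsum_weight_translate (hN : N ≠ 0) (hq : q.Prime) (hqN : q ∣ N) (hrk : rk q = 1) (k : ℕ)
    {τ : M2 ℂ} (hτ : τ.IsSymm) (s t u : ℤ) :
    ∑' v : Plucker, weight N χ rk v * v.lin ((q : ℂ)⁻¹ • (τ + (!![s, t; t, u] : M2 ℤ).map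
      (Int.cast : ℤ → ℂ))) ^ (-(k : ℤ)) =
    (q : ℂ) ^ k * ∑' v : Plucker, heckeWeight N χ rk q s t u v * v.lin τ ^ (-(k : ℤ)) := by
  have hqC : (q : ℂ) ≠ 0 := by exact_mod_cast hq.ne_zero
  have hsub : ∀ v, (q : ℂ) ^ k * (heckeWeight N χ rk q s t u v * v.lin τ ^ (-(k : ℤ))) ≠ 0 →
      (q : ℤ) ∣ v.residue s t u := fun v h => by
    by_contra h'
    apply h
    rw [heckeWeight, if_neg h', zero_mul, mul_zero]
  have heq : ∀ v, (q : ℤ) ∣ v.residue s t u →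
      weight N χ rk (v.heckePreimage q s t u) * (v.heckePreimage q s t u).lin ((q : ℂ)⁻¹ •
        (τ + (!![s, t; t, u] : M2 ℤ).map (Int.cast : ℤ → ℂ))) ^ (-(k : ℤ)) =
      (q : ℂ) ^ k * (heckeWeight N χ rk q s t u v * v.lin τ ^ (-(k : ℤ))) := fun v hv => by
    rw [lin_heckePreimage hq.ne_zero hτ hv, heckeWeight, if_pos hv, mul_zpow, _root_.inv_zpow,
      _root_.zpow_neg (q : ℂ), inv_inv, zpow_natCast]
    ring
  rw [← tsum_mul_left]
  refine tsum_eq_tsum_of_ne_zero_bij (fun v => heckePreimage q s t u v) ?_ ?_ ?_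
  · intro v w h
    exact Subtype.ext (heckePreimage_injOn hq.ne_zero (hsub _ v.2) (hsub _ w.2) h)
  · intro v hv
    have h3 := (weight_ne_zero (left_ne_zero_of_mul hv)).2.2 q
      (Nat.mem_primeFactors.2 ⟨hq, hqN, hN⟩)
    rw [hrk] at h3
    obtain ⟨w, hw, rfl⟩ := exists_heckePreimage_eq (s := s) (t := t) (u := u) hq.ne_zero
      (hasRank_of_localFactor_ne_zero hq h3).1
    refine ⟨⟨w, ?_⟩, rfl⟩
    rw [Function.mem_support, ← heq w hw]
    exact hv
  · intro v
    exact heq v (hsub _ v.2)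

end

section
variable {N k : ℕ} {χ : DirichletCharacter ℂ N} {rk : ℕ → Fin 3} {d d' : Fin 2 → ℤ}

lemma summable_weight (hk : 4 ≤ k) {τ : M2 ℂ} (hτ : τ ∈ upperHalfSpace) :
    Summable fun v : Plucker => weight N χ rk v * v.lin τ ^ (-(k : ℤ)) :=
  summable_mul_lin hτ hk (norm_weight_le N χ rk) fun _ h =>
    ⟨(weight_ne_zero h).1, (weight_ne_zero h).2.1⟩

/-- The action of `T(q)` on an Eisenstein series whose cusp has rank one at `q`. -/
lemma CuspData.heckeT_eisenstein (h : CuspData N χ rk d) {q : ℕ} (hq : q.Prime) (hqN : q ∣ N)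
    (hrk : rk q = 1) (h' : CuspData N χ (Function.update rk q 2) d') (hk : 4 ≤ k) {τ : M2 ℂ}
    (hτ : τ ∈ upperHalfSpace) :
    heckeT N k χ q (eisenstein N k χ (cuspElt d)) τ =
      (∏ p ∈ N.primeFactors.erase q, if rk p = 1 then 1 else component χ p (q : ZMod p)) *
        ((q : ℂ) ^ (k - 1) * eisenstein N k χ (cuspElt d) τ + (q : ℂ) ^ (k - 3) *
          ((q + 1) * ∑ᶠ w : ZMod q, component χ q w) * eisenstein N k χ (cuspElt d') τ) := by
  have := Fact.mk hq
  have hN := h.squarefree.ne_zero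
  have hqC : (q : ℂ) ≠ 0 := by exact_mod_cast hq.ne_zero
  have hs (s t u : ℤ) : Summable fun v : Plucker =>
      heckeWeight N χ rk q s t u v * v.lin τ ^ (-(k : ℤ)) :=
    summable_mul_lin hτ hk (fun _ => norm_heckeWeight_le) fun _ => heckeWeight_ne_zero hN hq hqN hrk
  rw [h.heckeT_eq hqN hτ, finsum_eq_sum_of_fintype]
  simp only [h.eisenstein_eq_tsum, h'.eisenstein_eq_tsum,
    tsum_weight_translate hN hq hqN hrk k hτ.1]
  simp only [← Finset.mul_sum]
  have hsum : ∑ s : ZMod q, ∑ t : ZMod q, ∑ u : ZMod q, ∑' v : Plucker,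
      heckeWeight N χ rk q s.val t.val u.val v * v.lin τ ^ (-(k : ℤ)) =
      ∑' v : Plucker, (∑ s : ZMod q, ∑ t : ZMod q, ∑ u : ZMod q,
        heckeWeight N χ rk q s.val t.val u.val v) * v.lin τ ^ (-(k : ℤ)) := by
    simp only [Finset.sum_mul]
    -- Absolute convergence lets the finite sum over S be taken inside the series.
    rw [Summable.tsum_finsetSum fun _ _ => summable_sum fun _ _ => summable_sum fun _ _ => hs _ _ _]
    refine Finset.sum_congr rfl fun s _ => ?_
    rw [Summable.tsum_finsetSum fun _ _ => summable_sum fun _ _ => hs _ _ _]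
    refine Finset.sum_congr rfl fun t _ => ?_
    rw [Summable.tsum_finsetSum fun _ _ => hs _ _ _]
  rw [hsum]
  simp only [heckeWeight]
  simp only [sum_weight_heckePreimage h.squarefree χ rk hqN hrk]
  set C : ℂ := ∏ p ∈ N.primeFactors.erase q, if rk p = 1 then 1 else component χ p (q : ZMod p)
  set G : ℂ := ∑ w : ZMod q, component χ q w
  have e : ∀ v : Plucker, C * ((q : ℂ) ^ 2 * weight N χ rk v +
      (q + 1) * G * weight N χ (Function.update rk q 2) v) * v.lin τ ^ (-(k : ℤ)) =
      C * (q : ℂ) ^ 2 * (weight N χ rk v * v.lin τ ^ (-(k : ℤ))) + C * ((q + 1) * G) *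
        (weight N χ (Function.update rk q 2) v * v.lin τ ^ (-(k : ℤ))) := fun v => by ring
  simp only [e]
  rw [((summable_weight hk hτ).mul_left _).tsum_add ((summable_weight hk hτ).mul_left _),
    tsum_mul_left, tsum_mul_left]
  have e1 : (q : ℂ) ^ k = (q : ℂ) ^ (k - 3) * (q : ℂ) ^ 3 := by
    rw [← pow_add]; congr 1; omega
  have e2 : (q : ℂ) ^ (k - 1) = (q : ℂ) ^ (k - 3) * (q : ℂ) ^ 2 := by
    rw [← pow_add]; congr 1; omega
  have e3 : (q : ℂ) ^ (-3 : ℤ) * (q : ℂ) ^ 3 = 1 := by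
    rw [show (-3 : ℤ) = -((3 : ℕ) : ℤ) by norm_num, _root_.zpow_neg, zpow_natCast]
    exact inv_mul_cancel₀ (pow_ne_zero _ hqC)
  rw [e1, e2]
  linear_combination (1 / 2 * (q : ℂ) ^ (k - 3) * C * ((q : ℂ) ^ 2 * ∑' v : Plucker,
    weight N χ rk v * v.lin τ ^ (-(k : ℤ)) + (q + 1) * G * ∑' v : Plucker,
    weight N χ (Function.update rk q 2) v * v.lin τ ^ (-(k : ℤ)))) * e3

end

/-! ### From ranks at primes back to factorizations of the level. -/

/-- The rank of a cusp of type `(N₀, N₁, N₂)` at the primes dividing the level. -/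
def cuspRank (N₀ N₁ p : ℕ) : Fin 3 := if p ∣ N₀ then 0 else if p ∣ N₁ then 1 else 2

lemma IsCuspDiag.diagCongr {N₀ N₁ N₂ : ℕ} {d : Fin 2 → ℤ} (hd : IsCuspDiag N₀ N₁ N₂ d) {p : ℕ}
    (hp : p.Prime) : (p ∣ N₀ → DiagCongr p 0 d) ∧ (p ∣ N₁ → DiagCongr p 1 d) ∧
      (p ∣ N₂ → DiagCongr p 2 d) := by
  have hdvd (n : ℤ) : (n : ZMod p) = 0 → (p : ℤ) ∣ n := dvd_of_intCast_eq_zero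
  have hdvd1 (n : ℤ) (h : (n : ZMod p) = 1) : (p : ℤ) ∣ n - 1 := hdvd _ (by push_cast; rw [h]; simp)
  obtain ⟨h0, h1, h2⟩ := hd p hp
  refine ⟨fun h => ?_, fun h => ?_, fun h => ?_⟩
  · have e := congrFun (congrFun (h0 h) 0) 0
    have e' := congrFun (congrFun (h0 h) 1) 1
    exact ⟨hdvd _ (by simpa using e), hdvd _ (by simpa using e')⟩
  · have e := congrFun (congrFun (h1 h) 0) 0
    have e' := congrFun (congrFun (h1 h) 1) 1
    exact ⟨hdvd1 _ (by simpa using e), hdvd _ (by simpa using e')⟩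
  · have e := congrFun (congrFun (h2 h) 0) 0
    have e' := congrFun (congrFun (h2 h) 1) 1
    exact ⟨hdvd1 _ (by simpa using e), hdvd1 _ (by simpa using e')⟩

lemma CuspData.of_isCuspDiag {N N₀ N₁ N₂ : ℕ} (hN : Squarefree N) (hρ : N₀ * N₁ * N₂ = N)
    {χ : DirichletCharacter ℂ N} (hχ : component χ N₁ ^ 2 = 1) {d : Fin 2 → ℤ}
    (hd : IsCuspDiag N₀ N₁ N₂ d) : CuspData N χ (cuspRank N₀ N₁) d where
  squarefree := hN
  congr p hp hpN := by
    obtain ⟨h0, h1, h2⟩ := hd.diagCongr hp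
    rw [cuspRank]
    split_ifs with c0 c1
    · exact h0 c0
    · exact h1 c1
    · rw [← hρ, hp.dvd_mul, hp.dvd_mul] at hpN
      exact h2 (by tauto)
  sq_eq_one p hp hpN h := by
    rw [cuspRank] at h
    split_ifs at h with c0 c1
    · exact absurd h (by decide)
    · exact component_sq_eq_one hN ⟨N₀ * N₂, by rw [← hρ]; ring⟩ hχ hp c1
    · exact absurd h (by decide)

lemma sum_mulChar_eq {q : ℕ} (hq : q.Prime) :
    ∑ᶠ w : ZMod q, (1 : DirichletCharacter ℂ q) w = q - 1 := by
  have := Fact.mk hq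
  rw [finsum_eq_sum_of_fintype, MulChar.sum_one_eq_card_units, ZMod.card_units,
    Nat.cast_sub hq.one_le, Nat.cast_one]

lemma sum_mulChar_eq_zero {q : ℕ} (hq : q.Prime) {ψ : DirichletCharacter ℂ q} (hψ : ψ ≠ 1) :
    ∑ᶠ w : ZMod q, ψ w = 0 := by
  have := Fact.mk hq
  rw [finsum_eq_sum_of_fintype, MulChar.sum_eq_zero_of_ne_one hψ]

lemma coprime_of_squarefree_mul_mul {N₀ N₁ N₂ : ℕ} (hN : Squarefree (N₀ * N₁ * N₂)) {p : ℕ}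
    (hp : p.Prime) (h1 : p ∣ N₁) : ¬ p ∣ N₀ ∧ ¬ p ∣ N₂ := by
  rw [Nat.squarefree_iff_prime_squarefree] at hN
  constructor
  · intro h
    exact hN p hp ((mul_dvd_mul h h1).mul_right _)
  · intro h
    exact hN p hp (mul_dvd_mul (h1.mul_left _) h)

/-- The primes of N at which the rank is not one are those dividing N₀N₂, and q is not among them.
-/
lemma prod_component_eq {N N₀ N₁ N₂ : ℕ} (hN : Squarefree N) (hρ : N₀ * N₁ * N₂ = N)
    (χ : DirichletCharacter ℂ N) {q : ℕ} (hq : q.Prime) (hqN₁ : q ∣ N₁) :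
    (∏ p ∈ N.primeFactors.erase q,
      if cuspRank N₀ N₁ p = 1 then 1 else component χ p (q : ZMod p)) =
      component χ (N₀ * N₂) (q : ZMod (N₀ * N₂)) := by
  have hsq : Squarefree (N₀ * N₁ * N₂) := hρ ▸ hN
  have hm : N₀ * N₂ ∣ N := ⟨N₁, by rw [← hρ]; ring⟩
  have hm0 : N₀ * N₂ ≠ 0 := ne_zero_of_dvd_ne_zero hN.ne_zero hm
  have hco : IsCoprime (q : ℤ) ((N₀ * N₂ : ℕ) : ℤ) := by
    rw [Nat.isCoprime_iff_coprime, hq.coprime_iff_not_dvd, hq.dvd_mul]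
    have := coprime_of_squarefree_mul_mul hsq hq hqN₁
    tauto
  have key := component_eq_prod hN χ hm hco
  simp only [Int.cast_natCast] at key
  rw [key]
  symm
  apply Finset.prod_subset_one_on_sdiff
  · intro p hp
    have hp' := Nat.prime_of_mem_primeFactors hp
    have hpd := Nat.dvd_of_mem_primeFactors hp
    rw [Finset.mem_erase]
    refine ⟨?_, Nat.primeFactors_mono hm hN.ne_zero hp⟩
    rintro rfl
    have := coprime_of_squarefree_mul_mul hsq hq hqN₁
    rw [hq.dvd_mul] at hpd
    tauto
  · intro p hp
    rw [Finset.mem_sdiff, Finset.mem_erase, Nat.mem_primeFactors, Nat.mem_primeFactors] at hp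
    obtain ⟨⟨-, hp', hpN, -⟩, h2⟩ := hp
    rw [← hρ, hp'.dvd_mul, hp'.dvd_mul] at hpN
    rw [hp'.dvd_mul] at h2
    have h0 : ¬ p ∣ N₀ := by tauto
    have h1 : p ∣ N₁ := by tauto
    rw [cuspRank, if_neg h0, if_pos h1, if_pos rfl]
  · intro p hp
    have hp' := Nat.prime_of_mem_primeFactors hp
    have hpd := Nat.dvd_of_mem_primeFactors hp
    rw [if_neg]
    rw [cuspRank]
    split_ifs with c0 c1
    · decide
    · have := coprime_of_squarefree_mul_mul hsq hp' c1
      rw [hp'.dvd_mul] at hpd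
      tauto
    · decide

/-- Passing from the factorization (N₀, N₁, N₂) to (N₀, N₁ / q, q N₂) changes the rank only at q,
from one to two. The condition χ_p² = 1 is then needed at fewer primes and is inherited. -/
lemma CuspData.of_isCuspDiag_div {N N₀ N₁ N₂ : ℕ} (hN : Squarefree N) (hρ : N₀ * N₁ * N₂ = N)
    {χ : DirichletCharacter ℂ N} (hχ : component χ N₁ ^ 2 = 1) {q : ℕ} (hq : q.Prime)
    (hqN₁ : q ∣ N₁) {d : Fin 2 → ℤ} (hd : IsCuspDiag N₀ (N₁ / q) (q * N₂) d) :
    CuspData N χ (Function.update (cuspRank N₀ N₁) q 2) d where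
  squarefree := hN
  congr p hp hpN := by
    obtain ⟨h0, h1, h2⟩ := hd.diagCongr hp
    by_cases hpq : p = q
    · subst hpq
      rw [Function.update_self]
      exact h2 (dvd_mul_right _ _)
    · rw [Function.update_of_ne hpq, cuspRank]
      split_ifs with c0 c1
      · exact h0 c0
      · refine h1 ((hp.dvd_mul.1 (?_ : p ∣ q * (N₁ / q))).resolve_left fun h => hpq
          ((Nat.prime_dvd_prime_iff_eq hp hq).1 h))
        rwa [Nat.mul_div_cancel' hqN₁]
      · rw [← hρ, hp.dvd_mul, hp.dvd_mul] at hpN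
        exact h2 (Dvd.dvd.mul_left (by tauto) _)
  sq_eq_one p hp hpN h := by
    by_cases hpq : p = q
    · rw [hpq, Function.update_self] at h
      exact absurd h (by decide)
    · rw [Function.update_of_ne hpq, cuspRank] at h
      split_ifs at h with c0 c1
      · exact absurd h (by decide)
      · exact component_sq_eq_one hN ⟨N₀ * N₂, by rw [← hρ]; ring⟩ hχ hp c1
      · exact absurd h (by decide)

end Siegel

theorem proposition3p6 (N N₀ N₁ N₂ : ℕ) (hN : Squarefree N) (hρ : N₀ * N₁ * N₂ = N)
    (k : ℕ) (hk : 4 ≤ k) (χ : DirichletCharacter ℂ N) (hχ : Siegel.component χ N₁ ^ 2 = 1)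
    (q : ℕ) (hq : q.Prime) (hqN₁ : q ∣ N₁)
    (d d' : Fin 2 → ℤ) (hd : Siegel.IsCuspDiag N₀ N₁ N₂ d)
    (hd' : Siegel.IsCuspDiag N₀ (N₁ / q) (q * N₂) d') :
    (Siegel.component χ q = 1 →
      ∀ τ ∈ Siegel.upperHalfSpace,
        Siegel.heckeT N k χ q (Siegel.eisenstein N k χ (Siegel.cuspElt d)) τ =
          Siegel.component χ (N₀ * N₂) (q : ZMod (N₀ * N₂)) *
            ((q : ℂ) ^ (k - 1) * Siegel.eisenstein N k χ (Siegel.cuspElt d) τ +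
              (q : ℂ) ^ (k - 3) * ((q : ℂ) ^ 2 - 1) *
                Siegel.eisenstein N k χ (Siegel.cuspElt d') τ)) ∧
    (Siegel.component χ q ≠ 1 →
      ∀ τ ∈ Siegel.upperHalfSpace,
        Siegel.heckeT N k χ q (Siegel.eisenstein N k χ (Siegel.cuspElt d)) τ =
          Siegel.component χ (N₀ * N₂) (q : ZMod (N₀ * N₂)) *
            ((q : ℂ) ^ (k - 1) * Siegel.eisenstein N k χ (Siegel.cuspElt d) τ)) := by
  have hqN₀ := (Siegel.coprime_of_squarefree_mul_mul (hρ ▸ hN) hq hqN₁).1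
  have h := Siegel.CuspData.of_isCuspDiag hN hρ hχ hd
  have hrk : Siegel.cuspRank N₀ N₁ q = 1 := by
    rw [Siegel.cuspRank, if_neg hqN₀, if_pos hqN₁]
  have h' := Siegel.CuspData.of_isCuspDiag_div hN hρ hχ hq hqN₁ hd'
  have key (τ) (hτ : τ ∈ Siegel.upperHalfSpace) := h.heckeT_eisenstein hq
    (hqN₁.trans ⟨N₀ * N₂, by rw [← hρ]; ring⟩) hrk h' hk hτ
  rw [Siegel.prod_component_eq hN hρ χ hq hqN₁] at key
  refine ⟨fun hc τ hτ => ?_, fun hc τ hτ => ?_⟩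
  -- For trivial χ_q the character sum is q - 1, and (q + 1)(q - 1) = q² - 1; in the other case it
  -- is zero and the second series drops out.
  · rw [key τ hτ, hc, Siegel.sum_mulChar_eq hq]
    ring
  · rw [key τ hτ, Siegel.sum_mulChar_eq_zero hq hc]
    ring
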